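/- Let $d\in\{2,3\}$, let $\Omega\subset\mathbb R^d$ be a bounded domain of class $C^2$, $1<\alpha<2$ and $0<T\le+\infty$. Let $a_{ij}=a_{ji}\in C^1(\overline\Omega)$ $(1\le i,j\le d)$ be real-valued with $\sum_{i,j}a_{ij}(x)\xi_i\xi_j\ge c|\xi|^2$ for some $c>0$ and all $x\in\overline\Omega$, $\xi\in\mathbb R^d$. Let $V\in L^\kappa(\Omega)$ for some $\kappa>d$, with $V\ge0$ a.e., and put $$\mathcal A u=-\sum_{i,j=1}^d\partial_{x_i}(a_{ij}\,\partial_{x_j}u)+Vu .$$ All functions are real-valued. $H^1_0(\Omega)$ is the closure of $C_c^\infty(\Omega)$ in $H^1(\Omega)$ and $H^{-1}(\Omega)$ is its dual. Below, $[0,T]$ means $[0,\infty)$ if $T=\infty$. For $u_0\in L^2(\Omega)$, $u_1\in H^{-1}(\Omega)$ and $f\in L^1(0,T;L^2(\Omega))$ consider the problem $$\partial_t^\alpha u+\mathcal A u=f\ \text{ in }(0,T)\times\Omega,\qquad u=0\ \text{ on }(0,T)\times\partial\Omega,\qquad u(0,\cdot)=u_0,\ \ \partial_tu(0,\cdot)=u_1\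 \text{ in }\Omega, \tag{P}$$ where $\partial_t^\alpha$ is the Caputo derivative of order $\alpha$. A function $u:(0,T)\to L^2(\Omega)$ is called a weak solution of (P) if there is $v\in L^\infty_{\mathrm{loc}}([0,\infty);L^2(\Omega))$ with $v=u$ a.e. on $(0,T)$ such that $\inf\{\epsilon>0:\ e^{-\epsilon t}v\in L^1(0,\infty;L^2(\Omega))\}=0$ and such that, for every $p>0$, the Laplace transform $\hat v(p)=\int_0^\infty e^{-pt}v(t)\,dt$ belongs to $H^1_0(\Omega)$ and satisfies, in $H^{-1}(\Omega)$, $$(\mathcal A+p^\alpha)\hat v(p)=\int_0^Te^{-pt}f(t)\,dt+p^{\alpha-1}u_0+p^{\alpha-2}u_1 .$$ **Theorem.** (i) There is a constant $C>0$, independent of $u_0,u_1,f$, such that for all $u_0\in L^2(\Omega)$, $u_1\in H^{-1}(\Omega)$ and $f\in L^1(0,T;L^2(\Omega))$ the problem (P) has a weak solution $u\in C([0,T];L^2(\Omega))$, every weak solution of (P) coincides with $u$ a.e. on $(0,T)$, and $$\sup_{t\in[0,T]}\|u(t)\|_{L^2(\Omega)}\le C\left(\|u_0\|_{L^2(\Omega)}+\|u_1\|_{H^{-1}(\Omega)}+\|f\|_{L^1(0,T;L^2(\Omega))}\right).$$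 (ii) Let $T<\infty$ and $0<r<\tfrac14$. There is a constant $C>0$, independent of $u_0,u_1,f$, such that whenever in addition $u_0\in H^{2r}(\Omega)$, the weak solution $u$ belongs to $W^{1,1}(0,T;L^2(\Omega))$ and $$\|u\|_{W^{1,1}(0,T;L^2(\Omega))}\le C\left(\|u_0\|_{H^{2r}(\Omega)}+\|u_1\|_{H^{-1}(\Omega)}+\|f\|_{L^1(0,T;L^2(\Omega))}\right).$$ Here $H^{2r}(\Omega)$ is the fractional Sobolev space with norm given by $$\|w\|_{H^{2r}(\Omega)}^2=\|w\|_{L^2(\Omega)}^2+\int_\Omega\int_\Omega\frac{|w(x)-w(y)|^2}{|x-y|^{d+4r}}\,dx\,dy .$$ -/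

import Mathlib

open MeasureTheory Set
open scoped ENNReal ContDiff

noncomputable section

namespace FracWave

/-- The Euclidean space `ℝ^d`. -/
abbrev Space (d : ℕ) := EuclideanSpace ℝ (Fin d)

/-- A bounded domain (nonempty, open, connected) with boundary of class `C²`: near each boundary
point, and in suitable orthonormal coordinates whose last axis points along `e`, the domain is
the region strictly above the graph of a `C²` function of the remaining coordinates. -/
structure IsC2BoundedDomain {d : ℕ} (Ω : Set (Space d)) : Prop where
  isOpen : IsOpen Ω
  isConnected : IsConnected Ω
  isBounded : Bornology.IsBounded Ω
  boundary : ∀ x₀ ∈ frontier Ω, ∃ (ρ : ℝ) (e : Space d) (γ : Space d → ℝ),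
    0 < ρ ∧ ‖e‖ = 1 ∧ ContDiff ℝ 2 γ ∧
      ∀ x ∈ Metric.ball x₀ ρ, (x ∈ Ω ↔ γ (x - inner ℝ x e • e) < inner ℝ x e)

/-- The real Hilbert space `L²(Ω)`. -/
abbrev L2 {d : ℕ} (Ω : Set (Space d)) := Lp ℝ 2 (volume.restrict Ω)

/-- The partial derivative `∂_i φ`. -/
def partialDeriv {d : ℕ} (i : Fin d) (φ : Space d → ℝ) (x : Space d) : ℝ :=
  fderiv ℝ φ x (EuclideanSpace.single i 1)

/-- The Hilbert space `L²(Ω) × L²(Ω)^d`, with `‖(u, g)‖² = ‖u‖² + ∑ i, ‖g i‖²`. A function `u` of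
`H¹(Ω)` is represented in it by the pair `(u, ∇u)`, whose norm is the `H¹` norm of `u`. -/
abbrev GraphSpace {d : ℕ} (Ω : Set (Space d)) :=
  WithLp 2 (L2 Ω × PiLp 2 (fun _ : Fin d => L2 Ω))

/-- The pairs `(φ, ∇φ)` with `φ ∈ C_c^∞(Ω)`. -/
def testGraph {d : ℕ} (Ω : Set (Space d)) : Submodule ℝ (GraphSpace Ω) where
  carrier := {w | ∃ φ : Space d → ℝ, ContDiff ℝ ∞ φ ∧ HasCompactSupport φ ∧ tsupport φ ⊆ Ω ∧
    (w.fst : Space d → ℝ) =ᵐ[volume.restrict Ω] φ ∧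
    ∀ i, (w.snd i : Space d → ℝ) =ᵐ[volume.restrict Ω] partialDeriv i φ}
  zero_mem' := by
    refine ⟨0, contDiff_const, HasCompactSupport.zero, by simp [tsupport], ?_, fun i => ?_⟩
    · exact Lp.coeFn_zero _ _ _
    · refine (Lp.coeFn_zero ℝ 2 (volume.restrict Ω)).trans (Filter.Eventually.of_forall ?_)
      intro x
      simp only [partialDeriv]
      rw [show (0 : Space d → ℝ) = fun _ => 0 from rfl]
      simp
  add_mem' := by
    rintro w w' ⟨φ, h1, h2, h3, h4, h5⟩ ⟨ψ, k1, k2, k3, k4, k5⟩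
    refine ⟨φ + ψ, h1.add k1, h2.add k2,
      (tsupport_add φ ψ).trans (union_subset h3 k3), ?_, fun i => ?_⟩
    · exact (Lp.coeFn_add _ _).trans (h4.add k4)
    · refine (Lp.coeFn_add (w.snd i) (w'.snd i)).trans (((h5 i).add (k5 i)).trans ?_)
      refine Filter.Eventually.of_forall fun x => ?_
      have a1 := (h1.differentiable (by simp)) x
      have a2 := (k1.differentiable (by simp)) x
      simp [partialDeriv, fderiv_add a1 a2]
  smul_mem' := by
    rintro c w ⟨φ, h1, h2, h3, h4, h5⟩
    refine ⟨c • φ, h1.const_smul c, h2.smul_left (f := fun _ => c),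
      (tsupport_smul_subset_right (fun _ => c) φ).trans h3, ?_, fun i => ?_⟩
    · exact (Lp.coeFn_smul _ _).trans (h4.const_smul c)
    · refine (Lp.coeFn_smul c (w.snd i)).trans (((h5 i).const_smul c).trans ?_)
      refine Filter.Eventually.of_forall fun x => ?_
      have a1 := (h1.differentiable (by simp)) x
      simp [partialDeriv, fderiv_const_smul a1 c]

/-- `H¹₀(Ω)`, the closure of `C_c^∞(Ω)` in the `H¹` norm. An element `w` is the pair of the function
`w.1.fst` and its weak gradient `w.1.snd`. -/
abbrev H10 {d : ℕ} (Ω : Set (Space d)) : Submodule ℝ (GraphSpace Ω) :=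
  (testGraph Ω).topologicalClosure

/-- `H⁻¹(Ω)`, the dual of `H¹₀(Ω)`, with the dual norm. -/
abbrev Hneg1 {d : ℕ} (Ω : Set (Space d)) := StrongDual ℝ (H10 Ω)

/-- The bilinear form of the operator `𝒜 w = -∑ ∂_i (a_ij ∂_j w) + V w` on `H¹₀(Ω)`. -/
def ellipticForm {d : ℕ} {Ω : Set (Space d)} (a : Fin d → Fin d → Space d → ℝ)
    (V : Space d → ℝ) (w φ : H10 Ω) : ℝ :=
  (∫ x in Ω, ∑ i, ∑ j, a i j x * w.1.snd j x * φ.1.snd i x) +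
    ∫ x in Ω, V x * w.1.fst x * φ.1.fst x

/-- `W ∈ L²(Ω)` is the (variational) solution of the Dirichlet problem
`(𝒜 + μ) W = g + ν ℓ` in `Ω`, `W = 0` on `∂Ω`, with `g ∈ L²(Ω)` and `ℓ ∈ H⁻¹(Ω)`:
`W` lies in `H¹₀(Ω)` and the equation holds in `H⁻¹(Ω)`. -/
def SolvesDirichlet {d : ℕ} {Ω : Set (Space d)} (a : Fin d → Fin d → Space d → ℝ)
    (V : Space d → ℝ) (μ : ℝ) (g : L2 Ω) (ν : ℝ) (ℓ : Hneg1 Ω) (W : L2 Ω) : Prop :=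
  ∃ w : H10 Ω, w.1.fst = W ∧ ∀ φ : H10 Ω,
    ellipticForm a V w φ + μ * (∫ x in Ω, W x * φ.1.fst x)
      = (∫ x in Ω, g x * φ.1.fst x) + ν * ℓ φ

/-- The open time interval `(0, T)`, for `0 < T ≤ ∞`. -/
def openTime (T : ℝ≥0∞) : Set ℝ := {t | 0 < t ∧ ENNReal.ofReal t < T}

/-- The time interval `[0, T]`, which is `[0, ∞)` for `T = ∞`. -/
def closedTime (T : ℝ≥0∞) : Set ℝ := {t | 0 ≤ t ∧ ENNReal.ofReal t ≤ T}

/-- The Laplace transform at `p` of `h : (0, ∞) → L²(Ω)`, `h` being extended by zero outside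
the set `S` of positive times. -/
def laplaceOn {d : ℕ} {Ω : Set (Space d)} (S : Set ℝ) (h : ℝ → L2 Ω) (p : ℝ) : L2 Ω :=
  ∫ t in S, Real.exp (-p * t) • h t

/-- `u` is a weak solution on `(0, T) × Ω` of `∂_t^α u + 𝒜 u = f`, `u = 0` on the lateral boundary,
`u(0) = u₀`, `∂_t u(0) = u₁`: it is the restriction to `(0, T)` of some
`v ∈ L^∞_loc([0, ∞); L²(Ω))` with `inf {ε > 0 | e^{-εt} v ∈ L¹(0, ∞; L²(Ω))} = 0`, whose Laplace
transform `v̂` satisfies `(𝒜 + p^α) v̂(p) = F(p) + p^{α-1} u₀ + p^{α-2} u₁` in `Ω`,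
`v̂(p) = 0` on `∂Ω`, for all `p > 0`, with `F` the Laplace transform of `f 1_{(0,T)}`. -/
def IsWeakSolution {d : ℕ} {Ω : Set (Space d)} (a : Fin d → Fin d → Space d → ℝ)
    (V : Space d → ℝ) (α : ℝ) (T : ℝ≥0∞) (u₀ : L2 Ω) (u₁ : Hneg1 Ω) (f : ℝ → L2 Ω)
    (u : ℝ → L2 Ω) : Prop :=
  ∃ v : ℝ → L2 Ω,
    (∀ R : ℝ, 0 < R → MemLp v (⊤ : ℝ≥0∞) (volume.restrict (Ioo 0 R))) ∧
    v =ᵐ[volume.restrict (openTime T)] u ∧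
    IsGLB {ε : ℝ | 0 < ε ∧ IntegrableOn (fun t => Real.exp (-ε * t) • v t) (Ioi 0)} 0 ∧
    ∀ p : ℝ, 0 < p →
      SolvesDirichlet a V (p ^ α) (laplaceOn (openTime T) f p + p ^ (α - 1) • u₀)
        (p ^ (α - 2)) u₁ (laplaceOn (Ioi 0) v p)

/-- The square of the Gagliardo (Sobolev–Slobodeckij) seminorm of order `s` on `Ω`. -/
def gagliardoSq {d : ℕ} {Ω : Set (Space d)} (s : ℝ) (u : L2 Ω) : ℝ≥0∞ :=
  ∫⁻ x in Ω, ∫⁻ y in Ω, ENNReal.ofReal (|u x - u y| ^ 2 / ‖x - y‖ ^ ((d : ℝ) + 2 * s))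

/-- `u ∈ H^s(Ω)`, for `0 < s < 1`. -/
def MemHs {d : ℕ} {Ω : Set (Space d)} (s : ℝ) (u : L2 Ω) : Prop := gagliardoSq s u < (⊤ : ℝ≥0∞)

/-- The norm of `H^s(Ω)`, for `0 < s < 1` and `u ∈ H^s(Ω)`. -/
def hsNorm {d : ℕ} {Ω : Set (Space d)} (s : ℝ) (u : L2 Ω) : ℝ :=
  Real.sqrt (‖u‖ ^ 2 + (gagliardoSq s u).toReal)

/-- `u ∈ W^{1,1}(S; L²(Ω))` with weak time derivative `g`, for an open set `S` of times. -/
def HasW11Deriv {d : ℕ} {Ω : Set (Space d)} (S : Set ℝ) (u g : ℝ → L2 Ω) : Prop :=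
  IntegrableOn u S ∧ IntegrableOn g S ∧
    ∀ η : ℝ → ℝ, ContDiff ℝ ∞ η → HasCompactSupport η → tsupport η ⊆ S →
      ∫ t in S, deriv η t • u t = -∫ t in S, η t • g t

end FracWave

end

open MeasureTheory Set
open scoped ENNReal ContDiff

noncomputable section

namespace FracWave

/-! ### The Laplace transform of Banach-space valued functions -/

section Laplace

variable {E : Type*} [NormedAddCommGroup E] [NormedSpace ℝ E]

/-! The equation is reduced to a bounded operator and solved in the Laplace variable. Let `R` be the
inverse of `𝒜` with Dirichlet condition: bounded, symmetric, nonnegative and injective on `L²(Ω)`.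
Applying `R` to the transformed equation gives `(1 + p^α R) v̂ = R (f̂ + p^(α-1) u₀) + p^(α-2) 𝒜⁻¹
u₁` (`exists_inverse_ellipticForm`). From there on the operator enters only through a continuous
functional calculus of `R` on `[0, ‖R‖]` (`exists_isCalculus`), whose variable `μ` plays the role of
an inverse eigenvalue. Uniqueness holds because `1 + p^α R` is injective and so is the Laplace
transform.

Existence needs the inverse transforms of `p^β / (1 + μ p^α)`. Since `α < 2`, the function `1 / (1 +
μ z^α)` is holomorphic up to a ray of some direction `θ > π/2`, along which `e^(tz)` decays. The
function `ray` is the corresponding ray integral; a Cauchy formula shows that it has the right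
transform (`laplace_ray`), and it satisfies `μ^η |ray| ≤ C t^(αη-β-1)` uniformly in `μ` for `0 ≤ η ≤
1`, `αη < β + 1` (`exists_rpow_mul_ray_le`). Three propagators result. For `u₀` the symbol is `μ
p^(α-1) / (1 + μ p^α)`. It is the excluded endpoint of this estimate, but it is still bounded in
time (`exists_mul_ray_bounded`). For `u₁`, Cauchy–Schwarz for the elliptic form puts `𝒜⁻¹ u₁` in the
range of `R^(1/2)`. The time derivative of the propagator has symbol `μ^(1/2) p^(α-1) / (1 + μ
p^α)`, which is `O(t^(-α/2))` at `0` and `O(t^(-α))` at infinity, hence integrable. For `f` the time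
derivative has symbol `μ p / (1 + μ p^α)`, which is `O(t^(α-2))` at `0` and `O(t^(-2))` at infinity,
again integrable. Thus all three propagators are bounded on the whole half line, which gives (i)
with a constant that also serves `T = ∞`.

For (ii) the last two terms already have an integrable derivative. The derivative of the first is
`-ray 0` applied to `u₀`: only `O(1/t)` on `L²`, but `O(t^(α/2-1))` on the range of `R^(1/2)`, which
contains `H¹₀(Ω)`. At each time `u₀` is split into an `H¹₀` part and a remainder, with a parameter
that is a power of `t`; the sum is integrable as soon as `u₀` is approximable by `H¹₀` at a
polynomial rate and polynomial cost (`exists_integral_norm_rayMap_le`). For `u₀` in `H^s(Ω)` this is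
`IsC2BoundedDomain.exists_approx`: cut off near the boundary and mollify. The error is governed by
the Gagliardo seminorm and by the mass of `u₀` in a boundary strip, and cone conditions at the
boundary make that mass a power of the width. No description of the domains of fractional powers of
`𝒜` is needed. -/

theorem integrableOn_exp_smul_of_lt {v : ℝ → E} {ε p : ℝ} (hεp : ε ≤ p)
    (h : IntegrableOn (fun t => Real.exp (-ε * t) • v t) (Ioi 0)) :
    IntegrableOn (fun t => Real.exp (-p * t) • v t) (Ioi 0) := by
  have h1 : IntegrableOn (fun t => Real.exp (-(p - ε) * t) • (Real.exp (-ε * t) • v t)) (Ioi 0) := by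
    refine Integrable.bdd_smul h 1 (by fun_prop) ?_
    filter_upwards [ae_restrict_mem measurableSet_Ioi] with t ht
    rw [Real.norm_eq_abs, Real.abs_exp]
    apply Real.exp_le_one_iff.2
    have : (0:ℝ) < t := ht
    nlinarith
  refine h1.congr_fun (fun t _ => ?_) measurableSet_Ioi
  simp only [smul_smul, ← Real.exp_add]
  congr 2; ring

theorem integrableOn_exp_smul_of_bounded {v : ℝ → E} {C p : ℝ} (hp : 0 < p)
    (hm : AEStronglyMeasurable v (volume.restrict (Ioi 0))) (hb : ∀ t, 0 < t → ‖v t‖ ≤ C) :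
    IntegrableOn (fun t => Real.exp (-p * t) • v t) (Ioi 0) := by
  refine Integrable.smul_bdd (integrableOn_exp_mul_Ioi (a := -p) (by linarith) 0) C hm ?_
  filter_upwards [ae_restrict_mem measurableSet_Ioi] with t ht using hb t ht

theorem integrableOn_exp_smul_of_integrableOn {v : ℝ → E} {p : ℝ} (hp : 0 ≤ p)
    (h : IntegrableOn v (Ioi 0)) :
    IntegrableOn (fun t => Real.exp (-p * t) • v t) (Ioi 0) :=
  integrableOn_exp_smul_of_lt (ε := 0) hp (by simpa using h)

theorem integral_exp_neg_mul_Ioi {p : ℝ} (hp : 0 < p) :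
    ∫ t in Ioi (0:ℝ), Real.exp (-p * t) = 1 / p := by
  rw [integral_exp_mul_Ioi (by linarith)]
  simp [neg_div_neg_eq]

/-- A monomial in `e^(-t)` times the weight `e^(-t)` is the Laplace kernel at the integer `n + 1`;
the weight keeps `p` positive when `n = 0`. -/
theorem integral_polynomial_exp_smul_eq_zero {v : ℝ → E}
    (hint : ∀ p : ℝ, 0 < p → IntegrableOn (fun t => Real.exp (-p * t) • v t) (Ioi 0))
    (h0 : ∀ p : ℝ, 0 < p → ∫ t in Ioi (0:ℝ), Real.exp (-p * t) • v t = 0)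
    (P : Polynomial ℝ) :
    IntegrableOn (fun t => P.eval (Real.exp (-t)) • (Real.exp (-t) • v t)) (Ioi 0) ∧
    ∫ t in Ioi (0:ℝ), P.eval (Real.exp (-t)) • (Real.exp (-t) • v t) = 0 := by
  induction P using Polynomial.induction_on' with
  | add P Q hP hQ =>
    simp only [Polynomial.eval_add, add_smul]
    refine ⟨hP.1.add hQ.1, ?_⟩
    rw [integral_add hP.1 hQ.1, hP.2, hQ.2, add_zero]
  | monomial n a =>
    have e : ∀ t : ℝ, (Polynomial.monomial n a).eval (Real.exp (-t)) • (Real.exp (-t) • v t)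
        = a • (Real.exp (-((n:ℝ) + 1) * t) • v t) := by
      intro t
      rw [Polynomial.eval_monomial, smul_smul, smul_smul, ← Real.exp_nat_mul, mul_assoc,
        ← Real.exp_add]
      congr 3; ring
    simp only [e]
    have hn : (0:ℝ) < (n:ℝ) + 1 := by positivity
    refine ⟨(hint _ hn).smul a, ?_⟩
    rw [integral_smul, h0 _ hn, smul_zero]

/-- Since `e^(-t)` ranges in `[0, 1]`, Weierstrass approximates `g` uniformly there by polynomials,
with an error weighted by the finite `L¹` norm of `e^(-t) v`. -/
theorem integral_comp_exp_smul_eq_zero {v : ℝ → E}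
    (hint : ∀ p : ℝ, 0 < p → IntegrableOn (fun t => Real.exp (-p * t) • v t) (Ioi 0))
    (h0 : ∀ p : ℝ, 0 < p → ∫ t in Ioi (0:ℝ), Real.exp (-p * t) • v t = 0)
    {g : ℝ → ℝ} (hg : Continuous g) :
    ∫ t in Ioi (0:ℝ), g (Real.exp (-t)) • (Real.exp (-t) • v t) = 0 := by
  have hw : IntegrableOn (fun t => Real.exp (-t) • v t) (Ioi 0) := by
    simpa using hint 1 one_pos
  have hmem : ∀ t ∈ Ioi (0:ℝ), Real.exp (-t) ∈ Icc (0:ℝ) 1 := fun t ht =>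
    ⟨(Real.exp_pos _).le, Real.exp_le_one_iff.2 (by simpa using (le_of_lt ht : (0:ℝ) ≤ t))⟩
  obtain ⟨B, hB⟩ := isCompact_Icc.exists_bound_of_continuousOn (s := Icc (0:ℝ) 1) hg.continuousOn
  have hgi : IntegrableOn (fun t => g (Real.exp (-t)) • (Real.exp (-t) • v t)) (Ioi 0) := by
    refine Integrable.bdd_smul hw B (Continuous.aestronglyMeasurable (by fun_prop)) ?_
    filter_upwards [ae_restrict_mem measurableSet_Ioi] with t ht using hB _ (hmem t ht)
  rw [← norm_le_zero_iff]
  refine le_of_forall_pos_le_add fun ε hε => ?_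
  set I := ∫ t in Ioi (0:ℝ), ‖Real.exp (-t) • v t‖
  have hI : 0 ≤ I := integral_nonneg fun _ => norm_nonneg _
  obtain ⟨P, hP⟩ := exists_polynomial_near_of_continuousOn 0 1 g hg.continuousOn (ε / (I + 1))
    (by positivity)
  obtain ⟨hPi, hP0⟩ := integral_polynomial_exp_smul_eq_zero hint h0 P
  rw [← sub_zero (∫ t in Ioi (0:ℝ), g (Real.exp (-t)) • (Real.exp (-t) • v t)), ← hP0,
    ← integral_sub hgi hPi]
  calc _ ≤ ∫ t in Ioi (0:ℝ), ε / (I + 1) * ‖Real.exp (-t) • v t‖ := by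
        refine norm_integral_le_of_norm_le (hw.norm.const_mul _) ?_
        filter_upwards [ae_restrict_mem measurableSet_Ioi] with t ht
        rw [← sub_smul, norm_smul]
        refine mul_le_mul_of_nonneg_right ?_ (norm_nonneg _)
        rw [norm_sub_rev]
        exact (hP _ (hmem t ht)).le
    _ = ε / (I + 1) * I := integral_const_mul _ _
    _ ≤ 0 + ε := by
        rw [zero_add, div_mul_eq_mul_div, div_le_iff₀ (by positivity)]
        nlinarith

/-- Injectivity of the Laplace transform. -/
theorem ae_eq_zero_of_laplace_eq_zero [CompleteSpace E] {v : ℝ → E}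
    (hint : ∀ p : ℝ, 0 < p → IntegrableOn (fun t => Real.exp (-p * t) • v t) (Ioi 0))
    (h0 : ∀ p : ℝ, 0 < p → ∫ t in Ioi (0:ℝ), Real.exp (-p * t) • v t = 0) :
    v =ᵐ[volume.restrict (Ioi 0)] 0 := by
  have hw : IntegrableOn (fun t => Real.exp (-t) • v t) (Ioi 0) := by
    simpa using hint 1 one_pos
  have key : ∀ᵐ t, t ∈ Ioi (0:ℝ) → Real.exp (-t) • v t = 0 := by
    refine isOpen_Ioi.ae_eq_zero_of_integral_contDiff_smul_eq_zero
      hw.locallyIntegrableOn fun φ hφ hφc hφs => ?_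
    obtain ⟨L, hL⟩ := hφc.isCompact.bddAbove
    -- The test function is pulled back by `s = e^(-t)`. Its support is bounded above, so the
    -- pullback vanishes near `s = 0`; at `s = 0` itself the convention `log 0 = 0` yields `φ 0`,
    -- which is zero because the support avoids `0`.
    have hcont : Continuous fun s : ℝ => φ (-Real.log s) := by
      rw [continuous_iff_continuousAt]
      intro s
      rcases eq_or_ne s 0 with rfl | hs
      · have : (fun _ : ℝ => (0:ℝ)) =ᶠ[nhds 0] fun s : ℝ => φ (-Real.log s) := by
          have h1 : Ioo (-(Real.exp (-(|L| + 1)))) (Real.exp (-(|L| + 1))) ∈ nhds (0:ℝ) :=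
            Ioo_mem_nhds (by simpa using Real.exp_pos _) (Real.exp_pos _)
          filter_upwards [h1] with s hs
          symm
          by_cases h : s = 0
          · subst h
            simp only [Real.log_zero, neg_zero]
            by_contra hne
            exact lt_irrefl (0:ℝ) (hφs (subset_tsupport _ hne))
          · by_contra hne
            have h2 := hL (subset_tsupport _ hne)
            have h3 : |s| < Real.exp (-(|L| + 1)) := abs_lt.2 hs
            have h4 : Real.log s < -(|L| + 1) := by
              rw [← Real.log_abs, Real.log_lt_iff_lt_exp (abs_pos.2 h)]; exact h3
            have := le_abs_self L
            linarith
        exact continuousAt_const.congr this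
      · exact hφ.continuous.continuousAt.comp (Real.continuousAt_log hs).neg
    have := integral_comp_exp_smul_eq_zero hint h0 hcont
    simp only [Real.log_exp, neg_neg] at this
    rw [← this, ← integral_indicator measurableSet_Ioi]
    congr 1; ext t
    by_cases ht : t ∈ Ioi (0:ℝ)
    · rw [indicator_of_mem ht]
    · rw [indicator_of_notMem ht]
      have : φ t = 0 := by
        by_contra hne
        exact ht (hφs (subset_tsupport _ hne))
      simp [this]
  rw [Filter.EventuallyEq, ae_restrict_iff' measurableSet_Ioi]
  filter_upwards [key] with t ht h
  simpa [(Real.exp_pos _).ne'] using ht h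

theorem ae_eq_of_laplace_eq [CompleteSpace E] {v w : ℝ → E}
    (hv : ∀ p : ℝ, 0 < p → IntegrableOn (fun t => Real.exp (-p * t) • v t) (Ioi 0))
    (hw : ∀ p : ℝ, 0 < p → IntegrableOn (fun t => Real.exp (-p * t) • w t) (Ioi 0))
    (h : ∀ p : ℝ, 0 < p → ∫ t in Ioi (0:ℝ), Real.exp (-p * t) • v t
      = ∫ t in Ioi (0:ℝ), Real.exp (-p * t) • w t) :
    v =ᵐ[volume.restrict (Ioi 0)] w := by
  have := ae_eq_zero_of_laplace_eq_zero (v := fun t => v t - w t)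
    (fun p hp => by simp only [smul_sub]; exact (hv p hp).sub (hw p hp))
    (fun p hp => by
      simp only [smul_sub]
      rw [integral_sub (hv p hp) (hw p hp), h p hp, sub_self])
  filter_upwards [this] with t ht using sub_eq_zero.1 ht

/-- Injectivity of the Laplace transform on continuous functions. -/
theorem eqOn_of_laplace_eq [CompleteSpace E] {v w : ℝ → E}
    (hvc : ContinuousOn v (Ioi 0)) (hwc : ContinuousOn w (Ioi 0))
    (hv : ∀ p : ℝ, 0 < p → IntegrableOn (fun t => Real.exp (-p * t) • v t) (Ioi 0))
    (hw : ∀ p : ℝ, 0 < p → IntegrableOn (fun t => Real.exp (-p * t) • w t) (Ioi 0))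
    (h : ∀ p : ℝ, 0 < p → ∫ t in Ioi (0:ℝ), Real.exp (-p * t) • v t
      = ∫ t in Ioi (0:ℝ), Real.exp (-p * t) • w t) :
    EqOn v w (Ioi 0) :=
  Measure.eqOn_open_of_ae_eq (ae_eq_of_laplace_eq hv hw h) isOpen_Ioi hvc hwc

end Laplace

/-! ### Convolutions and primitives on the half line, and their Laplace transforms. -/

section Convolution

variable {E F G : Type*} [NormedAddCommGroup E] [NormedSpace ℝ E] [NormedAddCommGroup F]
  [NormedSpace ℝ F] [NormedAddCommGroup G] [NormedSpace ℝ G]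

/-- The convolution `∫₀ᵗ L (f s) (K (t - s)) ds` of functions on the half line. -/
def halfConv (L : E →L[ℝ] F →L[ℝ] G) (f : ℝ → E) (K : ℝ → F) : ℝ → G :=
  convolution ((Ioi 0).indicator f) ((Ioi 0).indicator K) L volume

/-- The factorisation `e^(-pt) = e^(-ps) e^(-p(t-s))` passes the weight to both factors, which
reduces transforms of convolutions to plain integrals of convolutions. -/
theorem exp_smul_halfConv (L : E →L[ℝ] F →L[ℝ] G) (f : ℝ → E) (K : ℝ → F) (p : ℝ) :
    (fun t => Real.exp (-p * t) • halfConv L f K t) =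
      halfConv L (fun t => Real.exp (-p * t) • f t) (fun t => Real.exp (-p * t) • K t) := by
  ext t
  simp only [halfConv, convolution]
  rw [← integral_smul]
  congr 1; ext s
  have e1 : ∀ r : ℝ, (Ioi 0).indicator (fun t => Real.exp (-p * t) • f t) r
      = Real.exp (-p * r) • (Ioi 0).indicator f r := fun r => by
    by_cases h : r ∈ Ioi (0:ℝ) <;> simp [h]
  have e2 : ∀ r : ℝ, (Ioi 0).indicator (fun t => Real.exp (-p * t) • K t) r
      = Real.exp (-p * r) • (Ioi 0).indicator K r := fun r => by
    by_cases h : r ∈ Ioi (0:ℝ) <;> simp [h]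
  rw [e1, e2]
  simp only [map_smul, smul_apply, smul_smul, ← Real.exp_add]
  congr 2; ring

theorem halfConv_of_nonpos (L : E →L[ℝ] F →L[ℝ] G) (f : ℝ → E) (K : ℝ → F) {t : ℝ} (ht : t ≤ 0) :
    halfConv L f K t = 0 := by
  simp only [halfConv, convolution]
  rw [← integral_zero ℝ G]
  congr 1; ext s
  by_cases h : s ∈ Ioi (0:ℝ)
  · have : t - s ∉ Ioi (0:ℝ) := by
      simp only [mem_Ioi, not_lt] at h ⊢; linarith
    rw [indicator_of_notMem this, map_zero]
  · rw [indicator_of_notMem h]; simp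

theorem integrable_halfConv (L : E →L[ℝ] F →L[ℝ] G) {f : ℝ → E} {K : ℝ → F}
    (hf : IntegrableOn f (Ioi 0)) (hK : IntegrableOn K (Ioi 0)) : Integrable (halfConv L f K) :=
  Integrable.integrable_convolution L (hf.integrable_indicator measurableSet_Ioi)
    (hK.integrable_indicator measurableSet_Ioi)

theorem integral_halfConv [CompleteSpace E] [CompleteSpace F] [CompleteSpace G]
    (L : E →L[ℝ] F →L[ℝ] G) {f : ℝ → E} {K : ℝ → F}
    (hf : IntegrableOn f (Ioi 0)) (hK : IntegrableOn K (Ioi 0)) :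
    ∫ t in Ioi (0:ℝ), halfConv L f K t = L (∫ t in Ioi (0:ℝ), f t) (∫ t in Ioi (0:ℝ), K t) := by
  rw [setIntegral_eq_integral_of_forall_compl_eq_zero
    (s := Ioi 0) (fun t ht => halfConv_of_nonpos L f K (not_lt.1 ht)), halfConv,
    integral_convolution L (hf.integrable_indicator measurableSet_Ioi)
    (hK.integrable_indicator measurableSet_Ioi), integral_indicator measurableSet_Ioi,
    integral_indicator measurableSet_Ioi]

theorem integrableOn_exp_smul_halfConv (L : E →L[ℝ] F →L[ℝ] G) {f : ℝ → E} {K : ℝ → F} {p : ℝ}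
    (hf : IntegrableOn (fun t => Real.exp (-p * t) • f t) (Ioi 0))
    (hK : IntegrableOn (fun t => Real.exp (-p * t) • K t) (Ioi 0)) :
    IntegrableOn (fun t => Real.exp (-p * t) • halfConv L f K t) (Ioi 0) := by
  rw [exp_smul_halfConv]
  exact (integrable_halfConv L hf hK).integrableOn

theorem laplace_halfConv [CompleteSpace E] [CompleteSpace F] [CompleteSpace G]
    (L : E →L[ℝ] F →L[ℝ] G) {f : ℝ → E} {K : ℝ → F} {p : ℝ}
    (hf : IntegrableOn (fun t => Real.exp (-p * t) • f t) (Ioi 0))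
    (hK : IntegrableOn (fun t => Real.exp (-p * t) • K t) (Ioi 0)) :
    ∫ t in Ioi (0:ℝ), Real.exp (-p * t) • halfConv L f K t
      = L (∫ t in Ioi (0:ℝ), Real.exp (-p * t) • f t)
          (∫ t in Ioi (0:ℝ), Real.exp (-p * t) • K t) := by
  rw [← integral_halfConv L hf hK, exp_smul_halfConv]

theorem norm_halfConv_le (L : E →L[ℝ] F →L[ℝ] G) {f : ℝ → E} {K : ℝ → F} {C : ℝ}
    (hL : ∀ x y, ‖L x y‖ ≤ ‖x‖ * ‖y‖) (hf : IntegrableOn f (Ioi 0)) (hC : 0 ≤ C) (hK : ∀ t, 0 < t → ‖K t‖ ≤ C)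
    (t : ℝ) : ‖halfConv L f K t‖ ≤ C * ∫ s in Ioi (0:ℝ), ‖f s‖ := by
  have h1 : ∀ s, ‖(Ioi (0:ℝ)).indicator K s‖ ≤ C := fun s => by
    by_cases h : s ∈ Ioi (0:ℝ)
    · rw [indicator_of_mem h]; exact hK s h
    · rw [indicator_of_notMem h]; simpa using hC
  calc ‖halfConv L f K t‖ ≤ ∫ s, C * (Ioi (0:ℝ)).indicator (fun s => ‖f s‖) s := by
        refine norm_integral_le_of_norm_le (((integrable_indicator_iff measurableSet_Ioi).2 hf.norm).const_mul C)
          (Filter.Eventually.of_forall fun s => ?_)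
        calc _ ≤ ‖(Ioi (0:ℝ)).indicator f s‖ * ‖(Ioi (0:ℝ)).indicator K (t - s)‖ := hL _ _
          _ ≤ ‖(Ioi (0:ℝ)).indicator f s‖ * C := by gcongr; exact h1 _
          _ = _ := by rw [← norm_indicator_eq_indicator_norm]; ring
    _ = _ := by rw [integral_const_mul, integral_indicator measurableSet_Ioi]

/-- The kernel is continuous across `0` and vanishes before it, so cutting it off creates no jump
and the convolution is that of an integrable function with a bounded continuous one. -/
theorem continuous_halfConv [CompleteSpace G] (L : E →L[ℝ] F →L[ℝ] G) {f : ℝ → E} {K : ℝ → F} {C : ℝ}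
    (hf : IntegrableOn f (Ioi 0)) (hKc : Continuous K) (hK0 : ∀ t ≤ 0, K t = 0)
    (hK : ∀ t, ‖K t‖ ≤ C) : Continuous (halfConv L f K) := by
  have : (Ioi (0:ℝ)).indicator K = K := by
    ext t
    by_cases h : t ∈ Ioi (0:ℝ)
    · rw [indicator_of_mem h]
    · rw [indicator_of_notMem h, hK0 t (not_lt.1 h)]
  rw [halfConv, this]
  refine BddAbove.continuous_convolution_right_of_integrable L ⟨C, ?_⟩
    (hf.integrable_indicator measurableSet_Ioi) hKc
  rintro _ ⟨t, rfl⟩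
  exact hK t

/-- The primitive vanishing at `0`, extended by zero to negative times. -/
def primitive (g : ℝ → E) (t : ℝ) : E := ∫ s in Ioc 0 t, g s

theorem primitive_of_nonpos (g : ℝ → E) {t : ℝ} (ht : t ≤ 0) : primitive g t = 0 := by
  simp [primitive, Ioc_eq_empty (not_lt.2 ht)]

/-- Integration from `0` is convolution with the Heaviside function; this is where the factor `1 /
p` in the transform of a primitive comes from. -/
theorem primitive_eq_halfConv (g : ℝ → E) :
    primitive g = halfConv (ContinuousLinearMap.lsmul ℝ ℝ).flip g (fun _ => (1:ℝ)) := by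
  ext t
  simp only [primitive, halfConv, convolution]
  rw [integral_Ioc_eq_integral_Ioo, ← integral_indicator measurableSet_Ioo]
  congr 1; ext s
  by_cases h1 : 0 < s <;> by_cases h2 : s < t <;> simp [indicator, h1, h2]

theorem laplace_primitive [CompleteSpace E] {g : ℝ → E} {p : ℝ} (hp : 0 < p)
    (hg : IntegrableOn (fun t => Real.exp (-p * t) • g t) (Ioi 0)) :
    IntegrableOn (fun t => Real.exp (-p * t) • primitive g t) (Ioi 0) ∧
    ∫ t in Ioi (0:ℝ), Real.exp (-p * t) • primitive g t
      = (1 / p) • ∫ t in Ioi (0:ℝ), Real.exp (-p * t) • g t := by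
  have h1 : IntegrableOn (fun t => Real.exp (-p * t) • (fun _ => (1:ℝ)) t) (Ioi 0) := by
    simpa using integrableOn_exp_mul_Ioi (a := -p) (by linarith) 0
  rw [primitive_eq_halfConv]
  refine ⟨integrableOn_exp_smul_halfConv _ hg h1, ?_⟩
  rw [laplace_halfConv _ hg h1]
  simp
  simp_rw [← neg_mul, integral_exp_neg_mul_Ioi hp, one_div]

theorem continuous_primitive_of_local {g : ℝ → E} (hg : ∀ T, IntegrableOn g (Ioc 0 T)) :
    Continuous (primitive g) := by
  have hloc : ∀ a b : ℝ, IntervalIntegrable ((Ioi (0:ℝ)).indicator g) volume a b := by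
    intro a b
    rw [intervalIntegrable_iff, IntegrableOn, integrable_indicator_iff measurableSet_Ioi,
      IntegrableOn, Measure.restrict_restrict measurableSet_Ioi]
    refine (hg (max a b)).mono_set fun t ht => ⟨ht.1, ?_⟩
    exact ht.2.2
  have h := intervalIntegral.continuous_primitive hloc 0
  convert h using 1
  ext t
  rcases le_or_gt t 0 with ht | ht
  · rw [primitive_of_nonpos g ht, intervalIntegral.integral_of_ge ht,
      setIntegral_eq_zero_of_forall_eq_zero, neg_zero]
    intro s hs
    exact indicator_of_notMem (by simpa using hs.2) _
  · rw [primitive, intervalIntegral.integral_of_le ht.le]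
    refine setIntegral_congr_fun measurableSet_Ioc fun s hs => ?_
    exact (indicator_of_mem (show s ∈ Ioi (0:ℝ) from hs.1) _).symm

theorem continuous_primitive {g : ℝ → E} (hg : IntegrableOn g (Ioi 0)) :
    Continuous (primitive g) :=
  continuous_primitive_of_local fun _ => hg.mono_set Ioc_subset_Ioi_self

theorem integral_norm_halfConv_le (L : E →L[ℝ] F →L[ℝ] G) {f : ℝ → E} {K : ℝ → F}
    (hL : ∀ x y, ‖L x y‖ ≤ ‖x‖ * ‖y‖)
    (hf : IntegrableOn f (Ioi 0)) (hK : IntegrableOn K (Ioi 0)) :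
    ∫ t in Ioi (0:ℝ), ‖halfConv L f K t‖
      ≤ (∫ t in Ioi (0:ℝ), ‖f t‖) * ∫ t in Ioi (0:ℝ), ‖K t‖ := by
  have h := integral_halfConv (ContinuousLinearMap.mul ℝ ℝ) hf.norm hK.norm
  rw [ContinuousLinearMap.mul_apply'] at h
  rw [← h]
  have hi := integrable_halfConv (ContinuousLinearMap.mul ℝ ℝ) hf.norm hK.norm
  refine integral_mono_ae (integrable_halfConv L hf hK).integrableOn.norm hi.integrableOn ?_
  have hex := ((integrable_indicator_iff measurableSet_Ioi).2 hf.norm).ae_convolution_exists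
    (ContinuousLinearMap.mul ℝ ℝ) ((integrable_indicator_iff measurableSet_Ioi).2 hK.norm)
  filter_upwards [ae_restrict_of_ae hex] with t ht
  refine norm_integral_le_of_norm_le ht (Filter.Eventually.of_forall fun s => ?_)
  rw [ContinuousLinearMap.mul_apply', ← norm_indicator_eq_indicator_norm,
    ← norm_indicator_eq_indicator_norm]
  exact hL _ _

theorem norm_primitive_le {g : ℝ → E} (hg : IntegrableOn g (Ioi 0)) (t : ℝ) :
    ‖primitive g t‖ ≤ ∫ s in Ioi (0:ℝ), ‖g s‖ :=
  (norm_integral_le_integral_norm _).trans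
    (setIntegral_mono_set hg.norm (Filter.Eventually.of_forall fun _ => norm_nonneg _)
      Ioc_subset_Ioi_self.eventuallyLE)

end Convolution

/-! ### Integrals along horizontal lines -/

section Contour

open Complex Filter Topology

theorem integrable_exp_neg_mul_abs {ε : ℝ} (hε : 0 < ε) :
    Integrable fun x : ℝ => Real.exp (-ε * |x|) := by
  rw [← integrableOn_univ, ← Iic_union_Ioi (a := (0:ℝ))]
  refine IntegrableOn.union ?_ ?_
  · refine (integrableOn_exp_mul_Iic hε 0).congr_fun (fun x hx => ?_) measurableSet_Iic
    simp only [abs_of_nonpos (mem_Iic.1 hx)]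
    congr 1; ring
  · refine (integrableOn_exp_mul_Ioi (a := -ε) (by linarith) 0).congr_fun (fun x hx => ?_)
      measurableSet_Ioi
    simp only [abs_of_pos (mem_Ioi.1 hx)]

theorem tendsto_exp_neg_mul_abs_comp {ε : ℝ} (hε : 0 < ε) (C : ℝ) :
    Tendsto (fun R : ℝ => C * Real.exp (-ε * R)) atTop (𝓝 0) := by
  have h : Tendsto (fun R : ℝ => Real.exp (-(ε * R))) atTop (𝓝 0) :=
    Real.tendsto_exp_neg_atTop_nhds_zero.comp (tendsto_id.const_mul_atTop hε)
  simpa [neg_mul] using h.const_mul C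

/-- Integrable functions obtained by restricting a decaying function on a strip. -/
theorem integrable_horizontal {f : ℂ → ℂ} {y C ε : ℝ} (hε : 0 < ε)
    (hc : Continuous fun x : ℝ => f (x + y * I))
    (hb : ∀ x : ℝ, ‖f (x + y * I)‖ ≤ C * Real.exp (-ε * |x|)) :
    Integrable fun x : ℝ => f (x + y * I) :=
  ((integrable_exp_neg_mul_abs hε).const_mul C).mono' hc.aestronglyMeasurable
    (Eventually.of_forall hb)

/-- Cauchy's theorem on the rectangle `[-R, R] × [a, b]`, whose vertical sides vanish in the limit
by the exponential decay. In the coordinate `z = e^w` horizontal lines are rays from the origin, so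
this rotates a ray. -/
theorem integral_horizontal_eq {f : ℂ → ℂ} {a b C ε : ℝ} (hab : a ≤ b) (hε : 0 < ε)
    (hd : DifferentiableOn ℂ f {w | w.im ∈ Icc a b})
    (hb : ∀ x : ℝ, ∀ y ∈ Icc a b, ‖f (x + y * I)‖ ≤ C * Real.exp (-ε * |x|)) :
    Integrable (fun x : ℝ => f (x + a * I)) ∧ Integrable (fun x : ℝ => f (x + b * I)) ∧
    ∫ x : ℝ, f (x + a * I) = ∫ x : ℝ, f (x + b * I) := by
  have hcont : ∀ y ∈ Icc a b, Continuous fun x : ℝ => f (x + y * I) := fun y hy =>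
    hd.continuousOn.comp_continuous (by fun_prop) (fun x => by simpa using hy)
  have ha := integrable_horizontal hε (hcont a ⟨le_rfl, hab⟩) fun x => hb x a ⟨le_rfl, hab⟩
  have hb' := integrable_horizontal hε (hcont b ⟨hab, le_rfl⟩) fun x => hb x b ⟨hab, le_rfl⟩
  refine ⟨ha, hb', ?_⟩
  have hlim : ∀ {g : ℝ → ℂ}, Integrable g →
      Tendsto (fun R : ℝ => ∫ x in -R..R, g x) atTop (𝓝 (∫ x, g x)) := fun hg =>
    intervalIntegral_tendsto_integral hg tendsto_neg_atTop_atBot tendsto_id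
  have hside : ∀ s : ℝ, |s| = 1 →
      Tendsto (fun R : ℝ => ∫ y in a..b, f ((s * R : ℝ) + y * I)) atTop (𝓝 0) := by
    intro s hs
    refine squeeze_zero_norm' ?_ (tendsto_exp_neg_mul_abs_comp hε (C * |b - a|))
    filter_upwards [eventually_gt_atTop 0] with R hR
    refine (intervalIntegral.norm_integral_le_of_norm_le_const
      (C := C * Real.exp (-ε * R)) fun y hy => ?_).trans (le_of_eq (by ring))
    rw [uIoc_of_le hab] at hy
    have := hb (s * R) y ⟨hy.1.le, hy.2⟩
    rwa [abs_mul, hs, one_mul, abs_of_pos hR] at this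
  have key : ∀ R : ℝ, (∫ x in -R..R, f (x + a * I)) - ∫ x in -R..R, f (x + b * I)
      = I * (∫ y in a..b, f (((-1) * R : ℝ) + y * I)) - I * ∫ y in a..b, f ((1 * R : ℝ) + y * I) := by
    intro R
    have := integral_boundary_rect_eq_zero_of_differentiableOn f (⟨-R, a⟩ : ℂ) ⟨R, b⟩
      (hd.mono fun w hw => by
        have := (mem_reProdIm.1 hw).2
        simpa [uIcc_of_le hab] using this)
    simp only [smul_eq_mul] at this
    simp only [neg_mul, one_mul]
    push_cast at this ⊢
    linear_combination this
  have h1 := (hlim ha).sub (hlim hb')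
  have h2 := ((hside (-1) (by simp)).const_mul I).sub ((hside 1 (by simp)).const_mul I)
  simp only [key] at h1
  have := tendsto_nhds_unique h1 h2
  rw [mul_zero, sub_zero, sub_eq_zero] at this
  exact this

/-- With `s = e^x` this is the integral of `s^(-1/2) / (p + s)` over `(0, ∞)`, which has an
arctangent as primitive. -/
theorem integral_exp_half_div {p : ℝ} (hp : 0 < p) :
    ∫ x : ℝ, Real.exp (x / 2) / (p + Real.exp x) = Real.pi / Real.sqrt p := by
  have hs : 0 < Real.sqrt p := Real.sqrt_pos.2 hp
  have hss : Real.sqrt p ^ 2 = p := Real.sq_sqrt hp.le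
  have hderiv : ∀ x : ℝ, HasDerivAt
      (fun x => 2 / Real.sqrt p * Real.arctan (Real.exp (x / 2) / Real.sqrt p))
      (Real.exp (x / 2) / (p + Real.exp x)) x := by
    intro x
    have h1 : HasDerivAt (fun x : ℝ => Real.exp (x / 2)) (Real.exp (x / 2) * (1 / 2)) x :=
      ((hasDerivAt_id x).div_const 2).exp
    have h2 := ((h1.div_const (Real.sqrt p)).arctan).const_mul (2 / Real.sqrt p)
    refine h2.congr_deriv ?_
    have he : Real.exp x = Real.exp (x / 2) ^ 2 := by
      rw [← Real.exp_nat_mul]; congr 1; push_cast; ring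
    have : 0 < Real.exp (x / 2) := Real.exp_pos _
    rw [he, div_pow, hss]
    field_simp
    rw [hss]
  have hbot : Tendsto (fun x => 2 / Real.sqrt p * Real.arctan (Real.exp (x / 2) / Real.sqrt p))
      atBot (𝓝 0) := by
    have h1 : Tendsto (fun x : ℝ => Real.exp (x / 2) / Real.sqrt p) atBot (𝓝 (0 / Real.sqrt p)) :=
      (Real.tendsto_exp_atBot.comp (tendsto_id.atBot_div_const two_pos)).div_const _
    have := ((Real.continuous_arctan.tendsto _).comp h1).const_mul (2 / Real.sqrt p)
    simpa using this
  have htop : Tendsto (fun x => 2 / Real.sqrt p * Real.arctan (Real.exp (x / 2) / Real.sqrt p))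
      atTop (𝓝 (Real.pi / Real.sqrt p)) := by
    have h1 : Tendsto (fun x : ℝ => Real.exp (x / 2) / Real.sqrt p) atTop atTop :=
      (Real.tendsto_exp_atTop.comp (tendsto_id.atTop_div_const two_pos)).atTop_div_const hs
    have := ((tendsto_nhds_of_tendsto_nhdsWithin Real.tendsto_arctan_atTop).comp h1).const_mul
      (2 / Real.sqrt p)
    rwa [show 2 / Real.sqrt p * (Real.pi / 2) = Real.pi / Real.sqrt p by ring] at this
  have hint : Integrable fun x : ℝ => Real.exp (x / 2) / (p + Real.exp x) := by
    refine ((integrable_exp_neg_mul_abs (ε := 1 / 2) (by norm_num)).const_mul (1 / p + 1)).mono'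
      (Continuous.aestronglyMeasurable ?_) (Eventually.of_forall fun x => ?_)
    · exact Continuous.div (by fun_prop) (by fun_prop) fun x => by positivity
    · rw [Real.norm_of_nonneg (by positivity), div_le_iff₀ (by positivity)]
      have hpp : 0 < 1 / p := by positivity
      rcases le_total x 0 with hx | hx
      · rw [abs_of_nonpos hx, show -(1/2) * -x = x / 2 by ring]
        have : 0 < Real.exp (x/2) := Real.exp_pos _
        have h1 : (1:ℝ) ≤ (1 / p + 1) * (p + Real.exp x) := by
          have : (1 / p + 1) * (p + Real.exp x) = 1 + p + (1 / p + 1) * Real.exp x := by field_simp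
          rw [this]; have := Real.exp_pos x; nlinarith
        nlinarith
      · rw [abs_of_nonneg hx]
        have h1 : Real.exp (x / 2) = Real.exp (-(1 / 2) * x) * Real.exp x := by
          rw [← Real.exp_add]; congr 1; ring
        rw [h1]
        have h2 : 0 < Real.exp (-(1 / 2) * x) := Real.exp_pos _
        have h3 : Real.exp x ≤ (1 / p + 1) * (p + Real.exp x) := by
          have := Real.exp_pos x; nlinarith
        nlinarith
  rw [integral_of_hasDerivAt_of_tendsto hderiv hint hbot htop, sub_zero]

end Contour

/-! ### A Cauchy formula on a ray -/

section Ray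

open Complex Filter Topology

/-- The direction `θ` of the ray on which the Laplace transform is inverted: it lies in the open left
half plane and before the first singularity of `1 / (1 + μ z ^ α)`. -/
structure SectorAngle (α θ : ℝ) : Prop where
  one_lt : 1 < α
  lt_two : α < 2
  half_pi_lt : Real.pi / 2 < θ
  mul_lt : α * θ < Real.pi

/-- The condition `α < 2` is what leaves room between `π / 2` and `π / α`. -/
theorem exists_sectorAngle {α : ℝ} (h1 : 1 < α) (h2 : α < 2) : ∃ θ, SectorAngle α θ := by
  obtain ⟨θ, ha, hb⟩ := exists_between (show Real.pi / 2 < Real.pi / α from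
    div_lt_div_of_pos_left Real.pi_pos (by linarith) h2)
  exact ⟨θ, h1, h2, ha, by rwa [mul_comm, ← lt_div_iff₀ (by linarith)]⟩

namespace SectorAngle

variable {α θ : ℝ} (h : SectorAngle α θ)
include h

theorem pos : 0 < θ := by have := h.half_pi_lt; have := Real.pi_pos; linarith

theorem lt_pi : θ < Real.pi := by
  have := h.mul_lt; have := h.one_lt; have := h.pos; nlinarith

theorem cos_neg : Real.cos θ < 0 := by
  have := h.lt_pi
  exact Real.cos_neg_of_pi_div_two_lt_of_lt h.half_pi_lt (by linarith [Real.pi_pos])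

end SectorAngle

/-- A lower bound for `|1 + μ z ^ α| / (1 + μ |z| ^ α)` in the sector. -/
def sectorConst (α θ : ℝ) : ℝ := (1 + Real.cos (α * θ)) / 2

theorem SectorAngle.sectorConst_pos {α θ : ℝ} (h : SectorAngle α θ) : 0 < sectorConst α θ := by
  have h1 : Real.cos Real.pi < Real.cos (α * θ) :=
    Real.cos_lt_cos_of_nonneg_of_le_pi (mul_nonneg (by linarith [h.one_lt]) h.pos.le) le_rfl h.mul_lt
  rw [Real.cos_pi] at h1
  unfold sectorConst; linarith

/-- With `ρ = μ e^(αx)` the squared modulus is `1 + 2ρ cos(αy) + ρ²`, and the cosine is at least `2c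
- 1` for `c = sectorConst α θ`. Then `1 + 2ρ(2c - 1) + ρ² - c(1 + ρ)² = (1 - c)(1 - ρ)² ≥ 0`, and `c
≥ c²`. -/
theorem SectorAngle.le_norm_one_add {α θ : ℝ} (h : SectorAngle α θ) {μ : ℝ} (hμ : 0 ≤ μ) (x : ℝ)
    {y : ℝ} (hy : y ∈ Icc 0 θ) :
    sectorConst α θ * (1 + μ * Real.exp (α * x)) ≤ ‖1 + (μ : ℂ) * exp (α * (x + y * I))‖ := by
  set ρ := μ * Real.exp (α * x) with hρ
  have hρ0 : 0 ≤ ρ := by positivity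
  have hc := h.sectorConst_pos
  have ha : 0 < α := by linarith [h.one_lt]
  have hcos : Real.cos (α * θ) ≤ Real.cos (α * y) :=
    Real.cos_le_cos_of_nonneg_of_le_pi (mul_nonneg ha.le hy.1) h.mul_lt.le
      (mul_le_mul_of_nonneg_left hy.2 ha.le)
  have e : (1 + (μ : ℂ) * exp (α * (x + y * I))) =
      ⟨1 + ρ * Real.cos (α * y), ρ * Real.sin (α * y)⟩ := by
    have : (α * (x + y * I) : ℂ) = ((α * x : ℝ) : ℂ) + ((α * y : ℝ) : ℂ) * I := by push_cast; ring
    rw [this, exp_add, exp_mul_I, ← ofReal_exp, ← ofReal_cos, ← ofReal_sin]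
    rw [hρ]
    generalize Real.exp (α * x) = e
    generalize Real.cos (α * y) = a
    generalize Real.sin (α * y) = b
    apply Complex.ext <;> simp <;> ring
  have hle1 : sectorConst α θ ≤ 1 := by
    unfold sectorConst; linarith [Real.cos_le_one (α * θ)]
  refine le_of_sq_le_sq ?_ (norm_nonneg _)
  rw [← normSq_eq_norm_sq, e, normSq_mk]
  have hs := Real.sin_sq_add_cos_sq (α * y)
  have e2 : (1 + ρ * Real.cos (α * y)) * (1 + ρ * Real.cos (α * y)) +
      ρ * Real.sin (α * y) * (ρ * Real.sin (α * y)) = 1 + 2 * ρ * Real.cos (α * y) + ρ ^ 2 := by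
    linear_combination ρ ^ 2 * hs
  rw [e2]
  have e3 : Real.cos (α * θ) = 2 * sectorConst α θ - 1 := by unfold sectorConst; ring
  rw [e3] at hcos
  have h1 : 2 * ρ * (2 * sectorConst α θ - 1) ≤ 2 * ρ * Real.cos (α * y) := by gcongr
  have h2 : (sectorConst α θ * (1 + ρ)) ^ 2 ≤ sectorConst α θ * (1 + ρ) ^ 2 := by
    rw [mul_pow]; gcongr; nlinarith
  nlinarith [sq_nonneg (1 - ρ)]

theorem SectorAngle.one_add_ne_zero {α θ : ℝ} (h : SectorAngle α θ) {μ : ℝ} (hμ : 0 ≤ μ) (x : ℝ)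
    {y : ℝ} (hy : y ∈ Icc 0 θ) : 1 + (μ : ℂ) * exp (α * (x + y * I)) ≠ 0 := by
  have h1 := h.le_norm_one_add hμ x hy
  have h2 := h.sectorConst_pos
  rw [← norm_pos_iff]
  exact lt_of_lt_of_le (by positivity) h1

/-- The function `z ^ β / (1 + μ z ^ α)` of `z = exp w`. -/
def powSymbol (α β μ : ℝ) (w : ℂ) : ℂ := exp (β * w) / (1 + μ * exp (α * w))

theorem norm_exp_mul_add (b x y : ℝ) : ‖exp (b * (x + y * I) : ℂ)‖ = Real.exp (b * x) := by
  rw [norm_exp]; simp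

theorem norm_powSymbol_le {α θ : ℝ} (h : SectorAngle α θ) (β : ℝ) {μ : ℝ} (hμ : 0 ≤ μ) (x : ℝ)
    {y : ℝ} (hy : y ∈ Icc 0 θ) :
    ‖powSymbol α β μ (x + y * I)‖ ≤
      (sectorConst α θ)⁻¹ * (Real.exp (β * x) / (1 + μ * Real.exp (α * x))) := by
  have hc := h.sectorConst_pos
  rw [powSymbol, norm_div, norm_exp_mul_add, inv_mul_eq_div, div_div]
  refine div_le_div_of_nonneg_left (Real.exp_pos _).le (by positivity) ?_
  rw [mul_comm]
  exact h.le_norm_one_add hμ x hy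

theorem differentiableOn_powSymbol {α θ : ℝ} (h : SectorAngle α θ) (β : ℝ) {μ : ℝ} (hμ : 0 ≤ μ) :
    ∃ U : Set ℂ, IsOpen U ∧ {w | w.im ∈ Icc 0 θ} ⊆ U ∧ DifferentiableOn ℂ (powSymbol α β μ) U := by
  refine ⟨{w | 1 + μ * exp (α * w) ≠ 0}, isOpen_ne_fun (by fun_prop) (by fun_prop),
    fun w hw => ?_, fun w hw => ?_⟩
  · have := h.one_add_ne_zero hμ w.re hw
    rwa [re_add_im] at this
  · exact (DifferentiableAt.div (c := fun w : ℂ => exp (β * w))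
      (d := fun w : ℂ => 1 + μ * exp (α * w)) (by fun_prop) (by fun_prop) hw).differentiableWithinAt

theorem powSymbol_log (α β μ : ℝ) {p : ℝ} (hp : 0 < p) :
    powSymbol α β μ (Real.log p : ℝ) = ((p ^ β / (1 + μ * p ^ α) : ℝ) : ℂ) := by
  rw [powSymbol, Real.rpow_def_of_pos hp, Real.rpow_def_of_pos hp]
  push_cast
  rw [mul_comm (β : ℂ), mul_comm (α : ℂ)]

/-- The rotation of the integral of `z ^ (-1/2) / (p - z)` from the ray to the negative axis. -/
theorem integral_exp_half_ray {α θ : ℝ} (h : SectorAngle α θ) {p : ℝ} (hp : 0 < p) :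
    Integrable (fun x : ℝ => exp ((x + θ * I) / 2) / (p - exp (x + θ * I))) ∧
    ∫ x : ℝ, exp ((x + θ * I) / 2) / (p - exp (x + θ * I)) = I * (Real.pi / Real.sqrt p : ℝ) := by
  have hk : 0 < -Real.cos θ := by linarith [h.cos_neg]
  have hre : ∀ x y : ℝ, y ∈ Icc θ Real.pi →
      p + -Real.cos θ * Real.exp x ≤ ‖(p : ℂ) - exp (x + y * I)‖ := fun x y hy => by
    refine le_trans ?_ (re_le_norm _)
    have hcos : Real.cos y ≤ Real.cos θ :=
      Real.cos_le_cos_of_nonneg_of_le_pi h.pos.le hy.2 hy.1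
    rw [sub_re, ofReal_re, exp_re]
    simp only [add_re, ofReal_re, mul_re, I_re, mul_zero, ofReal_im, I_im, sub_self,
      add_zero, add_im, mul_im, zero_add, mul_one]
    nlinarith [Real.exp_pos x]
  obtain ⟨i1, i2, i3⟩ := integral_horizontal_eq
    (f := fun w => exp (w / 2) / (p - exp w)) (a := θ) (b := Real.pi)
    (C := 1 / p + 1 / -Real.cos θ) (ε := 1 / 2) h.lt_pi.le (by norm_num)
    (fun w hw => by
      refine (DifferentiableAt.div (by fun_prop) (by fun_prop) ?_).differentiableWithinAt
      have := hre w.re w.im hw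
      rw [re_add_im] at this
      rw [← norm_pos_iff]
      exact lt_of_lt_of_le (by positivity) this)
    (fun x y hy => by
      have h1 := hre x y hy
      have h2 : ‖exp ((x + y * I) / 2 : ℂ)‖ = Real.exp (x / 2) := by rw [norm_exp]; simp
      rw [norm_div, h2]
      have hden : 0 < p + -Real.cos θ * Real.exp x := by positivity
      refine (div_le_div_of_nonneg_left (Real.exp_pos _).le hden h1).trans ?_
      rw [div_le_iff₀ hden, add_mul]
      have hpp : 0 < 1 / p := by positivity
      have hkk : 0 < 1 / -Real.cos θ := by positivity
      rcases le_total x 0 with hx | hx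
      · rw [abs_of_nonpos hx, show -(1/2) * -x = x / 2 by ring]
        have h3 : (1:ℝ) ≤ 1 / p * (p + -Real.cos θ * Real.exp x) := by
          rw [mul_add, one_div_mul_cancel hp.ne']
          have : 0 ≤ 1 / p * (-Real.cos θ * Real.exp x) := by positivity
          linarith
        have h4 : 0 ≤ 1 / -Real.cos θ * Real.exp (x/2) * (p + -Real.cos θ * Real.exp x) := by
          positivity
        have := Real.exp_pos (x / 2)
        nlinarith
      · rw [abs_of_nonneg hx]
        have h5 : Real.exp (x / 2) = Real.exp (-(1 / 2) * x) * Real.exp x := by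
          rw [← Real.exp_add]; congr 1; ring
        rw [h5]
        have h3 : Real.exp x ≤ 1 / -Real.cos θ * (p + -Real.cos θ * Real.exp x) := by
          rw [mul_add, ← mul_assoc, one_div_mul_cancel hk.ne', one_mul]
          have : 0 ≤ 1 / -Real.cos θ * p := by positivity
          linarith
        have h4 : 0 ≤ 1 / p * Real.exp (-(1 / 2) * x) * (p + -Real.cos θ * Real.exp x) := by
          positivity
        have := Real.exp_pos (-(1 / 2) * x)
        nlinarith)
  refine ⟨i1, ?_⟩
  rw [i3, ← integral_exp_half_div hp, ← integral_complex_ofReal, ← integral_const_mul]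
  congr 1; ext x
  have e1 : exp ((x + Real.pi * I) / 2 : ℂ) = I * exp (x / 2) := by
    rw [add_div, exp_add, mul_comm, show (Real.pi * I / 2 : ℂ) = Real.pi / 2 * I by ring,
      exp_pi_div_two_mul_I]
  have e2 : exp (x + Real.pi * I : ℂ) = - exp x := by rw [exp_add, exp_pi_mul_I]; ring
  rw [e1, e2]; push_cast; ring

/-- If `|z - p|` is bounded below then so is `|p - z| / (p + |z|)`. -/
theorem exists_le_norm_sub_exp {p : ℝ} (hp : 0 < p) : ∃ c : ℝ, 0 < c ∧
    ∀ x y : ℝ, 1 ≤ |x - Real.log p| → c * (p + Real.exp x) ≤ ‖(p : ℂ) - exp (x + y * I)‖ := by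
  have he : 1 < Real.exp 1 := by simp
  -- For `|x - log p| ≥ 1` the numbers `p` and `e^x` differ at least by a factor `e`, and this
  -- constant is the value of `|p - e^x| / (p + e^x)` when the ratio is exactly `e`.
  refine ⟨(Real.exp 1 - 1) / (Real.exp 1 + 1), by apply div_pos <;> linarith, fun x y hx => ?_⟩
  have h1 : |p - Real.exp x| ≤ ‖(p : ℂ) - exp (x + y * I)‖ := by
    have := abs_norm_sub_norm_le (p : ℂ) (exp (x + y * I))
    simpa only [norm_exp, add_re, ofReal_re, mul_re, I_re, mul_zero, ofReal_im, I_im, mul_one,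
      sub_self, add_zero, norm_real, Real.norm_eq_abs, abs_of_pos hp] using this
  refine le_trans ?_ h1
  rw [div_mul_eq_mul_div, div_le_iff₀ (by linarith)]
  have hpe : p = Real.exp (Real.log p) := (Real.exp_log hp).symm
  rcases le_abs.1 hx with h2 | h2
  · have : Real.exp 1 * p ≤ Real.exp x := by
      rw [hpe, ← Real.exp_add]; exact Real.exp_le_exp.2 (by linarith)
    have h3 := neg_abs_le (p - Real.exp x)
    nlinarith [abs_nonneg (p - Real.exp x)]
  · have : Real.exp 1 * Real.exp x ≤ p := by
      rw [hpe, ← Real.exp_add]; exact Real.exp_le_exp.2 (by linarith)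
    have h3 := le_abs_self (p - Real.exp x)
    nlinarith [abs_nonneg (p - Real.exp x)]

theorem exp_div_one_add_le {α β μ ε : ℝ} (hμ : 0 < μ) (h1 : ε ≤ β) (h2 : ε ≤ α - β) (x : ℝ) :
    Real.exp (β * x) / (1 + μ * Real.exp (α * x)) ≤ (1 + 1 / μ) * Real.exp (-ε * |x|) := by
  have hd : 0 < 1 + μ * Real.exp (α * x) := by positivity
  have hm : 0 < 1 / μ := by positivity
  rcases le_total x 0 with hx | hx
  · rw [abs_of_nonpos hx]
    have e1 : Real.exp (β * x) ≤ Real.exp (-ε * -x) := Real.exp_le_exp.2 (by nlinarith)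
    refine (div_le_self (Real.exp_pos _).le ?_).trans (e1.trans ?_)
    · have : 0 ≤ μ * Real.exp (α * x) := by positivity
      linarith
    · exact le_mul_of_one_le_left (Real.exp_pos _).le (by linarith)
  · rw [abs_of_nonneg hx, div_le_iff₀ hd]
    have e1 : Real.exp (β * x) ≤ Real.exp (-ε * x) * Real.exp (α * x) := by
      rw [← Real.exp_add]; exact Real.exp_le_exp.2 (by nlinarith)
    refine e1.trans ?_
    have e2 : (1 + 1 / μ) * Real.exp (-ε * x) * (1 + μ * Real.exp (α * x))
      = Real.exp (-ε * x) * Real.exp (α * x) + Real.exp (-ε * x) * ((1 + 1 / μ)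
        + μ * Real.exp (α * x)) := by
      field_simp; ring
    rw [e2]
    have : 0 ≤ Real.exp (-ε * x) * ((1 + 1 / μ) + μ * Real.exp (α * x)) := by positivity
    linarith

theorem norm_powSymbol_mul_exp_div_le {α θ : ℝ} (h : SectorAngle α θ) {β μ p c ε : ℝ} (hμ : 0 < μ)
    (hp : 0 < p) (hc : 0 < c) (h1 : ε ≤ β + 1) (h2 : ε ≤ α - β) {x y : ℝ}
    (hy : y ∈ Icc 0 θ) (hx : c * (p + Real.exp x) ≤ ‖(p : ℂ) - exp (x + y * I)‖) :
    ‖powSymbol α β μ (x + y * I) * exp (x + y * I) / (p - exp (x + y * I))‖ ≤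
      (sectorConst α θ)⁻¹ * c⁻¹ * (1 / p + 1 / μ) * Real.exp (-ε * |x|) := by
  have hs := h.sectorConst_pos
  have he : ‖exp (x + y * I : ℂ)‖ = Real.exp x := by simpa using norm_exp_mul_add 1 x y
  have hd : 0 < p + Real.exp x := by positivity
  have hd2 : 0 < 1 + μ * Real.exp (α * x) := by positivity
  rw [norm_div, norm_mul, he]
  have key : Real.exp (β * x) / (1 + μ * Real.exp (α * x)) * Real.exp x / (p + Real.exp x) ≤
      (1 / p + 1 / μ) * Real.exp (-ε * |x|) := by
    rcases le_total x 0 with hx0 | hx0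
    · rw [abs_of_nonpos hx0]
      have e1 : Real.exp (β * x) * Real.exp x ≤ Real.exp (-ε * -x) := by
        rw [← Real.exp_add]; exact Real.exp_le_exp.2 (by nlinarith)
      have e2 : Real.exp (β * x) / (1 + μ * Real.exp (α * x)) ≤ Real.exp (β * x) := by
        refine div_le_self (Real.exp_pos _).le ?_
        have : 0 ≤ μ * Real.exp (α * x) := by positivity
        linarith
      calc _ ≤ Real.exp (β * x) * Real.exp x / p := by
            gcongr
            linarith [Real.exp_pos x]
        _ ≤ Real.exp (-ε * -x) / p := by gcongr
        _ ≤ _ := by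
          rw [add_mul, one_div_mul_eq_div]
          have : 0 ≤ 1 / μ * Real.exp (-ε * -x) := by positivity
          linarith
    · rw [abs_of_nonneg hx0]
      have e1 : Real.exp (β * x) ≤ Real.exp (-ε * x) * Real.exp (α * x) := by
        rw [← Real.exp_add]; exact Real.exp_le_exp.2 (by nlinarith)
      have e2 : Real.exp (β * x) / (1 + μ * Real.exp (α * x)) ≤ 1 / μ * Real.exp (-ε * x) := by
        rw [div_le_iff₀ hd2]
        refine e1.trans ?_
        have : 1 / μ * Real.exp (-ε * x) * (1 + μ * Real.exp (α * x)) =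
          Real.exp (-ε * x) * Real.exp (α * x) + 1 / μ * Real.exp (-ε * x) := by
          field_simp; ring
        rw [this]
        have : 0 ≤ 1 / μ * Real.exp (-ε * x) := by positivity
        linarith
      have e3 : Real.exp x / (p + Real.exp x) ≤ 1 := by
        rw [div_le_one hd]; linarith
      rw [mul_div_assoc]
      calc _ ≤ 1 / μ * Real.exp (-ε * x) * 1 := by gcongr
        _ ≤ _ := by
          have : 0 ≤ 1 / p * Real.exp (-ε * x) := by positivity
          linarith
  calc _ ≤ (sectorConst α θ)⁻¹ * (Real.exp (β * x) / (1 + μ * Real.exp (α * x))) * Real.exp x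
          / (c * (p + Real.exp x)) := by
        gcongr
        exact norm_powSymbol_le h β hμ.le x hy
    _ = (sectorConst α θ)⁻¹ * c⁻¹ *
        (Real.exp (β * x) / (1 + μ * Real.exp (α * x)) * Real.exp x / (p + Real.exp x)) := by
        field_simp
    _ ≤ _ := by rw [mul_assoc _ (1 / p + 1 / μ)]; gcongr

/-- The Cauchy formula for `z ^ β / (1 + μ z ^ α)` on the boundary of the sector. -/
theorem integral_powSymbol_ray {α θ : ℝ} (h : SectorAngle α θ) {β μ p : ℝ} (hμ : 0 < μ)
    (hβ : -1 < β) (hβα : β < α) (hp : 0 < p) :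
    (∫ x : ℝ, powSymbol α β μ (x + θ * I) * exp (x + θ * I) / (p - exp (x + θ * I))).im
      = Real.pi * (p ^ β / (1 + μ * p ^ α)) := by
  set ℓ : ℝ := Real.log p with hℓ
  have hexpℓ : exp (ℓ : ℂ) = p := by rw [hℓ, ← ofReal_exp, Real.exp_log hp]
  -- The pole `w = ℓ` lies on the real line, one edge of the strip. The integrand is split as `φ + H
  -- ℓ · e^(w/2) / (p - e^w)`. The divided differences make `φ` holomorphic up to the real line,
  -- where its integral is real; so the imaginary part comes from the second term alone, computed in
  -- `integral_exp_half_ray`.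
  set H : ℂ → ℂ := fun w => powSymbol α β μ w * exp (w / 2) with hH
  set φ : ℂ → ℂ := fun w => -(dslope H ℓ w * exp (w / 2) / dslope exp ℓ w) with hφ
  have hφne : ∀ w : ℂ, w ≠ ℓ → φ w = (H w - H ℓ) * exp (w / 2) / (p - exp w) := by
    intro w hw
    have hw' : w - ℓ ≠ 0 := sub_ne_zero.2 hw
    simp only [hφ]
    rw [dslope_of_ne _ hw, dslope_of_ne _ hw, slope_def_field, slope_def_field, hexpℓ,
      ← neg_sub (exp w), div_neg]
    congr 1
    rw [div_mul_eq_mul_div, div_div_div_cancel_right₀ hw']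
  have hinj : ∀ w : ℂ, w.im ∈ Icc 0 θ → w ≠ ℓ → exp w ≠ p := by
    intro w hw hne he
    rw [← hexpℓ] at he
    refine hne (exp_inj_of_neg_pi_lt_of_le_pi ?_ (hw.2.trans h.lt_pi.le) ?_ ?_ he)
    · linarith [hw.1, Real.pi_pos]
    · simpa using Real.pi_pos
    · simpa using Real.pi_pos.le
  obtain ⟨U, hUo, hSU, hUd⟩ := differentiableOn_powSymbol h β hμ.le
  have hℓU : (ℓ : ℂ) ∈ U := hSU (by simpa using h.pos.le)
  have hHd : DifferentiableOn ℂ H U := hUd.mul (Differentiable.differentiableOn (by fun_prop))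
  have hφd : DifferentiableOn ℂ φ {w | w.im ∈ Icc 0 θ} := by
    refine ((((differentiableOn_dslope (hUo.mem_nhds hℓU)).2 hHd).mono hSU).mul
      (Differentiable.differentiableOn (by fun_prop))).div ?_ ?_ |>.neg
    · exact ((differentiableOn_dslope Filter.univ_mem).2
        differentiable_exp.differentiableOn).mono (subset_univ _)
    · intro w hw
      by_cases hne : w = ℓ
      · rw [hne, dslope_same]; simp
      · rw [dslope_of_ne _ hne, slope_def_field, hexpℓ]
        exact div_ne_zero (sub_ne_zero.2 (hinj w hw hne)) (sub_ne_zero.2 hne)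
  -- Decay rates: `β + 1` at `-∞` and `α - β` at `+∞` for the symbol term, and `1 / 2` at both ends
  -- for the half power.
  obtain ⟨ε, hε0, hε1, hε2, hε3⟩ : ∃ ε : ℝ, 0 < ε ∧ ε ≤ β + 1 ∧ ε ≤ α - β ∧ ε ≤ 1 / 2 :=
    ⟨min (β + 1) (min (α - β) (1 / 2)), by simp; exact ⟨by linarith, hβα⟩,
      min_le_left _ _, (min_le_right _ _).trans (min_le_left _ _),
      (min_le_right _ _).trans (min_le_right _ _)⟩
  obtain ⟨c, hc, hcb⟩ := exists_le_norm_sub_exp hp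
  have hne_of : ∀ x y : ℝ, x ≠ ℓ → (x + y * I : ℂ) ≠ ℓ := fun x y hx he => hx (by
    simpa using congrArg re he)
  have hsplit : ∀ w : ℂ, w.im ∈ Icc 0 θ → w ≠ ℓ →
      powSymbol α β μ w * exp w / (p - exp w) = φ w + H ℓ * (exp (w / 2) / (p - exp w)) := by
    intro w hw hne
    rw [hφne w hne]
    have h2 : exp w = exp (w / 2) * exp (w / 2) := by rw [← exp_add]; ring_nf
    have h3 : (p : ℂ) - exp w ≠ 0 := sub_ne_zero.2 (Ne.symm (hinj w hw hne))
    field_simp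
    simp only [hH]
    rw [h2]; ring
  have hhalf : ∀ x y : ℝ, 1 ≤ |x - ℓ| → ‖exp ((x + y * I : ℂ) / 2) / (p - exp (x + y * I))‖ ≤
      c⁻¹ * (1 / p * (1 + p)) * Real.exp (-ε * |x|) := by
    intro x y hx
    have e1 : ‖exp ((x + y * I : ℂ) / 2)‖ = Real.exp (1 / 2 * x) := by
      rw [norm_exp]; congr 1; simp; ring
    have e2 := exp_div_one_add_le (α := 1) (β := 1 / 2) (μ := 1 / p) (ε := ε) (by positivity) hε3
      (by linarith) x
    rw [norm_div, e1]
    calc _ ≤ Real.exp (1 / 2 * x) / (c * (p + Real.exp x)) := by gcongr; exact hcb x y hx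
      _ = c⁻¹ * (1 / p * (Real.exp (1 / 2 * x) / (1 + 1 / p * Real.exp (1 * x)))) := by
        rw [one_mul]; field_simp
      _ ≤ c⁻¹ * (1 / p * ((1 + 1 / (1 / p)) * Real.exp (-ε * |x|))) := by gcongr
      _ = _ := by rw [one_div_one_div]; ring
  -- The decay estimates degenerate near the removed pole; there compactness bounds `φ` instead.
  obtain ⟨B, hB⟩ : ∃ B : ℝ, ∀ x y : ℝ, |x - ℓ| ≤ 1 → y ∈ Icc 0 θ → ‖φ (x + y * I)‖ ≤ B := by
    have hK : IsCompact (Icc (ℓ - 1) (ℓ + 1) ×ˢ Icc 0 θ) := isCompact_Icc.prod isCompact_Icc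
    obtain ⟨B, hB⟩ := hK.exists_bound_of_continuousOn
      (f := fun q : ℝ × ℝ => φ (q.1 + q.2 * I)) (hφd.continuousOn.comp (by fun_prop)
        (fun q hq => by simpa using hq.2))
    refine ⟨B, fun x y hx hy => hB (x, y) ⟨?_, hy⟩⟩
    have := abs_le.1 hx
    constructor <;> linarith
  have hB0 : 0 ≤ B := (norm_nonneg _).trans (hB ℓ 0 (by simp) ⟨le_rfl, h.pos.le⟩)
  have hs := h.sectorConst_pos
  obtain ⟨i1, i2, i3⟩ := integral_horizontal_eq (f := φ) (a := 0) (b := θ) (ε := ε)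
    (C := B * Real.exp (ε * (|ℓ| + 1)) + ((sectorConst α θ)⁻¹ * c⁻¹ * (1 / p + 1 / μ)
      + ‖H ℓ‖ * (c⁻¹ * (1 / p * (1 + p))))) h.pos.le hε0 hφd (fun x y hy => by
      rw [add_mul]
      rcases le_total (|x - ℓ|) 1 with hx | hx
      · have e1 : 1 ≤ Real.exp (ε * (|ℓ| + 1)) * Real.exp (-ε * |x|) := by
          rw [← Real.exp_add, Real.one_le_exp_iff]
          have : |x| ≤ |ℓ| + 1 := by
            have := abs_sub_abs_le_abs_sub x ℓ
            linarith
          nlinarith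
        have e2 : 0 ≤ ((sectorConst α θ)⁻¹ * c⁻¹ * (1 / p + 1 / μ)
          + ‖H ℓ‖ * (c⁻¹ * (1 / p * (1 + p)))) * Real.exp (-ε * |x|) := by positivity
        have := hB x y hx hy
        nlinarith
      · have hxne : x ≠ ℓ := by rintro rfl; simp at hx; linarith
        have e0 := hsplit (x + y * I) (by simpa using hy) (hne_of x y hxne)
        have e1 : φ (x + y * I) = _ := eq_sub_of_add_eq e0.symm
        rw [e1]
        have e2 := norm_powSymbol_mul_exp_div_le h hμ hp hc hε1 hε2 hy (hcb x y hx)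
        have e3 := mul_le_mul_of_nonneg_left (hhalf x y hx) (norm_nonneg (H ℓ))
        have e4 : 0 ≤ B * Real.exp (ε * (|ℓ| + 1)) * Real.exp (-ε * |x|) := by positivity
        refine (norm_sub_le _ _).trans ?_
        rw [norm_mul]
        linarith)
  obtain ⟨j1, j2⟩ := integral_exp_half_ray h hp
  have hθne : ∀ x : ℝ, (x + θ * I : ℂ) ≠ ℓ := fun x he => h.pos.ne' (by simpa using congrArg im he)
  have e1 : ∀ x : ℝ, powSymbol α β μ (x + θ * I) * exp (x + θ * I) / (p - exp (x + θ * I)) =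
      φ (x + θ * I) + H ℓ * (exp ((x + θ * I) / 2) / (p - exp (x + θ * I))) := fun x =>
    hsplit _ (by simpa using h.pos.le) (hθne x)
  simp only [e1]
  rw [integral_add i2 (j1.const_mul _), integral_const_mul, j2, ← i3]
  -- On the real axis `φ` takes real values away from the null set formed by `ℓ`.
  have hreal : (∫ x : ℝ, φ (x + (0 : ℝ) * I)).im = 0 := by
    rw [← RCLike.im_eq_complex_im, ← integral_im i1, integral_eq_zero_of_ae]
    filter_upwards [compl_mem_ae_iff.2 (measure_singleton ℓ)] with x hx
    have hx' : (x : ℂ) ≠ ℓ := by simpa using hx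
    have e : φ (x + (0 : ℝ) * I) = (((Real.exp (β * x) / (1 + μ * Real.exp (α * x)) *
        Real.exp (x / 2) - Real.exp (β * ℓ) / (1 + μ * Real.exp (α * ℓ)) *
        Real.exp (ℓ / 2)) * Real.exp (x / 2) / (p - Real.exp x) : ℝ) : ℂ) := by
      rw [ofReal_zero, zero_mul, add_zero, hφne _ hx']
      simp only [hH, powSymbol]
      push_cast
      rfl
    exact (congrArg im e).trans (ofReal_im _)
  rw [add_im, hreal, zero_add]
  have hHℓ : H ℓ = ((p ^ β / (1 + μ * p ^ α) * Real.sqrt p : ℝ) : ℂ) := by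
    simp only [hH]
    rw [hℓ, powSymbol_log α β μ hp, show ((Real.log p : ℝ) : ℂ) / 2 = ((Real.log p / 2 : ℝ) : ℂ) by
      push_cast; ring, ← ofReal_exp, ← ofReal_mul, Real.sqrt_eq_rpow, Real.rpow_def_of_pos hp (1 / 2)]
    congr 4; ring
  have hsq : 0 < Real.sqrt p := Real.sqrt_pos.2 hp
  rw [hHℓ, mul_left_comm, ← ofReal_mul, I_mul_im, ofReal_re]
  field_simp

end Ray

/-! ### Laplace inversion on a ray -/

section RayFunctions

open Complex Filter Topology

/-- In the variable `s = e^x` this is a Gamma integral; dilating `s` by `a` becomes a shift of `x`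
by `log a`, whence the factor `a^(-b)`. -/
theorem integrable_exp_neg_exp_mul_exp {a b : ℝ} (ha : 0 < a) (hb : 0 < b) :
    Integrable (fun x : ℝ => Real.exp (-a * Real.exp x) * Real.exp (b * x)) ∧
    ∫ x : ℝ, Real.exp (-a * Real.exp x) * Real.exp (b * x)
      = a ^ (-b) * ∫ x : ℝ, Real.exp (-Real.exp x) * Real.exp (b * x) := by
  have h1 : Integrable fun x : ℝ => Real.exp (-Real.exp x) * Real.exp (b * x) := by
    have h0 := Real.GammaIntegral_convergent hb
    rw [← Real.range_exp, ← image_univ, integrableOn_image_iff_integrableOn_abs_deriv_smul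
      (f' := Real.exp) MeasurableSet.univ (fun x _ => (Real.hasDerivAt_exp x).hasDerivWithinAt)
      Real.exp_injective.injOn, integrableOn_univ] at h0
    refine h0.congr (Eventually.of_forall fun x => ?_)
    simp only [smul_eq_mul, abs_of_pos (Real.exp_pos x)]
    rw [← Real.exp_mul, mul_left_comm, ← Real.exp_add]
    congr 2; ring
  have e : ∀ x : ℝ, Real.exp (-a * Real.exp x) * Real.exp (b * x) = a ^ (-b) *
      (Real.exp (-Real.exp (x + Real.log a)) * Real.exp (b * (x + Real.log a))) := fun x => by
    have hp : a ^ (-b) * Real.exp (b * (x + Real.log a)) = Real.exp (b * x) := by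
      rw [Real.rpow_def_of_pos ha, ← Real.exp_add]; congr 1; ring
    rw [Real.exp_add x, Real.exp_log ha, mul_left_comm, hp]
    congr 2; ring
  simp only [e]
  refine ⟨(h1.comp_add_right (Real.log a)).const_mul _, ?_⟩
  rw [integral_const_mul,
    integral_add_right_eq_self (fun x => Real.exp (-Real.exp x) * Real.exp (b * x)) (Real.log a)]

/-- The integrand of the Laplace inversion on the ray of direction `θ`, in logarithmic coordinates. -/
def rayKernel (α θ β t μ x : ℝ) : ℂ :=
  exp (t * exp (x + θ * I)) * (powSymbol α β μ (x + θ * I) * exp (x + θ * I))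

/-- The inverse Laplace transform of `p ^ β / (1 + μ p ^ α)`. -/
def ray (α θ β t μ : ℝ) : ℝ := 1 / Real.pi * (∫ x : ℝ, rayKernel α θ β t μ x).im

variable {α θ : ℝ}

theorem norm_rayKernel_le (h : SectorAngle α θ) (β t : ℝ) {μ : ℝ} (hμ : 0 ≤ μ) (x : ℝ) :
    ‖rayKernel α θ β t μ x‖ ≤ (sectorConst α θ)⁻¹ * (Real.exp (-(-Real.cos θ * t) * Real.exp x) *
      (Real.exp ((β + 1) * x) / (1 + μ * Real.exp (α * x)))) := by
  have e1 : ‖exp (t * exp (x + θ * I))‖ = Real.exp (-(-Real.cos θ * t) * Real.exp x) := by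
    rw [norm_exp, re_ofReal_mul, exp_re]
    congr 1
    simp
    ring
  have e2 : ‖exp (x + θ * I : ℂ)‖ = Real.exp x := by simpa using norm_exp_mul_add 1 x θ
  rw [rayKernel, norm_mul, norm_mul, e1, e2]
  have := norm_powSymbol_le h β hμ x (y := θ) ⟨h.pos.le, le_rfl⟩
  calc _ ≤ Real.exp (-(-Real.cos θ * t) * Real.exp x) * ((sectorConst α θ)⁻¹ *
        (Real.exp (β * x) / (1 + μ * Real.exp (α * x))) * Real.exp x) := by gcongr
    _ = _ := by rw [add_mul, one_mul, Real.exp_add]; ring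

/-- The inequality `y^η ≤ 1 + y` at `y = μ e^(αx)` trades powers of `μ` for powers of `e^x`,
independently of the size of `μ`. -/
theorem rpow_mul_exp_div_le {μ η : ℝ} (hμ : 0 ≤ μ) (h0 : 0 ≤ η) (h1 : η ≤ 1) (α b x : ℝ) :
    μ ^ η * (Real.exp (b * x) / (1 + μ * Real.exp (α * x))) ≤ Real.exp ((b - α * η) * x) := by
  have hd : 0 < 1 + μ * Real.exp (α * x) := by positivity
  rw [← mul_div_assoc, div_le_iff₀ hd]
  have hy : (μ * Real.exp (α * x)) ^ η ≤ 1 + μ * Real.exp (α * x) := by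
    have hy0 : 0 ≤ μ * Real.exp (α * x) := by positivity
    rcases le_total (μ * Real.exp (α * x)) 1 with h | h
    · exact (Real.rpow_le_one hy0 h h0).trans (by linarith)
    · calc _ ≤ (μ * Real.exp (α * x)) ^ (1:ℝ) := Real.rpow_le_rpow_of_exponent_le h h1
        _ ≤ _ := by rw [Real.rpow_one]; linarith
  rw [Real.mul_rpow hμ (Real.exp_pos _).le, ← Real.exp_mul] at hy
  have e : μ ^ η * Real.exp (b * x) =
      Real.exp ((b - α * η) * x) * (μ ^ η * Real.exp (α * x * η)) := by
    rw [mul_left_comm, ← Real.exp_add]; congr 2; ring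
  rw [e]; gcongr

theorem measurable_rayKernel (h : SectorAngle α θ) (β t : ℝ) {μ : ℝ} (hμ : 0 ≤ μ) :
    Continuous fun x => rayKernel α θ β t μ x := by
  unfold rayKernel powSymbol
  have : ∀ x : ℝ, 1 + (μ : ℂ) * exp (α * (x + θ * I)) ≠ 0 := fun x =>
    h.one_add_ne_zero hμ x ⟨h.pos.le, le_rfl⟩
  have hd : Continuous fun x : ℝ => exp (β * (x + θ * I) : ℂ) / (1 + μ * exp (α * (x + θ * I))) :=
    Continuous.div (by fun_prop) (by fun_prop) this
  fun_prop

theorem integrable_rayKernel (h : SectorAngle α θ) {β t μ : ℝ} (hβ : -1 < β) (ht : 0 < t)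
    (hμ : 0 ≤ μ) : Integrable fun x => rayKernel α θ β t μ x := by
  have hk : 0 < -Real.cos θ * t := mul_pos (by linarith [h.cos_neg]) ht
  have hc := h.sectorConst_pos
  refine ((integrable_exp_neg_exp_mul_exp hk (b := β + 1) (by linarith)).1.const_mul
    (sectorConst α θ)⁻¹).mono' (measurable_rayKernel h β t hμ).aestronglyMeasurable
    (Eventually.of_forall fun x => (norm_rayKernel_le h β t hμ x).trans ?_)
  have := rpow_mul_exp_div_le hμ le_rfl zero_le_one α (β + 1) x
  rw [Real.rpow_zero, one_mul, mul_zero, sub_zero] at this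
  gcongr

/-- On the ray `|e^(tz)|` decays because `cos θ < 0`, and trading `μ^η` for `e^(-αηx)` leaves a
Gamma integral of exponent `β + 1 - αη`. A larger `η` weakens the singularity at `t = 0`, while `η =
0` gives the best decay at infinity. -/
theorem exists_rpow_mul_ray_le (h : SectorAngle α θ) {β η : ℝ} (h0 : 0 ≤ η) (h1 : η ≤ 1)
    (hb : α * η < β + 1) : ∃ C : ℝ, 0 ≤ C ∧ ∀ t μ : ℝ, 0 < t → 0 ≤ μ →
      μ ^ η * |ray α θ β t μ| ≤ C * t ^ (α * η - β - 1) := by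
  have hc := h.sectorConst_pos
  have hk : 0 < -Real.cos θ := by linarith [h.cos_neg]
  set b := β + 1 - α * η with hbdef
  have hb0 : 0 < b := by linarith
  set J := ∫ x : ℝ, Real.exp (-Real.exp x) * Real.exp (b * x)
  have hJ : 0 ≤ J := integral_nonneg fun x => by positivity
  refine ⟨1 / Real.pi * ((sectorConst α θ)⁻¹ * ((-Real.cos θ) ^ (-b) * J)), by positivity,
    fun t μ ht hμ => ?_⟩
  obtain ⟨hi, he⟩ := integrable_exp_neg_exp_mul_exp (mul_pos hk ht) hb0
  have hμη : 0 ≤ μ ^ η := by positivity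
  calc μ ^ η * |ray α θ β t μ| = 1 / Real.pi * |(∫ x : ℝ, (μ ^ η : ℝ) * rayKernel α θ β t μ x).im| := by
        rw [ray, abs_mul, abs_of_pos (by positivity : 0 < 1 / Real.pi), integral_const_mul,
          im_ofReal_mul, abs_mul, abs_of_nonneg hμη]
        ring
    _ ≤ 1 / Real.pi * ‖∫ x : ℝ, (μ ^ η : ℝ) * rayKernel α θ β t μ x‖ := by
        gcongr; exact abs_im_le_norm _
    _ ≤ 1 / Real.pi * ∫ x : ℝ, (sectorConst α θ)⁻¹ *
        (Real.exp (-(-Real.cos θ * t) * Real.exp x) * Real.exp (b * x)) := by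
        gcongr
        refine norm_integral_le_of_norm_le (hi.const_mul _) (Eventually.of_forall fun x => ?_)
        rw [norm_mul, norm_real, Real.norm_of_nonneg hμη]
        calc _ ≤ μ ^ η * _ := mul_le_mul_of_nonneg_left (norm_rayKernel_le h β t hμ x) hμη
          _ = (sectorConst α θ)⁻¹ * (Real.exp (-(-Real.cos θ * t) * Real.exp x) *
              (μ ^ η * (Real.exp ((β + 1) * x) / (1 + μ * Real.exp (α * x))))) := by ring
          _ ≤ _ := by gcongr; exact rpow_mul_exp_div_le hμ h0 h1 α (β + 1) x
    _ = _ := by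
        rw [integral_const_mul, he, Real.mul_rpow hk.le ht.le, show α * η - β - 1 = -b by ring]
        ring

theorem continuousOn_ray (h : SectorAngle α θ) {β : ℝ} (hβ : -1 < β) :
    ContinuousOn (fun q : ℝ × ℝ => ray α θ β q.1 q.2) (Ioi 0 ×ˢ Ici 0) := by
  intro q hq
  have ht0 : 0 < q.1 := hq.1
  have hk : 0 < -Real.cos θ := by linarith [h.cos_neg]
  have hc := h.sectorConst_pos
  have hmain : ContinuousWithinAt (fun q : ℝ × ℝ => ∫ x : ℝ, rayKernel α θ β q.1 q.2 x)
      (Ioi 0 ×ˢ Ici 0) q := by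
    refine continuousWithinAt_of_dominated (bound := fun x => (sectorConst α θ)⁻¹ *
      (Real.exp (-(-Real.cos θ * (q.1 / 2)) * Real.exp x) * Real.exp ((β + 1) * x))) ?_ ?_ ?_ ?_
    · filter_upwards [self_mem_nhdsWithin] with r hr
      exact (measurable_rayKernel h β r.1 hr.2).aestronglyMeasurable
    · have h1 : ∀ᶠ r : ℝ × ℝ in 𝓝[Ioi 0 ×ˢ Ici 0] q, q.1 / 2 < r.1 :=
        nhdsWithin_le_nhds ((continuous_fst.tendsto q).eventually (lt_mem_nhds (by linarith)))
      filter_upwards [self_mem_nhdsWithin, h1] with r hr hr1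
      refine Eventually.of_forall fun x => (norm_rayKernel_le h β r.1 hr.2 x).trans ?_
      have := rpow_mul_exp_div_le hr.2 le_rfl zero_le_one α (β + 1) x
      rw [Real.rpow_zero, one_mul, mul_zero, sub_zero] at this
      have h2 : Real.exp (-(-Real.cos θ * r.1) * Real.exp x) ≤
          Real.exp (-(-Real.cos θ * (q.1 / 2)) * Real.exp x) := by
        apply Real.exp_le_exp.2
        have : -Real.cos θ * (q.1 / 2) ≤ -Real.cos θ * r.1 := by gcongr
        have := mul_le_mul_of_nonneg_right this (Real.exp_pos x).le
        linarith
      have hr2 : 0 ≤ r.2 := hr.2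
      gcongr
    · exact (integrable_exp_neg_exp_mul_exp (mul_pos hk (by linarith)) (by linarith)).1.const_mul _
    · refine Eventually.of_forall fun x => ContinuousAt.continuousWithinAt ?_
      unfold rayKernel powSymbol
      have h1 : 1 + ((q.2 : ℝ) : ℂ) * exp (α * (x + θ * I)) ≠ 0 :=
        h.one_add_ne_zero hq.2 x ⟨h.pos.le, le_rfl⟩
      have hd : ContinuousAt (fun r : ℝ × ℝ => exp (β * (x + θ * I) : ℂ) /
          (1 + (r.2 : ℂ) * exp (α * (x + θ * I)))) q :=
        ContinuousAt.div (by fun_prop) (by fun_prop) h1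
      fun_prop
  exact ((continuous_im.continuousAt.comp_continuousWithinAt hmain).const_mul (1 / Real.pi)).congr
    (fun _ _ => rfl) rfl

/-- This is the integral of `e^(tz)` along the ray. Only the fact that it is real matters: it drops
out of the imaginary part that defines `ray`. -/
theorem integral_exp_exp_ray (h : SectorAngle α θ) {t : ℝ} (ht : 0 < t) :
    ∫ x : ℝ, exp (t * exp (x + θ * I)) * exp (x + θ * I) = ((-(1 / t) : ℝ) : ℂ) := by
  have hk : 0 < -Real.cos θ := by linarith [h.cos_neg]
  have hderiv : ∀ x : ℝ, HasDerivAt (fun x : ℝ => (1 / t : ℂ) * exp (t * exp (x + θ * I)))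
      (exp (t * exp (x + θ * I)) * exp (x + θ * I)) x := by
    intro x
    have h1 : HasDerivAt (fun x : ℝ => (x + θ * I : ℂ)) 1 x :=
      (hasDerivAt_id x).ofReal_comp.add_const _
    refine ((h1.cexp.const_mul (t : ℂ)).cexp.const_mul (1 / t : ℂ)).congr_deriv ?_
    have : (t : ℂ) ≠ 0 := ofReal_ne_zero.2 ht.ne'
    field_simp
  have hint : Integrable fun x : ℝ => exp (t * exp (x + θ * I)) * exp (x + θ * I) := by
    have := integrable_rayKernel h (β := 0) (by norm_num) ht le_rfl
    simpa [rayKernel, powSymbol] using this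
  have htop : Tendsto (fun x : ℝ => (1 / t : ℂ) * exp (t * exp (x + θ * I))) atTop (𝓝 0) := by
    rw [tendsto_zero_iff_norm_tendsto_zero]
    have e : ∀ x : ℝ, ‖(1 / t : ℂ) * exp (t * exp (x + θ * I))‖ =
        1 / t * Real.exp (-((-Real.cos θ * t) * Real.exp x)) := fun x => by
      rw [norm_mul, norm_exp, re_ofReal_mul, exp_re]
      congr 1
      · simp [abs_of_pos ht]
      · congr 1; simp; ring
    simp only [e]
    have := (Real.tendsto_exp_neg_atTop_nhds_zero.comp
      (Real.tendsto_exp_atTop.const_mul_atTop (mul_pos hk ht))).const_mul (1 / t)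
    simpa using this
  have hbot : Tendsto (fun x : ℝ => (1 / t : ℂ) * exp (t * exp (x + θ * I))) atBot
      (𝓝 ((1 / t : ℂ) * exp (t * 0))) := by
    refine ((continuous_exp.tendsto _).comp (Tendsto.const_mul _ ?_)).const_mul _
    rw [tendsto_zero_iff_norm_tendsto_zero]
    simpa [norm_exp] using Real.tendsto_exp_atBot
  rw [integral_of_hasDerivAt_of_tendsto hderiv hint hbot htop]
  simp

/-- The boundary term of the constant symbol vanishes. -/
theorem ray_zero_eq (h : SectorAngle α θ) {t μ : ℝ} (ht : 0 < t) (hμ : 0 ≤ μ) :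
    ray α θ 0 t μ = -(μ * ray α θ α t μ) := by
  have e : ∀ x : ℝ, rayKernel α θ 0 t μ x = exp (t * exp (x + θ * I)) * exp (x + θ * I)
      - μ * rayKernel α θ α t μ x := fun x => by
    have h1 : 1 + (μ : ℂ) * exp (α * (x + θ * I)) ≠ 0 :=
      h.one_add_ne_zero hμ x ⟨h.pos.le, le_rfl⟩
    simp only [rayKernel, powSymbol, ofReal_zero, zero_mul, exp_zero]
    rw [one_div]
    generalize exp (α * (x + θ * I) : ℂ) = z at h1 ⊢
    field_simp
    ring
  have hint : Integrable fun x : ℝ => exp (t * exp (x + θ * I)) * exp (x + θ * I) := by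
    have := integrable_rayKernel h (β := 0) (by norm_num) ht le_rfl
    simpa [rayKernel, powSymbol] using this
  have hi2 := integrable_rayKernel h (β := α) (by linarith [h.one_lt]) ht hμ
  rw [ray, ray]
  simp only [e]
  rw [integral_sub hint (hi2.const_mul _), integral_exp_exp_ray h ht, integral_const_mul, sub_im,
    ofReal_im, im_ofReal_mul]
  ring

/-- The Laplace transform of `ray`. -/
theorem laplace_ray (h : SectorAngle α θ) {β μ p : ℝ} (hμ : 0 < μ) (hβ : -1 < β) (hβα : β < α)
    (hp : 0 < p) :
    IntegrableOn (fun t => Real.exp (-p * t) * ray α θ β t μ) (Ioi 0) ∧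
    ∫ t in Ioi (0:ℝ), Real.exp (-p * t) * ray α θ β t μ = p ^ β / (1 + μ * p ^ α) := by
  have hk : 0 < -Real.cos θ := by linarith [h.cos_neg]
  have hc := h.sectorConst_pos
  set m : ℝ → ℝ := fun x => Real.exp ((β + 1) * x) / (1 + μ * Real.exp (α * x)) with hm
  have hmc : Continuous m := Continuous.div (by fun_prop) (by fun_prop) fun x => by positivity
  have hm0 : ∀ x, 0 ≤ m x := fun x => by positivity
  have hcont : Continuous fun q : ℝ × ℝ => (Real.exp (-p * q.1) : ℂ) * rayKernel α θ β q.1 μ q.2 := by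
    unfold rayKernel powSymbol
    have h1 : ∀ x : ℝ, 1 + (μ : ℂ) * exp (α * (x + θ * I)) ≠ 0 := fun x =>
      h.one_add_ne_zero hμ.le x ⟨h.pos.le, le_rfl⟩
    have hd : Continuous fun q : ℝ × ℝ =>
        exp (β * (q.2 + θ * I) : ℂ) / (1 + μ * exp (α * (q.2 + θ * I))) :=
      Continuous.div (by fun_prop) (by fun_prop) fun q => h1 q.2
    fun_prop
  have hbound : ∀ t x : ℝ, ‖(Real.exp (-p * t) : ℂ) * rayKernel α θ β t μ x‖ ≤
      (sectorConst α θ)⁻¹ * m x * Real.exp (-(p + -Real.cos θ * Real.exp x) * t) := fun t x => by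
    rw [norm_mul, norm_real, Real.norm_of_nonneg (Real.exp_pos _).le]
    refine (mul_le_mul_of_nonneg_left (norm_rayKernel_le h β t hμ.le x) (Real.exp_pos _).le).trans
      (le_of_eq ?_)
    rw [show -(p + -Real.cos θ * Real.exp x) * t = -p * t + -(-Real.cos θ * t) * Real.exp x by ring,
      Real.exp_add]
    ring
  -- Majorant for Fubini: integrating the pointwise bound in `t` leaves this function of `x`,
  -- integrable at `-∞` because `β > -1` and at `+∞` because `β < α`.
  have hmi : Integrable fun x => m x / (p + -Real.cos θ * Real.exp x) := by
    obtain ⟨ε, hε0, hε1, hε2⟩ : ∃ ε : ℝ, 0 < ε ∧ ε ≤ β + 1 ∧ ε ≤ α - β :=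
      ⟨min (β + 1) (α - β), by simp; exact ⟨by linarith, hβα⟩, min_le_left _ _, min_le_right _ _⟩
    refine ((integrable_exp_neg_mul_abs hε0).const_mul (1 / p + 1 / (-Real.cos θ) * (1 / μ))).mono'
      (hmc.div (by fun_prop) fun x => by positivity).aestronglyMeasurable
      (Eventually.of_forall fun x => ?_)
    have hd : 0 < p + -Real.cos θ * Real.exp x := by positivity
    rw [Real.norm_of_nonneg (by have := hm0 x; positivity), div_le_iff₀ hd]
    rcases le_total x 0 with hx | hx
    · have e1 : m x ≤ Real.exp (-ε * |x|) := by
        refine (div_le_self (Real.exp_pos _).le ?_).trans ?_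
        · have : 0 ≤ μ * Real.exp (α * x) := by positivity
          linarith
        · rw [abs_of_nonpos hx]; exact Real.exp_le_exp.2 (by nlinarith)
      refine e1.trans ?_
      have : (1 / p + 1 / (-Real.cos θ) * (1 / μ)) * Real.exp (-ε * |x|) *
          (p + -Real.cos θ * Real.exp x) = Real.exp (-ε * |x|) + Real.exp (-ε * |x|) *
          (1 / p * (-Real.cos θ * Real.exp x) + 1 / (-Real.cos θ) * (1 / μ) *
            (p + -Real.cos θ * Real.exp x)) := by
        have : (1 / p) * p = 1 := one_div_mul_cancel hp.ne'
        linear_combination Real.exp (-ε * |x|) * this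
      rw [this]
      have : 0 ≤ Real.exp (-ε * |x|) * (1 / p * (-Real.cos θ * Real.exp x) +
          1 / (-Real.cos θ) * (1 / μ) * (p + -Real.cos θ * Real.exp x)) := by positivity
      linarith
    · have e1 : m x ≤ 1 / μ * (Real.exp (-ε * |x|) * Real.exp x) := by
        rw [hm, div_le_iff₀ (by positivity), abs_of_nonneg hx]
        have e2 : Real.exp ((β + 1) * x) ≤ Real.exp (-ε * x) * Real.exp x * Real.exp (α * x) := by
          rw [← Real.exp_add, ← Real.exp_add]; exact Real.exp_le_exp.2 (by nlinarith)
        refine e2.trans ?_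
        have : 1 / μ * (Real.exp (-ε * x) * Real.exp x) * (1 + μ * Real.exp (α * x)) =
          Real.exp (-ε * x) * Real.exp x * Real.exp (α * x) +
            1 / μ * (Real.exp (-ε * x) * Real.exp x) := by field_simp; ring
        rw [this]
        have : 0 ≤ 1 / μ * (Real.exp (-ε * x) * Real.exp x) := by positivity
        linarith
      refine e1.trans ?_
      have : (1 / p + 1 / (-Real.cos θ) * (1 / μ)) * Real.exp (-ε * |x|) *
          (p + -Real.cos θ * Real.exp x) = 1 / μ * (Real.exp (-ε * |x|) * Real.exp x) +
          Real.exp (-ε * |x|) * (1 / p * (p + -Real.cos θ * Real.exp x) +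
            1 / (-Real.cos θ) * (1 / μ) * p) := by
        have : (1 / (-Real.cos θ)) * (-Real.cos θ) = 1 := one_div_mul_cancel hk.ne'
        linear_combination Real.exp (-ε * |x|) * (1 / μ) * Real.exp x * this
      rw [this]
      have : 0 ≤ Real.exp (-ε * |x|) * (1 / p * (p + -Real.cos θ * Real.exp x) +
            1 / (-Real.cos θ) * (1 / μ) * p) := by positivity
      linarith
  have hprod : Integrable (fun q : ℝ × ℝ => (Real.exp (-p * q.1) : ℂ) * rayKernel α θ β q.1 μ q.2)
      ((volume.restrict (Ioi 0)).prod volume) := by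
    have hG : Integrable (fun q : ℝ × ℝ => (sectorConst α θ)⁻¹ * m q.2 *
        Real.exp (-(p + -Real.cos θ * Real.exp q.2) * q.1))
        ((volume.restrict (Ioi 0)).prod volume) := by
      rw [integrable_prod_iff' (Continuous.aestronglyMeasurable (by fun_prop))]
      have hx : ∀ x : ℝ, -(p + -Real.cos θ * Real.exp x) < 0 := fun x => by
        have : 0 < p + -Real.cos θ * Real.exp x := by positivity
        linarith
      refine ⟨Eventually.of_forall fun x => (integrableOn_exp_mul_Ioi (hx x) 0).const_mul
        ((sectorConst α θ)⁻¹ * m x), ?_⟩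
      refine (hmi.const_mul (sectorConst α θ)⁻¹).congr (Eventually.of_forall fun x => ?_)
      have : ∀ t : ℝ, ‖(sectorConst α θ)⁻¹ * m x * Real.exp (-(p + -Real.cos θ * Real.exp x) * t)‖ =
          (sectorConst α θ)⁻¹ * m x * Real.exp (-(p + -Real.cos θ * Real.exp x) * t) := fun t =>
        Real.norm_of_nonneg (by have := hm0 x; positivity)
      simp only [this]
      rw [integral_const_mul, integral_exp_neg_mul_Ioi (by linarith [hx x])]
      ring
    exact hG.mono' hcont.aestronglyMeasurable (Eventually.of_forall fun q => hbound q.1 q.2)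
  have e1 : ∀ t : ℝ, Real.exp (-p * t) * ray α θ β t μ = 1 / Real.pi *
      (∫ x : ℝ, (Real.exp (-p * t) : ℂ) * rayKernel α θ β t μ x).im := fun t => by
    rw [integral_const_mul, im_ofReal_mul, ray]; ring
  simp only [e1]
  have hi := hprod.integral_prod_left
  refine ⟨hi.im.const_mul _, ?_⟩
  have hswap := integral_integral_swap
    (f := fun t x => (Real.exp (-p * t) : ℂ) * rayKernel α θ β t μ x) hprod
  have him : ∫ t in Ioi (0:ℝ), (∫ x : ℝ, (Real.exp (-p * t) : ℂ) * rayKernel α θ β t μ x).im =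
    (∫ t in Ioi (0:ℝ), ∫ x : ℝ, (Real.exp (-p * t) : ℂ) * rayKernel α θ β t μ x).im :=
    integral_im hi
  rw [integral_const_mul, him, hswap]
  have e2 : ∀ x : ℝ, ∫ t in Ioi (0:ℝ), (Real.exp (-p * t) : ℂ) * rayKernel α θ β t μ x =
      powSymbol α β μ (x + θ * I) * exp (x + θ * I) / (p - exp (x + θ * I)) := fun x => by
    have hre : (exp (x + θ * I) - p).re < 0 := by
      rw [sub_re, exp_re, ofReal_re]
      simp
      have := h.cos_neg
      nlinarith [Real.exp_pos x]
    have e3 : ∀ t : ℝ, (Real.exp (-p * t) : ℂ) * rayKernel α θ β t μ x =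
        (powSymbol α β μ (x + θ * I) * exp (x + θ * I)) * exp ((exp (x + θ * I) - p) * t) :=
      fun t => by
        have : exp ((exp (x + θ * I) - p) * t) = (Real.exp (-p * t) : ℂ) * exp (t * exp (x + θ * I)) := by
          rw [ofReal_exp, ← exp_add]; congr 1; push_cast; ring
        rw [this, rayKernel]; ring
    simp only [e3]
    rw [integral_const_mul, integral_exp_mul_complex_Ioi hre]
    simp only [ofReal_zero, mul_zero, exp_zero]
    rw [← neg_sub (p : ℂ) (exp _), neg_div_neg_eq, mul_one_div]
  simp only [e2]
  rw [integral_powSymbol_ray h hμ hβ hβα hp]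
  field_simp

end RayFunctions

/-! ### Bounds on the inverse transforms, uniform in the spectral variable. -/

section SymbolFamilies

open Filter Topology

variable {α θ : ℝ}

theorem continuousOn_ray_left (h : SectorAngle α θ) {β μ : ℝ} (hβ : -1 < β) (hμ : 0 ≤ μ) :
    ContinuousOn (fun t => ray α θ β t μ) (Ioi 0) :=
  (continuousOn_ray h hβ).comp (f := fun t : ℝ => (t, μ)) (by fun_prop) fun _ ht => ⟨ht, hμ⟩

/-- The splitting point `s` is left free so that it can be tuned to `μ` when a bound uniform in `μ`
is wanted. -/
theorem integrableOn_Ioi_of_rpow_bounds {E : Type*} [NormedAddCommGroup E] {f : ℝ → E}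
    {a b A B s : ℝ} (hs : 0 < s) (ha : a < 1) (hb : 1 < b) (hc : ContinuousOn f (Ioi 0))
    (h1 : ∀ t, 0 < t → ‖f t‖ ≤ A * t ^ (-a)) (h2 : ∀ t, 0 < t → ‖f t‖ ≤ B * t ^ (-b)) :
    IntegrableOn f (Ioi 0) ∧
    ∫ t in Ioi (0:ℝ), ‖f t‖ ≤ A * (s ^ (1 - a) / (1 - a)) + B * (s ^ (1 - b) / (b - 1)) := by
  have hm := hc.aestronglyMeasurable measurableSet_Ioi (μ := volume)
  have i1 : IntegrableOn (fun t : ℝ => A * t ^ (-a)) (Ioc 0 s) :=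
    Integrable.const_mul ((intervalIntegrable_iff_integrableOn_Ioc_of_le hs.le).1
      (intervalIntegral.intervalIntegrable_rpow' (by linarith))) _
  have i2 : IntegrableOn (fun t : ℝ => B * t ^ (-b)) (Ioi s) :=
    Integrable.const_mul (integrableOn_Ioi_rpow_of_lt (by linarith) hs) _
  have f1 : IntegrableOn f (Ioc 0 s) := by
    refine i1.mono' (hm.mono_measure (Measure.restrict_mono Ioc_subset_Ioi_self le_rfl)) ?_
    filter_upwards [ae_restrict_mem measurableSet_Ioc] with t ht using h1 t ht.1
  have f2 : IntegrableOn f (Ioi s) := by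
    refine i2.mono' (hm.mono_measure (Measure.restrict_mono (Ioi_subset_Ioi hs.le) le_rfl)) ?_
    filter_upwards [ae_restrict_mem measurableSet_Ioi] with t ht using h2 t (hs.trans ht)
  have hf : IntegrableOn f (Ioi 0) := by
    rw [← Ioc_union_Ioi_eq_Ioi hs.le]; exact f1.union f2
  refine ⟨hf, ?_⟩
  rw [← Ioc_union_Ioi_eq_Ioi hs.le, setIntegral_union Ioc_disjoint_Ioi_same measurableSet_Ioi
    f1.norm f2.norm]
  refine add_le_add ?_ ?_
  · calc _ ≤ ∫ t in Ioc 0 s, A * t ^ (-a) :=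
          setIntegral_mono_on f1.norm i1 measurableSet_Ioc fun t ht => h1 t ht.1
      _ = _ := by
        rw [integral_const_mul, ← intervalIntegral.integral_of_le hs.le,
          integral_rpow (Or.inl (by linarith)), Real.zero_rpow (by linarith), sub_zero]
        ring_nf
  · calc _ ≤ ∫ t in Ioi s, B * t ^ (-b) :=
          setIntegral_mono_on f2.norm i2 measurableSet_Ioi fun t ht => h2 t (hs.trans ht)
      _ = _ := by
        rw [integral_const_mul, integral_Ioi_rpow_of_lt (by linarith) hs]
        congr 1
        rw [← neg_div_neg_eq (s ^ (1 - b)) (b - 1)]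
        congr 1 <;> ring_nf

theorem integrableOn_exp_smul_of_rpow_bound {E : Type*} [NormedAddCommGroup E] [NormedSpace ℝ E]
    {f : ℝ → E} {a A p : ℝ} (hp : 0 < p) (ha : a < 1) (hc : ContinuousOn f (Ioi 0))
    (h1 : ∀ t, 0 < t → ‖f t‖ ≤ A * t ^ (-a)) :
    IntegrableOn (fun t => Real.exp (-p * t) • f t) (Ioi 0) := by
  have hi := (integrableOn_rpow_mul_exp_neg_mul_rpow (s := -a) (p := 1) (by linarith) one_pos hp).const_mul A
  refine hi.mono' (((by fun_prop : Continuous fun t : ℝ => Real.exp (-p * t)).continuousOn.smul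
    hc).aestronglyMeasurable measurableSet_Ioi) ?_
  filter_upwards [ae_restrict_mem measurableSet_Ioi] with t ht
  rw [norm_smul, Real.norm_of_nonneg (Real.exp_pos _).le, Real.rpow_one, ← mul_assoc, mul_comm]
  gcongr
  exact h1 t ht

/-- The symbol of the propagator of the initial displacement is bounded. -/
theorem exists_mul_ray_bounded (h : SectorAngle α θ) :
    ∃ C : ℝ, 0 ≤ C ∧ ∀ t μ : ℝ, 0 < t → 0 ≤ μ → μ * |ray α θ (α - 1) t μ| ≤ C := by
  have h1 := h.one_lt
  have h2 := h.lt_two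
  -- The exponents `β = α - 1`, `η = 1` are the excluded endpoint `αη = β + 1` of this estimate. The
  -- symbol is instead written as `1` minus the primitive of `ray 0`, whose `L¹` norm in time is
  -- bounded uniformly in `μ`.
  obtain ⟨C₁, hC₁, hb₁⟩ := exists_rpow_mul_ray_le h (β := 0) (η := 1 / 2) (by norm_num) (by norm_num)
    (by linarith)
  obtain ⟨C₂, hC₂, hb₂⟩ := exists_rpow_mul_ray_le h (β := α) (η := 0) le_rfl zero_le_one
    (by linarith)
  refine ⟨1 + (C₁ * (2 / α) + C₂ * (1 / α)), by positivity, fun t μ ht hμ => ?_⟩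
  rcases hμ.eq_or_lt with rfl | hμ
  · rw [zero_mul]; positivity
  have hc0 := continuousOn_ray_left h (β := 0) (by norm_num) hμ.le
  -- Near `0` the bound is `μ^(-1/2) t^(α/2-1)`; at infinity the cancellation `ray_zero_eq` improves
  -- `1 / t` to `μ t^(-1-α)`. At `s = μ^(1/α)` all powers of `μ` cancel in both pieces.
  obtain ⟨hi, hI⟩ := integrableOn_Ioi_of_rpow_bounds (f := fun t => ray α θ 0 t μ)
    (a := 1 - α / 2) (b := 1 + α) (A := μ ^ (-(1 / 2) : ℝ) * C₁) (B := μ * C₂)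
    (s := μ ^ (1 / α)) (by positivity) (by linarith) (by linarith) hc0
    (fun t ht => by
      have := hb₁ t μ ht hμ.le
      rw [show α * (1 / 2) - 0 - 1 = -(1 - α / 2) by ring] at this
      rwa [Real.rpow_neg hμ.le, mul_assoc, inv_mul_eq_div, le_div_iff₀' (by positivity)])
    (fun t ht => by
      have := hb₂ t μ ht hμ.le
      rw [Real.rpow_zero, one_mul, show α * 0 - α - 1 = -(1 + α) by ring] at this
      rw [ray_zero_eq h ht hμ.le, norm_neg, Real.norm_eq_abs, abs_mul, abs_of_pos hμ, mul_assoc]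
      gcongr)
  have hI' : ∫ t in Ioi (0:ℝ), ‖ray α θ 0 t μ‖ ≤ C₁ * (2 / α) + C₂ * (1 / α) := by
    refine hI.trans (le_of_eq ?_)
    have e1 : μ ^ (-(1 / 2) : ℝ) * (μ ^ (1 / α)) ^ (1 - (1 - α / 2)) = 1 := by
      rw [← Real.rpow_mul hμ.le, ← Real.rpow_add hμ]
      convert Real.rpow_zero μ using 2; field_simp; ring
    have e2 : μ * (μ ^ (1 / α)) ^ (1 - (1 + α)) = 1 := by
      rw [← Real.rpow_mul hμ.le]
      nth_rewrite 1 [← Real.rpow_one μ]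
      rw [← Real.rpow_add hμ]
      convert Real.rpow_zero μ using 2; field_simp; ring
    calc _ = C₁ * (μ ^ (-(1 / 2) : ℝ) * (μ ^ (1 / α)) ^ (1 - (1 - α / 2))) / (1 - (1 - α / 2)) +
          C₂ * (μ * (μ ^ (1 / α)) ^ (1 - (1 + α))) / (1 + α - 1) := by ring
      _ = _ := by
        rw [e1, e2, show 1 - (1 - α / 2) = α / 2 by ring, show 1 + α - 1 = α by ring]
        field_simp
  -- In transforms: `μ p^(α-1) / (1 + μ p^α) = 1/p - (1/p) · 1 / (1 + μ p^α)`.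
  have hprim : EqOn (fun t => μ * ray α θ (α - 1) t μ)
      (fun t => 1 - primitive (fun t => ray α θ 0 t μ) t) (Ioi 0) := by
    have hl : ∀ p : ℝ, 0 < p → _ := fun p hp =>
      laplace_ray h hμ (β := α - 1) (p := p) (by linarith) (by linarith) hp
    have hl0 : ∀ p : ℝ, 0 < p → _ := fun p hp =>
      laplace_ray h hμ (β := 0) (p := p) (by linarith) (by linarith) hp
    have hpr : ∀ p : ℝ, 0 < p → _ := fun p hp =>
      laplace_primitive (g := fun t => ray α θ 0 t μ) hp
        (by simpa only [smul_eq_mul] using (hl0 p hp).1)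
    have hone : ∀ p : ℝ, 0 < p → IntegrableOn (fun t => Real.exp (-p * t)) (Ioi 0) := fun p hp =>
      integrableOn_exp_mul_Ioi (a := -p) (by linarith) 0
    refine eqOn_of_laplace_eq
      ((continuousOn_ray_left h (by linarith) hμ.le).const_mul μ |>.congr fun _ _ => rfl)
      ((continuous_const.sub (continuous_primitive hi)).continuousOn)
      (fun p hp => ?_) (fun p hp => ?_) (fun p hp => ?_)
    · simpa only [smul_eq_mul, mul_left_comm] using! (hl p hp).1.const_mul μ
    · simp only [mul_sub, smul_eq_mul, mul_one]
      exact (hone p hp).sub (hpr p hp).1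
    · simp only [mul_sub, smul_eq_mul, mul_one, mul_left_comm (b := μ)]
      have e1 := (hpr p hp).2
      simp only [smul_eq_mul] at e1
      have e2 := (hpr p hp).1
      simp only [smul_eq_mul] at e2
      rw [integral_const_mul, (hl p hp).2, integral_sub (hone p hp) e2, integral_exp_neg_mul_Ioi hp,
        e1, (hl0 p hp).2]
      have hpa : 0 < p ^ α := by positivity
      rw [Real.rpow_sub hp, Real.rpow_one, Real.rpow_zero]
      field_simp
      ring
  have := hprim ht
  calc μ * |ray α θ (α - 1) t μ| = |1 - primitive (fun t => ray α θ 0 t μ) t| := by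
        rw [← abs_of_pos hμ, ← abs_mul, abs_of_pos hμ]; exact congrArg abs this
    _ ≤ |(1:ℝ)| + |primitive (fun t => ray α θ 0 t μ) t| := abs_sub _ _
    _ ≤ _ := by
      rw [abs_one]
      gcongr
      exact (norm_primitive_le hi t).trans hI'

/-! ### The symbols as continuous functions on the spectrum -/

variable (M : ℝ)

/-- The function `μ ↦ ray α θ β t μ` on `[0, M]`. -/
def rayMap (α θ β t : ℝ) : C(Icc (0:ℝ) M, ℝ) :=
  open Classical in
  if h : Continuous fun μ : Icc (0:ℝ) M => ray α θ β t μ then ⟨_, h⟩ else 0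

/-- The function `μ ↦ μ ^ η` on `[0, M]`. -/
def powMap (η : ℝ) (hη : 0 ≤ η) : C(Icc (0:ℝ) M, ℝ) :=
  ⟨fun μ => (μ : ℝ) ^ η, by
    exact continuous_subtype_val.rpow_const fun _ => Or.inr hη⟩

/-- The function `μ ↦ 1 / (1 + q μ)` on `[0, M]`. -/
def resMap (q : ℝ) (hq : 0 ≤ q) : C(Icc (0:ℝ) M, ℝ) :=
  ⟨fun μ => 1 / (1 + μ * q), by
    refine Continuous.div (by fun_prop) (by fun_prop) fun μ => ?_
    have := μ.2.1
    positivity⟩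

variable {M}

/-- Continuity in `μ` up to `μ = 0` holds for every `t > 0`, so the default value of `rayMap` plays
no role at positive times. -/
theorem rayMap_apply (h : SectorAngle α θ) {β t : ℝ} (hβ : -1 < β) (ht : 0 < t)
    (μ : Icc (0:ℝ) M) : rayMap M α θ β t μ = ray α θ β t μ := by
  have : Continuous fun μ : Icc (0:ℝ) M => ray α θ β t μ :=
    (continuousOn_ray h hβ).comp_continuous (f := fun μ : Icc (0:ℝ) M => (t, (μ : ℝ)))
      (by fun_prop) fun μ => ⟨ht, μ.2.1⟩
  rw [rayMap, dif_pos this]; rfl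

/-- Joint continuity in `(t, μ)` is curried: the compact-open topology on functions over the compact
interval is that of the sup norm. -/
theorem continuousOn_rayMap (h : SectorAngle α θ) {β : ℝ} (hβ : -1 < β) :
    ContinuousOn (rayMap M α θ β) (Ioi 0) := by
  rw [continuousOn_iff_continuous_domRestrict]
  let F : C(Ioi (0:ℝ) × Icc (0:ℝ) M, ℝ) := ⟨fun q => ray α θ β q.1 q.2,
    (continuousOn_ray h hβ).comp_continuous
      (f := fun q : Ioi (0:ℝ) × Icc (0:ℝ) M => ((q.1 : ℝ), (q.2 : ℝ))) (by fun_prop)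
      fun q => ⟨q.1.2, q.2.2.1⟩⟩
  convert F.curry.continuous using 1
  ext t μ
  exact rayMap_apply h hβ t.2 μ

@[simp] theorem powMap_apply (η : ℝ) (hη : 0 ≤ η) (μ : Icc (0:ℝ) M) :
    powMap M η hη μ = (μ : ℝ) ^ η := rfl

@[simp] theorem resMap_apply (q : ℝ) (hq : 0 ≤ q) (μ : Icc (0:ℝ) M) :
    resMap M q hq μ = 1 / (1 + μ * q) := rfl

theorem exists_norm_powMap_mul_rayMap_le (h : SectorAngle α θ) {β η : ℝ} (hβ : -1 < β) (h0 : 0 ≤ η)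
    (h1 : η ≤ 1) (hb : α * η < β + 1) : ∃ C : ℝ, 0 ≤ C ∧ ∀ t : ℝ, 0 < t →
      ‖powMap M η h0 * rayMap M α θ β t‖ ≤ C * t ^ (α * η - β - 1) := by
  obtain ⟨C, hC, hC'⟩ := exists_rpow_mul_ray_le h h0 h1 hb
  refine ⟨C, hC, fun t ht => (ContinuousMap.norm_le _ (by positivity)).2 fun μ => ?_⟩
  rw [ContinuousMap.mul_apply, powMap_apply, rayMap_apply h hβ ht, norm_mul,
    Real.norm_of_nonneg (Real.rpow_nonneg μ.2.1 _)]
  exact hC' t μ ht μ.2.1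

/-- Laplace transforms of families of symbols are computed pointwise. -/
theorem laplace_powMap_mul_rayMap (h : SectorAngle α θ) {β η p : ℝ} (hβ : -1 < β) (hβα : β < α)
    (hη : 0 < η) (hp : 0 < p)
    (hi : IntegrableOn (fun t => Real.exp (-p * t) • (powMap M η hη.le * rayMap M α θ β t)) (Ioi 0)) :
    ∫ t in Ioi (0:ℝ), Real.exp (-p * t) • (powMap M η hη.le * rayMap M α θ β t)
      = p ^ β • (powMap M η hη.le * resMap M (p ^ α) (by positivity)) := by
  ext μ
  have e := (ContinuousMap.evalCLM ℝ μ).integral_comp_comm hi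
  refine (e.symm.trans ?_)
  have e1 : ∀ t ∈ Ioi (0:ℝ), (ContinuousMap.evalCLM ℝ μ)
      (Real.exp (-p * t) • (powMap M η hη.le * rayMap M α θ β t)) =
      (μ : ℝ) ^ η * (Real.exp (-p * t) * ray α θ β t μ) := fun t ht => by
    simp only [ContinuousMap.evalCLM_apply, ContinuousMap.smul_apply, ContinuousMap.mul_apply,
      powMap_apply, rayMap_apply h hβ ht, smul_eq_mul]
    ring
  rw [setIntegral_congr_fun measurableSet_Ioi e1, integral_const_mul]
  -- The Cauchy formula requires `μ > 0`. At the spectral point `0` both sides vanish thanks to the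
  -- factor `μ^η`.
  rcases μ.2.1.eq_or_lt with h0 | h0
  · simp [← h0, Real.zero_rpow hη.ne']
  · rw [(laplace_ray h h0 hβ hβα hp).2]
    simp only [ContinuousMap.smul_apply, ContinuousMap.mul_apply, powMap_apply, resMap_apply,
      smul_eq_mul]
    ring

end SymbolFamilies

/-! ### Continuous functional calculus for a positive operator on a real Hilbert space -/

section Calculus

variable {H : Type*} [NormedAddCommGroup H] [InnerProductSpace ℝ H]

/-- Only the vectors `R^i x` with `i ≤ deg P` matter. Compressing `R` to their span gives a
symmetric operator in finite dimension, whose powers act on `x` as those of `R` up to that degree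
and whose eigenvalues, being Rayleigh quotients of `R`, lie in `[0, M]`. Diagonalising it yields the
bound. -/
theorem norm_aeval_apply_le {R : H →L[ℝ] H} {M C : ℝ} (hsym : ∀ x y, inner ℝ (R x) y = inner ℝ x (R y))
    (hpos : ∀ x, 0 ≤ inner ℝ (R x) x) (hM : ‖R‖ ≤ M) (P : Polynomial ℝ)
    (hP : ∀ μ ∈ Icc (0:ℝ) M, |P.eval μ| ≤ C) (x : H) :
    ‖Polynomial.aeval R P x‖ ≤ C * ‖x‖ := by
  set n := P.natDegree
  let K : Submodule ℝ H := Submodule.span ℝ ((fun i => (R ^ i) x) '' (Iic n))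
  have : FiniteDimensional ℝ K :=
    FiniteDimensional.span_of_finite ℝ ((finite_Iic n).image _)
  have hmem : ∀ i ≤ n, (R ^ i) x ∈ K := fun i hi => Submodule.subset_span ⟨i, hi, rfl⟩
  let T : K →ₗ[ℝ] K := (K.orthogonalProjectionOnto ∘L R ∘L K.subtypeL).toLinearMap
  have hTapp : ∀ u v : K, inner ℝ (T u) v = inner ℝ (R u) (v : H) := fun u v => by
    change inner ℝ (K.orthogonalProjectionOnto (R u)) v = _
    exact Submodule.inner_orthogonalProjectionOnto_eq_of_mem_right v (R u)
  have hT : T.IsSymmetric := fun u v => by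
    rw [hTapp, hsym, real_inner_comm, ← hTapp, real_inner_comm]
  let y : K := ⟨x, by simpa using hmem 0 (Nat.zero_le _)⟩
  have hpow : ∀ i ≤ n, ((T ^ i) y : H) = (R ^ i) x := by
    intro i
    induction i with
    | zero => intro _; simp [y]
    | succ i ih =>
      intro hi
      rw [pow_succ', pow_succ', Module.End.mul_apply, mul_apply_eq_comp,
        ← ih (by omega)]
      change (K.orthogonalProjectionOnto (R ((T ^ i) y)) : H) = _
      rw [ih (by omega), ← mul_apply_eq_comp, ← pow_succ']
      exact congrArg Subtype.val
        (Submodule.orthogonalProjectionOnto_mem_subspace_eq_self ⟨_, hmem _ hi⟩)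
  have heval : ((Polynomial.aeval T P y : K) : H) = Polynomial.aeval R P x := by
    rw [Polynomial.aeval_eq_sum_range, Polynomial.aeval_eq_sum_range, LinearMap.sum_apply,
      sum_apply, Submodule.coe_sum]
    refine Finset.sum_congr rfl fun i hi => ?_
    have hi' : i ≤ n := by simpa [Nat.lt_succ_iff] using hi
    rw [LinearMap.smul_apply, smul_apply, Submodule.coe_smul, hpow i hi']
  let b := hT.eigenvectorBasis rfl
  have hb : ∀ (Q : Polynomial ℝ) (v : K) i,
      b.repr (Polynomial.aeval T Q v) i = Q.eval (hT.eigenvalues rfl i) * b.repr v i := by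
    intro Q v i
    induction Q using Polynomial.induction_on' with
    | add Q₁ Q₂ h₁ h₂ => simp [h₁, h₂, add_mul]
    | monomial m a =>
      have : ∀ m : ℕ, b.repr ((T ^ m) v) i = (hT.eigenvalues rfl i) ^ m * b.repr v i := by
        intro m
        induction m with
        | zero => simp
        | succ m ih =>
          rw [pow_succ', Module.End.mul_apply]
          refine (hT.eigenvectorBasis_apply_self_apply rfl _ i).trans ?_
          change _ * b.repr ((T ^ m) v) i = _
          rw [ih, pow_succ']
          simp only [RCLike.ofReal_real_eq_id, id_eq]
          ring
      simp [Polynomial.aeval_monomial, this, Module.algebraMap_end_apply, mul_assoc]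
  have hev : ∀ i, hT.eigenvalues rfl i ∈ Icc (0:ℝ) M := by
    intro i
    have hn : ‖b i‖ = 1 := b.orthonormal.1 i
    have e : hT.eigenvalues rfl i = inner ℝ (R (b i)) (b i : H) := by
      rw [← hTapp, show T (b i) = _ from hT.apply_eigenvectorBasis rfl i]
      change _ = inner ℝ (_ • b i) (b i)
      rw [real_inner_smul_left, real_inner_self_eq_norm_sq, hn]
      simp
    rw [e]
    refine ⟨hpos _, (real_inner_le_norm _ _).trans ?_⟩
    have hn' : ‖(b i : H)‖ = 1 := hn
    calc _ ≤ ‖R‖ * ‖(b i : H)‖ * ‖(b i : H)‖ := by gcongr; exact R.le_opNorm _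
      _ ≤ M := by rw [hn']; linarith
  rw [← heval]
  change ‖Polynomial.aeval T P y‖ ≤ C * ‖y‖
  have hC : ∀ i, |P.eval (hT.eigenvalues rfl i)| ≤ C := fun i => hP _ (hev i)
  rw [← b.repr.norm_map, ← b.repr.norm_map y]
  by_cases hne : Nonempty (Fin (Module.finrank ℝ K))
  · have hC0 : 0 ≤ C := (abs_nonneg _).trans (hC hne.some)
    refine le_of_sq_le_sq ?_ (by positivity)
    rw [mul_pow, EuclideanSpace.norm_sq_eq, EuclideanSpace.norm_sq_eq, Finset.mul_sum]
    refine Finset.sum_le_sum fun i _ => ?_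
    rw [hb, norm_mul, mul_pow]
    gcongr
    exact hC i
  · have : IsEmpty (Fin (Module.finrank ℝ K)) := not_nonempty_iff.1 hne
    have h0 : ∀ z : EuclideanSpace ℝ (Fin (Module.finrank ℝ K)), ‖z‖ = 0 := fun z => by
      rw [EuclideanSpace.norm_eq]; simp
    rw [h0, h0, mul_zero]

/-- The continuous functional calculus of a positive operator. -/
structure IsCalculus (M : ℝ) (R : H →L[ℝ] H) (Φ : C(Icc (0:ℝ) M, ℝ) →L[ℝ] (H →L[ℝ] H)) : Prop where
  norm_le : ∀ g, ‖Φ g‖ ≤ ‖g‖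
  map_one : Φ 1 = ContinuousLinearMap.id ℝ H
  map_pow_one : Φ (powMap M 1 zero_le_one) = R
  map_mul : ∀ f g x, Φ (f * g) x = Φ f (Φ g x)
  symm : ∀ g x y, inner ℝ (Φ g x) y = inner ℝ x (Φ g y)

variable [CompleteSpace H]

/-- Polynomials are dense in the continuous functions on `[0, M]`, and `norm_aeval_apply_le` makes
`P ↦ P(R)` contractive for the sup norm, so it extends. The algebraic identities pass to the limit
by density. -/
theorem exists_isCalculus {R : H →L[ℝ] H} {M : ℝ} (hsym : ∀ x y, inner ℝ (R x) y = inner ℝ x (R y))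
    (hpos : ∀ x, 0 ≤ inner ℝ (R x) x) (hM : ‖R‖ ≤ M) :
    ∃ Φ : C(Icc (0:ℝ) M, ℝ) →L[ℝ] (H →L[ℝ] H), IsCalculus M R Φ := by
  let f : Polynomial ℝ →ₗ[ℝ] (H →L[ℝ] H) := (Polynomial.aeval R).toLinearMap
  let e : Polynomial ℝ →ₗ[ℝ] C(Icc (0:ℝ) M, ℝ) :=
    (Polynomial.toContinuousMapOnAlgHom (Icc (0:ℝ) M)).toLinearMap
  have hd : DenseRange e := by
    intro g
    have := continuousMap_mem_polynomialFunctions_closure 0 M g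
    rw [← SetLike.mem_coe, Subalgebra.topologicalClosure_coe, polynomialFunctions_coe] at this
    exact this
  have hn : ∀ P, ‖f P‖ ≤ 1 * ‖e P‖ := fun P => by
    rw [one_mul]
    refine ContinuousLinearMap.opNorm_le_bound _ (norm_nonneg _) fun x => ?_
    exact norm_aeval_apply_le hsym hpos hM P
      (fun μ hμ => (e P).norm_coe_le_norm ⟨μ, hμ⟩) x
  let Φ := f.extendOfNorm e
  have hΦ : ∀ P, Φ (e P) = Polynomial.aeval R P := fun P =>
    LinearMap.extendOfNorm_eq hd ⟨1, hn⟩ P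
  refine ⟨Φ, fun g => by simpa using LinearMap.norm_extendOfNorm_apply_le hd 1 hn g, ?_, ?_, ?_, ?_⟩
  · have : (1 : C(Icc (0:ℝ) M, ℝ)) = e 1 := by ext μ; simp [e]
    rw [this, hΦ, _root_.map_one]; rfl
  · have : powMap M 1 zero_le_one = e Polynomial.X := by ext μ; simp [e]
    rw [this, hΦ, Polynomial.aeval_X]
  · intro g₁ g₂ x
    refine hd.induction_on₂ (p := fun g₁ g₂ => Φ (g₁ * g₂) x = Φ g₁ (Φ g₂ x)) ?_ ?_ g₁ g₂
    · refine isClosed_eq (by fun_prop) ?_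
      have : Continuous fun q : C(Icc (0:ℝ) M, ℝ) × C(Icc (0:ℝ) M, ℝ) => Φ q.1 (Φ q.2 x) := by
        fun_prop
      exact this
    · intro P Q
      have : e P * e Q = e (P * Q) :=
        (_root_.map_mul (Polynomial.toContinuousMapOnAlgHom (Icc (0:ℝ) M)) P Q).symm
      rw [this, hΦ, hΦ, hΦ, _root_.map_mul]; rfl
  · intro g x y
    refine hd.induction_on (p := fun g => inner ℝ (Φ g x) y = inner ℝ x (Φ g y)) g ?_ ?_
    · exact isClosed_eq (by fun_prop) (by fun_prop)
    · intro P
      rw [hΦ]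
      induction P using Polynomial.induction_on' with
      | add P Q h₁ h₂ =>
        simp only [map_add, add_apply, inner_add_left, inner_add_right, h₁, h₂]
      | monomial m a =>
        have : ∀ (m : ℕ) (x y : H), inner ℝ ((R ^ m) x) y = inner ℝ x ((R ^ m) y) := by
          intro m
          induction m with
          | zero => intro x y; simp
          | succ m ih =>
            intro x y
            nth_rewrite 1 [pow_succ']
            rw [pow_succ, mul_apply_eq_comp, mul_apply_eq_comp, hsym, ih]
        simp only [Polynomial.aeval_monomial, mul_apply_eq_comp,
          ContinuousLinearMap.algebraMap_apply, real_inner_smul_left, real_inner_smul_right, this]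

/-- By symmetry, the orthogonal complement of the range is the kernel. -/
theorem denseRange_of_symm_of_injective {R : H →L[ℝ] H}
    (hsym : ∀ x y, inner ℝ (R x) y = inner ℝ x (R y)) (hinj : ∀ x, R x = 0 → x = 0) :
    DenseRange R := by
  have h : (LinearMap.range R.toLinearMap).topologicalClosure = ⊤ := by
    rw [Submodule.topologicalClosure_eq_top_iff, Submodule.eq_bot_iff]
    intro x hx
    refine hinj x (ext_inner_left ℝ fun y => ?_)
    rw [inner_zero_right, ← hsym]
    exact (Submodule.mem_orthogonal _ _).1 hx (R y) ⟨y, rfl⟩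
  intro x
  have hx : x ∈ (LinearMap.range R.toLinearMap).topologicalClosure := h ▸ Submodule.mem_top
  exact hx

/-- A vector whose functional is controlled by `S` lies in the range of `S`. -/
theorem exists_eq_apply_of_inner_le {S : H →L[ℝ] H} (hsym : ∀ x y, inner ℝ (S x) y = inner ℝ x (S y))
    (hd : DenseRange S) {k : H} {Λ : ℝ} (hΛ : 0 ≤ Λ) (hk : ∀ x, |inner ℝ k x| ≤ Λ * ‖S x‖) :
    ∃ h : H, S h = k ∧ ‖h‖ ≤ Λ := by
  let f : H →ₗ[ℝ] ℝ := (innerSL ℝ k).toLinearMap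
  have hd' : DenseRange S.toLinearMap := hd
  -- The bound makes `S x ↦ ⟪k, x⟫` well defined and continuous on a dense subspace; the sought
  -- preimage is the Riesz vector of its extension.
  let g := f.extendOfNorm S.toLinearMap
  have hg : ∀ x, g (S x) = inner ℝ k x := fun x =>
    LinearMap.extendOfNorm_eq hd' ⟨Λ, hk⟩ x
  refine ⟨(InnerProductSpace.toDual ℝ H).symm g, ext_inner_right ℝ fun x => ?_, ?_⟩
  · rw [hsym, InnerProductSpace.toDual_symm_apply, hg]
  · rw [LinearIsometryEquiv.norm_map]
    exact g.opNorm_le_bound hΛ fun x => LinearMap.norm_extendOfNorm_apply_le hd' Λ hk x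

end Calculus

/-! ### The symbols of the evolution -/

section EvolutionSymbols

open Filter Topology

variable {α θ : ℝ} {M : ℝ}

/-- The symbol of the propagator of the initial displacement. -/
def displacementSymbol (M α θ t : ℝ) : C(Icc (0:ℝ) M, ℝ) :=
  powMap M 1 zero_le_one * rayMap M α θ (α - 1) t

/-- The symbol of the time derivative of the propagator of the initial velocity, composed with the
square root of the elliptic operator. -/
def velocitySymbolDeriv (M α θ t : ℝ) : C(Icc (0:ℝ) M, ℝ) :=
  powMap M (1 / 2) one_half_pos.le * rayMap M α θ (α - 1) t

/-- The symbol of the time derivative of the propagator of the source. -/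
def sourceSymbolDeriv (M α θ t : ℝ) : C(Icc (0:ℝ) M, ℝ) :=
  powMap M 1 zero_le_one * rayMap M α θ 1 t

/-- The symbol of the propagator of the initial velocity. -/
def velocitySymbol (M α θ : ℝ) : ℝ → C(Icc (0:ℝ) M, ℝ) := primitive (velocitySymbolDeriv M α θ)

/-- The symbol of the propagator of the source. -/
def sourceSymbol (M α θ : ℝ) : ℝ → C(Icc (0:ℝ) M, ℝ) := primitive (sourceSymbolDeriv M α θ)

theorem continuousOn_powMap_mul_rayMap (h : SectorAngle α θ) {β η : ℝ} (hβ : -1 < β) (hη : 0 ≤ η) :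
    ContinuousOn (fun t => powMap M η hη * rayMap M α θ β t) (Ioi 0) :=
  continuousOn_const.mul (continuousOn_rayMap h hβ)

theorem powMap_zero_mul (g : C(Icc (0:ℝ) M, ℝ)) : powMap M 0 le_rfl * g = g := by
  ext μ; simp

theorem exists_norm_displacementSymbol_le (h : SectorAngle α θ) (M : ℝ) :
    ∃ C : ℝ, 0 ≤ C ∧ ∀ t, 0 < t → ‖displacementSymbol M α θ t‖ ≤ C := by
  obtain ⟨C, hC, hb⟩ := exists_mul_ray_bounded h
  refine ⟨C, hC, fun t ht => (ContinuousMap.norm_le _ hC).2 fun μ => ?_⟩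
  rw [displacementSymbol, ContinuousMap.mul_apply, powMap_apply,
    rayMap_apply h (by linarith [h.one_lt]) ht, norm_mul, Real.rpow_one,
    Real.norm_of_nonneg μ.2.1]
  exact hb t μ ht μ.2.1

theorem integrableOn_exp_displacementSymbol (h : SectorAngle α θ) {p : ℝ} (hp : 0 < p) :
    IntegrableOn (fun t => Real.exp (-p * t) • displacementSymbol M α θ t) (Ioi 0) := by
  obtain ⟨C, -, hC⟩ := exists_norm_displacementSymbol_le h M
  exact integrableOn_exp_smul_of_bounded hp ((continuousOn_powMap_mul_rayMap h
    (by linarith [h.one_lt]) _).aestronglyMeasurable measurableSet_Ioi) hC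

theorem laplace_displacementSymbol (h : SectorAngle α θ) {p : ℝ} (hp : 0 < p) :
    ∫ t in Ioi (0:ℝ), Real.exp (-p * t) • displacementSymbol M α θ t
      = p ^ (α - 1) • (powMap M 1 zero_le_one * resMap M (p ^ α) (by positivity)) :=
  laplace_powMap_mul_rayMap h (by linarith [h.one_lt]) (by linarith) one_pos hp
    (integrableOn_exp_displacementSymbol h hp)

/-- For large times `μ^η` is simply bounded on `[0, M]`, which keeps the full decay of the case
without a power of `μ`. -/
theorem powMap_mul_bound (h : SectorAngle α θ) (M : ℝ) {β η : ℝ} (hβ : -1 < β) (hη : 0 ≤ η) :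
    ∃ C : ℝ, 0 ≤ C ∧ ∀ t, 0 < t →
      ‖powMap M η hη * rayMap M α θ β t‖ ≤ C * t ^ (-(β + 1)) := by
  obtain ⟨C, hC, hb⟩ := exists_norm_powMap_mul_rayMap_le (M := M) h hβ le_rfl zero_le_one
    (by linarith)
  refine ⟨‖powMap M η hη‖ * C, by positivity, fun t ht => ?_⟩
  have := hb t ht
  rw [powMap_zero_mul, show α * 0 - β - 1 = -(β + 1) by ring] at this
  calc _ ≤ ‖powMap M η hη‖ * ‖rayMap M α θ β t‖ := norm_mul_le _ _
    _ ≤ ‖powMap M η hη‖ * (C * t ^ (-(β + 1))) := by gcongr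
    _ = _ := by ring

/-- The two bounds are `t^(-α/2)` at `0` and `t^(-α)` at infinity, and `α / 2 < 1 < α`. The half
power of `μ` is exactly what data in `H⁻¹` leave available. -/
theorem integrableOn_velocitySymbolDeriv (h : SectorAngle α θ) :
    IntegrableOn (velocitySymbolDeriv M α θ) (Ioi 0) := by
  have h1 := h.one_lt
  have h2 := h.lt_two
  obtain ⟨A, -, hA⟩ := exists_norm_powMap_mul_rayMap_le (M := M) h (β := α - 1) (η := 1 / 2)
    (by linarith) one_half_pos.le (by norm_num) (by linarith)
  obtain ⟨B, -, hB⟩ := powMap_mul_bound h M (β := α - 1) (by linarith) one_half_pos.le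
  refine (integrableOn_Ioi_of_rpow_bounds (a := α / 2) (b := α) (A := A) (B := B) one_pos
    (by linarith) h1 (continuousOn_powMap_mul_rayMap h (by linarith) _) (fun t ht => ?_)
    (fun t ht => ?_)).1
  · have := hA t ht
    rwa [show α * (1 / 2) - (α - 1) - 1 = -(α / 2) by ring] at this
  · have := hB t ht
    rwa [show -(α - 1 + 1) = -α by ring] at this

/-- The bounds are `t^(α-2)` at `0`, integrable because `α > 1`, and `t^(-2)` at infinity. -/
theorem integrableOn_sourceSymbolDeriv (h : SectorAngle α θ) :
    IntegrableOn (sourceSymbolDeriv M α θ) (Ioi 0) := by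
  have h1 := h.one_lt
  have h2 := h.lt_two
  obtain ⟨A, -, hA⟩ := exists_norm_powMap_mul_rayMap_le (M := M) h (β := 1) (η := 1)
    (by linarith) zero_le_one le_rfl (by linarith)
  obtain ⟨B, -, hB⟩ := powMap_mul_bound h M (β := 1) (by linarith) zero_le_one
  refine (integrableOn_Ioi_of_rpow_bounds (a := 2 - α) (b := 2) (A := A) (B := B) one_pos
    (by linarith) (by norm_num) (continuousOn_powMap_mul_rayMap h (by linarith) _) (fun t ht => ?_)
    (fun t ht => ?_)).1
  · have := hA t ht
    rwa [show α * 1 - 1 - 1 = -(2 - α) by ring] at this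
  · have := hB t ht
    rwa [show -((1:ℝ) + 1) = -2 by ring] at this

theorem laplace_velocitySymbolDeriv (h : SectorAngle α θ) {p : ℝ} (hp : 0 < p) :
    ∫ t in Ioi (0:ℝ), Real.exp (-p * t) • velocitySymbolDeriv M α θ t
      = p ^ (α - 1) • (powMap M (1 / 2) one_half_pos.le * resMap M (p ^ α) (by positivity)) :=
  laplace_powMap_mul_rayMap h (by linarith [h.one_lt]) (by linarith) one_half_pos hp
    (integrableOn_exp_smul_of_integrableOn hp.le (integrableOn_velocitySymbolDeriv h))

theorem laplace_sourceSymbolDeriv (h : SectorAngle α θ) {p : ℝ} (hp : 0 < p) :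
    ∫ t in Ioi (0:ℝ), Real.exp (-p * t) • sourceSymbolDeriv M α θ t
      = p • (powMap M 1 zero_le_one * resMap M (p ^ α) (by positivity)) := by
  have := laplace_powMap_mul_rayMap h (M := M) (β := 1) (by linarith [h.one_lt]) h.one_lt one_pos hp
    (integrableOn_exp_smul_of_integrableOn hp.le (integrableOn_sourceSymbolDeriv h))
  rwa [Real.rpow_one] at this

theorem continuous_velocitySymbol (h : SectorAngle α θ) : Continuous (velocitySymbol M α θ) :=
  continuous_primitive (integrableOn_velocitySymbolDeriv h)

theorem continuous_sourceSymbol (h : SectorAngle α θ) : Continuous (sourceSymbol M α θ) :=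
  continuous_primitive (integrableOn_sourceSymbolDeriv h)

theorem laplace_velocitySymbol (h : SectorAngle α θ) {p : ℝ} (hp : 0 < p) :
    IntegrableOn (fun t => Real.exp (-p * t) • velocitySymbol M α θ t) (Ioi 0) ∧
    ∫ t in Ioi (0:ℝ), Real.exp (-p * t) • velocitySymbol M α θ t
      = p ^ (α - 2) • (powMap M (1 / 2) one_half_pos.le * resMap M (p ^ α) (by positivity)) := by
  obtain ⟨h1, h2⟩ := laplace_primitive hp
    (integrableOn_exp_smul_of_integrableOn hp.le (integrableOn_velocitySymbolDeriv (M := M) h))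
  refine ⟨h1, h2.trans ?_⟩
  rw [laplace_velocitySymbolDeriv h hp, smul_smul]
  congr 1
  rw [show α - 2 = α - 1 - 1 by ring, Real.rpow_sub hp (α - 1), Real.rpow_one]
  ring

theorem laplace_sourceSymbol (h : SectorAngle α θ) {p : ℝ} (hp : 0 < p) :
    IntegrableOn (fun t => Real.exp (-p * t) • sourceSymbol M α θ t) (Ioi 0) ∧
    ∫ t in Ioi (0:ℝ), Real.exp (-p * t) • sourceSymbol M α θ t
      = powMap M 1 zero_le_one * resMap M (p ^ α) (by positivity) := by
  obtain ⟨h1, h2⟩ := laplace_primitive hp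
    (integrableOn_exp_smul_of_integrableOn hp.le (integrableOn_sourceSymbolDeriv (M := M) h))
  refine ⟨h1, h2.trans ?_⟩
  rw [laplace_sourceSymbolDeriv h hp, smul_smul, one_div_mul_cancel hp.ne', one_smul]

/-- The integrated equation for the propagator of the initial displacement. -/
theorem powMap_mul_displacementSymbol (h : SectorAngle α θ) {t : ℝ} (ht : 0 < t) :
    powMap M 1 zero_le_one * displacementSymbol M α θ t
      = powMap M 1 zero_le_one - primitive (sourceSymbol M α θ) t := by
  set X := powMap M 1 zero_le_one
  have hs : ∀ p : ℝ, 0 < p → _ := fun p hp => laplace_primitive hp (laplace_sourceSymbol (M := M) h hp).1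
  have hone : ∀ p : ℝ, 0 < p → IntegrableOn (fun t => Real.exp (-p * t) • X) (Ioi 0) := fun p hp =>
    (integrableOn_exp_mul_Ioi (a := -p) (by linarith) 0).smul_const X
  have hcomm : ∀ (p : ℝ) (t : ℝ), Real.exp (-p * t) • (X * displacementSymbol M α θ t) =
      ContinuousLinearMap.mul ℝ _ X (Real.exp (-p * t) • displacementSymbol M α θ t) := fun p t => by
    rw [map_smul]; rfl
  -- In transforms: `μ² p^(α-1) / (1 + μ p^α) = μ/p - (1/p) · μ / (1 + μ p^α)`.
  refine eqOn_of_laplace_eq (v := fun t => X * displacementSymbol M α θ t)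
    (w := fun t => X - primitive (sourceSymbol M α θ) t) ?_ ?_ (fun p hp => ?_) (fun p hp => ?_)
    (fun p hp => ?_) (mem_Ioi.2 ht)
  · exact continuousOn_const.mul (continuousOn_powMap_mul_rayMap h (by linarith [h.one_lt]) _)
  · exact (continuous_const.sub (continuous_primitive_of_local fun T =>
      (continuous_sourceSymbol h).integrableOn_Ioc)).continuousOn
  · simp only [hcomm]
    exact (ContinuousLinearMap.mul ℝ _ X).integrable_comp (integrableOn_exp_displacementSymbol h hp)
  · simp only [smul_sub]
    exact (hone p hp).sub (hs p hp).1
  · simp only [hcomm, smul_sub]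
    rw [ContinuousLinearMap.integral_comp_comm _ (integrableOn_exp_displacementSymbol h hp),
      laplace_displacementSymbol h hp, integral_sub (hone p hp) (hs p hp).1, (hs p hp).2,
      (laplace_sourceSymbol h hp).2, integral_smul_const, integral_exp_neg_mul_Ioi hp]
    ext μ
    have hμ := μ.2.1
    have hpa : 0 < p ^ α := by positivity
    simp only [X, ContinuousLinearMap.mul_apply', ContinuousMap.mul_apply, ContinuousMap.smul_apply,
      ContinuousMap.sub_apply, powMap_apply, resMap_apply, smul_eq_mul, Real.rpow_one]
    rw [Real.rpow_sub hp, Real.rpow_one]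
    field_simp
    ring

/-- Both sides have transform `μ / (1 + μ p^α)`. The identity lets `ray 0`, up to sign the time
derivative of the displacement propagator, be compared with the source propagator after applying
`R`. -/
theorem powMap_mul_rayMap_zero (h : SectorAngle α θ) {t : ℝ} (ht : 0 < t) :
    powMap M 1 zero_le_one * rayMap M α θ 0 t = sourceSymbol M α θ t := by
  have h1 := h.one_lt
  have h2 := h.lt_two
  have hi : ∀ p : ℝ, 0 < p → IntegrableOn (fun t => Real.exp (-p * t) •
      (powMap M 1 zero_le_one * rayMap M α θ 0 t)) (Ioi 0) := by
    intro p hp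
    obtain ⟨A, -, hA⟩ := exists_norm_powMap_mul_rayMap_le (M := M) h (β := 0) (η := 1 / 2)
      (by linarith) one_half_pos.le (by norm_num) (by linarith)
    refine integrableOn_exp_smul_of_rpow_bound (a := 1 - α / 2)
      (A := ‖powMap M (1 / 2) one_half_pos.le‖ * A) hp (by linarith)
      (continuousOn_powMap_mul_rayMap h (by norm_num) _) fun t ht => ?_
    -- The pair `β = 0`, `η = 1` violates `αη < β + 1`; half of the power is used for integrability
    -- at `0` and the other half is bounded crudely.
    have e : powMap M 1 zero_le_one = powMap M (1 / 2) one_half_pos.le *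
        powMap M (1 / 2) one_half_pos.le := by
      ext μ
      simp only [powMap_apply, ContinuousMap.mul_apply]
      rw [← Real.rpow_add_of_nonneg μ.2.1 (by norm_num) (by norm_num)]
      norm_num
    rw [e, mul_assoc, mul_assoc, show -(1 - α / 2) = α * (1 / 2) - 0 - 1 by ring]
    exact (norm_mul_le _ _).trans (mul_le_mul_of_nonneg_left (hA t ht) (norm_nonneg _))
  refine eqOn_of_laplace_eq (v := fun t => powMap M 1 zero_le_one * rayMap M α θ 0 t)
    (continuousOn_powMap_mul_rayMap h (by norm_num) _) (continuous_sourceSymbol h).continuousOn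
    hi (fun p hp => (laplace_sourceSymbol h hp).1) (fun p hp => ?_) (mem_Ioi.2 ht)
  rw [(laplace_sourceSymbol h hp).2, laplace_powMap_mul_rayMap h (by norm_num) (by linarith) one_pos hp
    (hi p hp), Real.rpow_zero, one_smul]

end EvolutionSymbols

/-! ### The abstract fractional evolution equation -/

section Evolution

open Filter Topology

variable {H : Type*} [NormedAddCommGroup H] [InnerProductSpace ℝ H]

/-- A symmetric, nonnegative and injective bounded operator, such as the inverse of an elliptic
operator. -/
structure IsInverseElliptic (R : H →L[ℝ] H) : Prop where
  symm : ∀ x y, inner ℝ (R x) y = inner ℝ x (R y)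
  nonneg : ∀ x, 0 ≤ inner ℝ (R x) x
  injective : ∀ x, R x = 0 → x = 0

/-- `k` lies in the range of the square root of `R`, with bound `Λ`. -/
def SqrtBound (R : H →L[ℝ] H) (k : H) (Λ : ℝ) : Prop :=
  ∀ x, |inner ℝ k x| ≤ Λ * Real.sqrt (inner ℝ (R x) x)

/-- The Laplace transform of `v` satisfies the transformed equation. -/
def SolvesTransformed (R : H →L[ℝ] H) (α : ℝ) (u₀ k : H) (f v : ℝ → H) : Prop :=
  ∀ p : ℝ, 0 < p → (∫ t in Ioi (0:ℝ), Real.exp (-p * t) • v t) +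
      p ^ α • R (∫ t in Ioi (0:ℝ), Real.exp (-p * t) • v t) =
    R ((∫ t in Ioi (0:ℝ), Real.exp (-p * t) • f t) + p ^ (α - 1) • u₀) + p ^ (α - 2) • k

variable {α θ M : ℝ} {R : H →L[ℝ] H} {Φ : C(Icc (0:ℝ) M, ℝ) →L[ℝ] (H →L[ℝ] H)}

/-- Pairing with `x` gives `‖x‖² + q ⟪R x, x⟫ = 0`, a sum of nonnegative terms. -/
theorem IsInverseElliptic.add_smul_injective (hR : IsInverseElliptic R) {q : ℝ} (hq : 0 ≤ q) {x : H}
    (hx : x + q • R x = 0) : x = 0 := by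
  have h1 : inner ℝ (x + q • R x) x = 0 := by rw [hx, inner_zero_left]
  rw [inner_add_left, real_inner_smul_left, real_inner_self_eq_norm_sq] at h1
  have := mul_nonneg hq (hR.nonneg x)
  have : ‖x‖ ^ 2 = 0 := by nlinarith [sq_nonneg ‖x‖]
  simpa using this

/-- The action of symbols on vectors. -/
def symbolAction (Φ : C(Icc (0:ℝ) M, ℝ) →L[ℝ] (H →L[ℝ] H)) : H →L[ℝ] C(Icc (0:ℝ) M, ℝ) →L[ℝ] H :=
  Φ.flip

@[simp] theorem symbolAction_apply (x : H) (g : C(Icc (0:ℝ) M, ℝ)) : symbolAction Φ x g = Φ g x :=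
  rfl

namespace IsCalculus

variable (hΦ : IsCalculus M R Φ)
include hΦ

theorem pow_one_mul (g : C(Icc (0:ℝ) M, ℝ)) (x : H) :
    Φ (powMap M 1 zero_le_one * g) x = R (Φ g x) := by
  rw [hΦ.map_mul, hΦ.map_pow_one]

theorem commute (g : C(Icc (0:ℝ) M, ℝ)) (x : H) : Φ g (R x) = R (Φ g x) := by
  rw [← hΦ.pow_one_mul, mul_comm, hΦ.map_mul, hΦ.map_pow_one]

theorem sqrt_sqrt (x : H) :
    Φ (powMap M (1 / 2) one_half_pos.le) (Φ (powMap M (1 / 2) one_half_pos.le) x) = R x := by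
  rw [← hΦ.map_mul, ← hΦ.map_pow_one]
  congr 2
  ext μ
  simp only [powMap_apply, ContinuousMap.mul_apply]
  rw [← Real.rpow_add_of_nonneg μ.2.1 (by norm_num) (by norm_num)]
  norm_num

theorem norm_sqrt (x : H) :
    ‖Φ (powMap M (1 / 2) one_half_pos.le) x‖ = Real.sqrt (inner ℝ (R x) x) := by
  rw [← hΦ.sqrt_sqrt x, hΦ.symm, real_inner_self_eq_norm_sq, Real.sqrt_sq (norm_nonneg _)]

variable [CompleteSpace H] in
theorem denseRange_sqrt (hR : IsInverseElliptic R) :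
    DenseRange (Φ (powMap M (1 / 2) one_half_pos.le)) :=
  denseRange_of_symm_of_injective (hΦ.symm _) fun x hx =>
    hR.injective x (by rw [← hΦ.sqrt_sqrt, hx, map_zero])

variable [CompleteSpace H] in
-- Since `‖R^(1/2) x‖² = ⟪R x, x⟫`, the condition `SqrtBound` says that the functional of `k` is
-- dominated by `‖R^(1/2) x‖`.
theorem exists_sqrt (hR : IsInverseElliptic R) {k : H} {Λ : ℝ} (hΛ : 0 ≤ Λ) (hk : SqrtBound R k Λ) :
    ∃ h : H, Φ (powMap M (1 / 2) one_half_pos.le) h = k ∧ ‖h‖ ≤ Λ :=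
  exists_eq_apply_of_inner_le (hΦ.symm _) (hΦ.denseRange_sqrt hR) hΛ fun x => by
    rw [hΦ.norm_sqrt]; exact hk x

/-- The scalar identity `(1 + qμ) · g / (1 + qμ) = g`, read in the functional calculus. -/
theorem mul_resMap (g : C(Icc (0:ℝ) M, ℝ)) {q : ℝ} (hq : 0 ≤ q) (x : H) :
    Φ (g * resMap M q hq) x + q • R (Φ (g * resMap M q hq) x) = Φ g x := by
  rw [← hΦ.pow_one_mul, ← smul_apply, ← map_smul, ← add_apply, ← map_add]
  congr 2
  ext μ
  have := μ.2.1
  have : 0 < 1 + (μ : ℝ) * q := by positivity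
  simp only [ContinuousMap.add_apply, ContinuousMap.mul_apply, ContinuousMap.smul_apply,
    powMap_apply, resMap_apply, Real.rpow_one, smul_eq_mul]
  field_simp

theorem norm_apply_le (g : C(Icc (0:ℝ) M, ℝ)) (x : H) : ‖Φ g x‖ ≤ ‖g‖ * ‖x‖ :=
  ((Φ g).le_opNorm x).trans (by gcongr; exact hΦ.norm_le g)

theorem norm_symbolAction_le (x : H) (g : C(Icc (0:ℝ) M, ℝ)) :
    ‖symbolAction Φ x g‖ ≤ ‖x‖ * ‖g‖ := by
  rw [mul_comm]; exact hΦ.norm_apply_le g x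

end IsCalculus

variable [CompleteSpace H] in
theorem integrableOn_exp_calculus (x : H) {G : ℝ → C(Icc (0:ℝ) M, ℝ)} {p : ℝ}
    (hG : IntegrableOn (fun t => Real.exp (-p * t) • G t) (Ioi 0)) :
    IntegrableOn (fun t => Real.exp (-p * t) • Φ (G t) x) (Ioi 0) ∧
    ∫ t in Ioi (0:ℝ), Real.exp (-p * t) • Φ (G t) x
      = Φ (∫ t in Ioi (0:ℝ), Real.exp (-p * t) • G t) x := by
  have e : ∀ t, Real.exp (-p * t) • Φ (G t) x = symbolAction Φ x (Real.exp (-p * t) • G t) :=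
    fun t => by simp
  simp only [e]
  exact ⟨(symbolAction Φ x).integrable_comp hG, ContinuousLinearMap.integral_comp_comm _ hG⟩

/-- The propagator of the initial displacement. -/
def displacementPart (Φ : C(Icc (0:ℝ) M, ℝ) →L[ℝ] (H →L[ℝ] H)) (α θ : ℝ) (u₀ : H) (t : ℝ) : H :=
  if t ≤ 0 then u₀ else Φ (displacementSymbol M α θ t) u₀

/-- The mild solution of the evolution equation. -/
def mildSolution (Φ : C(Icc (0:ℝ) M, ℝ) →L[ℝ] (H →L[ℝ] H)) (α θ : ℝ) (u₀ h : H) (f : ℝ → H)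
    (t : ℝ) : H :=
  displacementPart Φ α θ u₀ t + Φ (velocitySymbol M α θ t) h +
    halfConv (symbolAction Φ) f (sourceSymbol M α θ) t

variable [CompleteSpace H] in
-- Only `t = 0` is delicate, since the symbols do not converge uniformly there. On vectors `R y` the
-- integrated equation gives `R y` minus a primitive that vanishes at `0`; the range of `R` is dense
-- and the symbols are uniformly bounded, so strong continuity extends to all `u₀`.
theorem continuousOn_displacementPart (hΦ : IsCalculus M R Φ) (hR : IsInverseElliptic R)
    (h : SectorAngle α θ) (u₀ : H) : ContinuousOn (displacementPart Φ α θ u₀) (Ici 0) := by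
  obtain ⟨C, hC0, hC⟩ := exists_norm_displacementSymbol_le h M
  intro t ht
  rcases (mem_Ici.1 ht).eq_or_lt with rfl | ht
  · rw [← continuousWithinAt_Ioi_iff_Ici]
    have e0 : displacementPart Φ α θ u₀ 0 = u₀ := if_pos le_rfl
    rw [ContinuousWithinAt, e0, Metric.tendsto_nhds]
    intro ε hε
    obtain ⟨y, hy⟩ := (denseRange_of_symm_of_injective hR.symm hR.injective).exists_dist_lt u₀
      (show 0 < ε / (2 * (C + 2)) by positivity)
    have hprim : Tendsto (fun t => ‖Φ (primitive (sourceSymbol M α θ) t) y‖) (𝓝[>] 0) (𝓝 0) := by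
      have hc : Continuous fun t => ‖Φ (primitive (sourceSymbol M α θ) t) y‖ := by
        have := continuous_primitive_of_local (g := sourceSymbol M α θ) fun T =>
          (continuous_sourceSymbol h).integrableOn_Ioc
        fun_prop
      have := hc.tendsto 0
      rw [primitive_of_nonpos _ le_rfl, map_zero, zero_apply, norm_zero] at this
      exact this.mono_left nhdsWithin_le_nhds
    filter_upwards [self_mem_nhdsWithin, hprim.eventually (gt_mem_nhds (half_pos hε))] with t ht hpt
    have ht : 0 < t := ht
    have e1 : displacementPart Φ α θ u₀ t = Φ (displacementSymbol M α θ t) u₀ :=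
      if_neg (not_le.2 ht)
    have e2 : Φ (displacementSymbol M α θ t) (R y)
        = R y - Φ (primitive (sourceSymbol M α θ) t) y := by
      rw [hΦ.commute, ← hΦ.pow_one_mul, powMap_mul_displacementSymbol h ht, map_sub, sub_apply,
        hΦ.map_pow_one]
    rw [e1, dist_eq_norm]
    rw [dist_eq_norm] at hy
    have e3 : Φ (displacementSymbol M α θ t) u₀ - u₀ =
        Φ (displacementSymbol M α θ t) (u₀ - R y) - (u₀ - R y)
          - Φ (primitive (sourceSymbol M α θ) t) y := by
      rw [map_sub, e2]; abel
    rw [e3]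
    calc _ ≤ ‖Φ (displacementSymbol M α θ t) (u₀ - R y)‖ + ‖u₀ - R y‖
          + ‖Φ (primitive (sourceSymbol M α θ) t) y‖ := by
          refine (norm_sub_le _ _).trans ?_
          gcongr
          exact norm_sub_le _ _
      _ ≤ C * ‖u₀ - R y‖ + ‖u₀ - R y‖ + ‖Φ (primitive (sourceSymbol M α θ) t) y‖ := by
          gcongr
          exact (hΦ.norm_apply_le _ _).trans (by gcongr; exact hC t ht)
      _ < ε := by
          have h1 : (C + 1) * ‖u₀ - R y‖ ≤ (C + 2) * (ε / (2 * (C + 2))) := by gcongr; linarith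
          have h2 : (C + 2) * (ε / (2 * (C + 2))) = ε / 2 := by field_simp
          linarith
  · have hc : ContinuousOn (fun t => Φ (displacementSymbol M α θ t) u₀) (Ioi 0) := by
      have := continuousOn_powMap_mul_rayMap (M := M) h (β := α - 1) (by linarith [h.one_lt])
        zero_le_one
      exact (Φ.continuous.comp_continuousOn this).clm_apply continuousOn_const
    have := (hc.continuousAt (Ioi_mem_nhds ht)).congr (f := fun t => Φ (displacementSymbol M α θ t) u₀)
      (g := displacementPart Φ α θ u₀) (by
        filter_upwards [Ioi_mem_nhds ht] with s hs
        exact (if_neg (not_le.2 hs)).symm)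
    exact this.continuousWithinAt

theorem norm_sourceSymbol_le (h : SectorAngle α θ) (t : ℝ) :
    ‖sourceSymbol M α θ t‖ ≤ ∫ s in Ioi (0:ℝ), ‖sourceSymbolDeriv M α θ s‖ :=
  norm_primitive_le (integrableOn_sourceSymbolDeriv h) t

variable [CompleteSpace H] in
theorem continuousOn_mildSolution (hΦ : IsCalculus M R Φ) (hR : IsInverseElliptic R)
    (h : SectorAngle α θ) (u₀ k : H) {f : ℝ → H} (hf : IntegrableOn f (Ioi 0)) :
    ContinuousOn (mildSolution Φ α θ u₀ k f) (Ici 0) := by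
  refine ((continuousOn_displacementPart hΦ hR h u₀).add ?_).add ?_
  · have := continuous_velocitySymbol (M := M) h
    exact (by fun_prop : Continuous fun t => Φ (velocitySymbol M α θ t) k).continuousOn
  · exact (continuous_halfConv (symbolAction Φ) hf (continuous_sourceSymbol h)
      (fun t ht => primitive_of_nonpos _ ht) (norm_sourceSymbol_le h)).continuousOn

theorem exists_norm_mildSolution_le (h : SectorAngle α θ) (M : ℝ) : ∃ C : ℝ, 0 < C ∧
    ∀ (R : H →L[ℝ] H) (Φ : C(Icc (0:ℝ) M, ℝ) →L[ℝ] (H →L[ℝ] H)), IsCalculus M R Φ →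
    ∀ (u₀ k : H) (f : ℝ → H), IntegrableOn f (Ioi 0) → ∀ t, 0 ≤ t →
      ‖mildSolution Φ α θ u₀ k f t‖ ≤ C * (‖u₀‖ + ‖k‖ + ∫ s in Ioi (0:ℝ), ‖f s‖) := by
  obtain ⟨C₁, hC₁, hb₁⟩ := exists_norm_displacementSymbol_le h M
  set C₂ := ∫ s in Ioi (0:ℝ), ‖velocitySymbolDeriv M α θ s‖
  set C₃ := ∫ s in Ioi (0:ℝ), ‖sourceSymbolDeriv M α θ s‖
  have hC₂ : 0 ≤ C₂ := integral_nonneg fun _ => norm_nonneg _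
  have hC₃ : 0 ≤ C₃ := integral_nonneg fun _ => norm_nonneg _
  refine ⟨1 + C₁ + C₂ + C₃, by positivity, fun R Φ hΦ u₀ k f hf t _ => ?_⟩
  have hI : 0 ≤ ∫ s in Ioi (0:ℝ), ‖f s‖ := integral_nonneg fun _ => norm_nonneg _
  have h1 : ‖displacementPart Φ α θ u₀ t‖ ≤ (1 + C₁) * ‖u₀‖ := by
    rw [displacementPart]
    split_ifs with ht0
    · nlinarith [norm_nonneg u₀]
    · refine (hΦ.norm_apply_le _ _).trans ?_
      have := hb₁ t (not_le.1 ht0)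
      nlinarith [norm_nonneg u₀]
  have h2 : ‖Φ (velocitySymbol M α θ t) k‖ ≤ C₂ * ‖k‖ := by
    refine (hΦ.norm_apply_le _ _).trans ?_
    gcongr
    exact norm_primitive_le (integrableOn_velocitySymbolDeriv h) t
  have h3 := norm_halfConv_le (symbolAction Φ) hΦ.norm_symbolAction_le hf hC₃
    (fun t _ => norm_sourceSymbol_le h t) t
  calc _ ≤ (1 + C₁) * ‖u₀‖ + C₂ * ‖k‖ + C₃ * ∫ s in Ioi (0:ℝ), ‖f s‖ := by
        refine (norm_add_le _ _).trans (add_le_add ((norm_add_le _ _).trans (add_le_add h1 h2)) h3)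
    _ ≤ _ := by
      have := norm_nonneg u₀
      have := norm_nonneg k
      nlinarith [mul_nonneg hC₁ hI, mul_nonneg hC₂ hI, mul_nonneg hC₃ (norm_nonneg u₀),
        mul_nonneg hC₂ (norm_nonneg u₀), mul_nonneg hC₁ (norm_nonneg k),
        mul_nonneg hC₃ (norm_nonneg k)]

variable [CompleteSpace H] in
-- Each of the three terms has a transform of the form `g · 1 / (1 + μ p^α)` applied to the data, so
-- `mul_resMap` removes the denominator from each separately.
theorem laplace_mildSolution (hΦ : IsCalculus M R Φ) (h : SectorAngle α θ) (u₀ k : H) {f : ℝ → H}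
    (hf : IntegrableOn f (Ioi 0)) {p : ℝ} (hp : 0 < p) :
    IntegrableOn (fun t => Real.exp (-p * t) • mildSolution Φ α θ u₀ k f t) (Ioi 0) ∧
    (∫ t in Ioi (0:ℝ), Real.exp (-p * t) • mildSolution Φ α θ u₀ k f t) +
      p ^ α • R (∫ t in Ioi (0:ℝ), Real.exp (-p * t) • mildSolution Φ α θ u₀ k f t) =
    R ((∫ t in Ioi (0:ℝ), Real.exp (-p * t) • f t) + p ^ (α - 1) • u₀) +
      p ^ (α - 2) • Φ (powMap M (1 / 2) one_half_pos.le) k := by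
  have hpa : 0 ≤ p ^ α := by positivity
  have hfp := integrableOn_exp_smul_of_integrableOn hp.le hf
  obtain ⟨a1, a2⟩ := integrableOn_exp_calculus (Φ := Φ) u₀
    (integrableOn_exp_displacementSymbol (M := M) h hp)
  obtain ⟨b1, b2⟩ := integrableOn_exp_calculus (Φ := Φ) k (laplace_velocitySymbol (M := M) h hp).1
  obtain ⟨k1, k2⟩ := laplace_sourceSymbol (M := M) h hp
  have c1 := integrableOn_exp_smul_halfConv (symbolAction Φ) hfp k1
  have c2 := laplace_halfConv (symbolAction Φ) hfp k1
  have e : ∀ t ∈ Ioi (0:ℝ), Real.exp (-p * t) • Φ (displacementSymbol M α θ t) u₀ =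
      Real.exp (-p * t) • displacementPart Φ α θ u₀ t := fun t ht => by
    rw [displacementPart, if_neg (not_le.2 ht)]
  have a1' := a1.congr_fun e measurableSet_Ioi
  rw [setIntegral_congr_fun measurableSet_Ioi e, laplace_displacementSymbol h hp] at a2
  rw [(laplace_velocitySymbol h hp).2] at b2
  rw [k2, symbolAction_apply] at c2
  simp only [mildSolution, smul_add]
  have ab1 : IntegrableOn (fun t => Real.exp (-p * t) • displacementPart Φ α θ u₀ t +
      Real.exp (-p * t) • Φ (velocitySymbol M α θ t) k) (Ioi 0) := a1'.add b1
  refine ⟨ab1.add c1, ?_⟩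
  rw [integral_add ab1 c1, integral_add a1' b1, a2, b2, c2]
  have key := fun g x => hΦ.mul_resMap g hpa x
  have kA := key (powMap M 1 zero_le_one) u₀
  have kB := key (powMap M (1 / 2) one_half_pos.le) k
  have kC := key (powMap M 1 zero_le_one) (∫ t in Ioi (0:ℝ), Real.exp (-p * t) • f t)
  rw [hΦ.map_pow_one] at kA kC
  have e0 : R ((∫ t in Ioi (0:ℝ), Real.exp (-p * t) • f t) + p ^ (α - 1) • u₀) =
      R (∫ t in Ioi (0:ℝ), Real.exp (-p * t) • f t) + p ^ (α - 1) • R u₀ := by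
    rw [map_add, map_smul]
  rw [e0, ← kA, ← kB, ← kC]
  simp only [map_smul, smul_apply, map_add, smul_add]
  rw [smul_comm (p ^ α) (p ^ (α - 1)), smul_comm (p ^ α) (p ^ (α - 2))]
  abel

variable [CompleteSpace H] in
-- The difference of the two transforms lies in the kernel of `1 + p^α R`, hence vanishes, and the
-- Laplace transform is injective.
theorem SolvesTransformed.ae_eq (hR : IsInverseElliptic R) {u₀ k : H} {f v w : ℝ → H}
    (hv : SolvesTransformed R α u₀ k f v) (hw : SolvesTransformed R α u₀ k f w)
    (hvi : ∀ p : ℝ, 0 < p → IntegrableOn (fun t => Real.exp (-p * t) • v t) (Ioi 0))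
    (hwi : ∀ p : ℝ, 0 < p → IntegrableOn (fun t => Real.exp (-p * t) • w t) (Ioi 0)) :
    v =ᵐ[volume.restrict (Ioi 0)] w := by
  refine ae_eq_of_laplace_eq hvi hwi fun p hp => ?_
  have h1 := (hv p hp).trans (hw p hp).symm
  rw [← sub_eq_zero]
  refine hR.add_smul_injective (q := p ^ α) (by positivity) ?_
  rw [map_sub, smul_sub, ← sub_eq_zero.2 h1]
  abel

end Evolution

/-! ### The time derivative of the mild solution -/

section TimeDerivative

variable {H : Type*} [NormedAddCommGroup H] [InnerProductSpace ℝ H] [CompleteSpace H]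
variable {α θ M : ℝ} {R : H →L[ℝ] H} {Φ : C(Icc (0:ℝ) M, ℝ) →L[ℝ] (H →L[ℝ] H)}

/-- `u` is approximable at the polynomial rate `κ` by elements `z` of the range of the square root
of `R`, at a polynomial cost of order `N`. -/
def Approximable (R : H →L[ℝ] H) (κ N a : ℝ) (u : H) : Prop :=
  ∀ δ : ℝ, 0 < δ → δ ≤ 1 → ∃ z, ‖u - z‖ ≤ a * δ ^ κ ∧ SqrtBound R z (a * δ ^ (-N))

theorem integrableOn_rpow_Ioc {r T : ℝ} (hr : -1 < r) :
    IntegrableOn (fun t : ℝ => t ^ r) (Ioc 0 T) := by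
  rcases le_or_gt T 0 with hT | hT
  · simp [Ioc_eq_empty (not_lt.2 hT)]
  · exact (intervalIntegrable_iff_integrableOn_Ioc_of_le hT.le).1
      (intervalIntegral.intervalIntegrable_rpow' hr)

/-- On a general vector `ray 0` acts with norm `O(1/t)`, which is not integrable; on `R^(1/2) w`
with norm `O(t^(α/2-1)) ‖w‖`. Splitting `u` at each time `t` with `δ` a small power of `t` gains
`δ^κ` on the first part and loses only `δ^(-N)` on the second. -/
theorem exists_integral_norm_rayMap_le (hΦ : IsCalculus M R Φ) (hR : IsInverseElliptic R)
    (h : SectorAngle α θ) {κ N : ℝ} (hκ : 0 < κ) (hN : 0 < N) (T : ℝ) :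
    ∃ C : ℝ, 0 ≤ C ∧ ∀ (u : H) (a : ℝ), 0 ≤ a → Approximable R κ N a u →
      IntegrableOn (fun t => Φ (rayMap M α θ 0 t) u) (Ioc 0 T) ∧
      ∫ t in Ioc 0 T, ‖Φ (rayMap M α θ 0 t) u‖ ≤ C * a := by
  have h1 := h.one_lt
  have h2 := h.lt_two
  obtain ⟨A, hA0, hA⟩ := powMap_mul_bound h M (β := 0) (by norm_num) le_rfl
  obtain ⟨B, hB0, hB⟩ := exists_norm_powMap_mul_rayMap_le (M := M) h (β := 0) (η := 1 / 2)
    (by norm_num) one_half_pos.le (by norm_num) (by linarith)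
  -- Dividing `t` by `T'` keeps the parameter `δ = (t / T')^σ` at most `1`.
  set T' := max T 1
  have hT' : 0 < T' := lt_of_lt_of_le one_pos (le_max_right _ _)
  -- With this exponent the loss `δ^(-N)` costs `t^(-α/4)`, so `t^(α/2-1)` becomes `t^(α/4-1)`,
  -- still integrable at `0`.
  set σ := α / (4 * N)
  have hσ : 0 < σ := by positivity
  set G : ℝ → ℝ := fun t => A * (t ^ (σ * κ - 1) * (1 / T') ^ (σ * κ))
    + B * (t ^ (α / 4 - 1) * (1 / T') ^ (-(α / 4)))
  have hG : IntegrableOn G (Ioc 0 T) :=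
    (((integrableOn_rpow_Ioc (by nlinarith [mul_pos hσ hκ])).mul_const _).const_mul A).add
      (((integrableOn_rpow_Ioc (by linarith)).mul_const _).const_mul B)
  have hG0 : ∀ t ∈ Ioc 0 T, 0 ≤ G t := fun t ht => by have := ht.1; positivity
  refine ⟨∫ t in Ioc 0 T, G t, setIntegral_nonneg measurableSet_Ioc hG0, fun u a ha hu => ?_⟩
  have hc : ContinuousOn (fun t => Φ (rayMap M α θ 0 t) u) (Ioi 0) :=
    (Φ.continuous.comp_continuousOn (continuousOn_rayMap h (by norm_num))).clm_apply
      continuousOn_const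
  have hb : ∀ t ∈ Ioc 0 T, ‖Φ (rayMap M α θ 0 t) u‖ ≤ G t * a := by
    intro t ht
    have ht0 : 0 < t := ht.1
    have hx : 0 < t * (1 / T') := by positivity
    have hx1 : t * (1 / T') ≤ 1 := by
      rw [mul_one_div, div_le_one hT']; exact ht.2.trans (le_max_left _ _)
    obtain ⟨z, hz1, hz2⟩ := hu ((t * (1 / T')) ^ σ) (by positivity)
      (Real.rpow_le_one hx.le hx1 hσ.le)
    obtain ⟨w, rfl, hw⟩ := hΦ.exists_sqrt hR (by positivity) hz2
    have e : Φ (rayMap M α θ 0 t) u =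
        Φ (rayMap M α θ 0 t) (u - Φ (powMap M (1 / 2) one_half_pos.le) w) +
        Φ (powMap M (1 / 2) one_half_pos.le * rayMap M α θ 0 t) w := by
      rw [mul_comm, hΦ.map_mul, map_sub]; abel
    have hA' := hA t ht0
    rw [powMap_zero_mul] at hA'
    have hB' := hB t ht0
    have e1 : t ^ (-(0 + 1) : ℝ) * ((t * (1 / T')) ^ σ) ^ κ
        = t ^ (σ * κ - 1) * (1 / T') ^ (σ * κ) := by
      rw [← Real.rpow_mul hx.le, Real.mul_rpow ht0.le (by positivity), ← mul_assoc,
        ← Real.rpow_add ht0]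
      congr 2; ring
    have e2 : t ^ (α * (1 / 2) - 0 - 1) * ((t * (1 / T')) ^ σ) ^ (-N)
        = t ^ (α / 4 - 1) * (1 / T') ^ (-(α / 4)) := by
      have : σ * -N = -(α / 4) := by simp only [σ]; field_simp
      rw [← Real.rpow_mul hx.le, this, Real.mul_rpow ht0.le (by positivity), ← mul_assoc,
        ← Real.rpow_add ht0]
      congr 2; ring
    rw [e]
    calc _ ≤ (A * t ^ (-(0 + 1) : ℝ)) * (a * ((t * (1 / T')) ^ σ) ^ κ) +
          (B * t ^ (α * (1 / 2) - 0 - 1)) * (a * ((t * (1 / T')) ^ σ) ^ (-N)) := by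
          refine (norm_add_le _ _).trans (add_le_add ?_ ?_)
          · exact (hΦ.norm_apply_le _ _).trans (by gcongr)
          · exact (hΦ.norm_apply_le _ _).trans (by gcongr)
      _ = A * (t ^ (-(0 + 1) : ℝ) * ((t * (1 / T')) ^ σ) ^ κ) * a +
          B * (t ^ (α * (1 / 2) - 0 - 1) * ((t * (1 / T')) ^ σ) ^ (-N)) * a := by ring
      _ = G t * a := by rw [e1, e2]; simp only [G]; ring
  have hi : IntegrableOn (fun t => Φ (rayMap M α θ 0 t) u) (Ioc 0 T) :=
    (hG.mul_const a).mono' ((hc.mono Ioc_subset_Ioi_self).aestronglyMeasurable measurableSet_Ioc)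
      ((ae_restrict_iff' measurableSet_Ioc).2 (.of_forall hb))
  refine ⟨hi, ?_⟩
  rw [← integral_mul_const]
  exact setIntegral_mono_on hi.norm (hG.mul_const a) measurableSet_Ioc hb

theorem primitive_calculus (x : H) {G : ℝ → C(Icc (0:ℝ) M, ℝ)} {t : ℝ}
    (hG : IntegrableOn G (Ioc 0 t)) :
    Φ (primitive G t) x = primitive (fun s => Φ (G s) x) t :=
  (ContinuousLinearMap.integral_comp_comm (symbolAction Φ x) hG).symm

/-- After applying the injective operator `R`, both sides agree by the integrated equation.
Integrability of the derivative on `u` is the one extra ingredient. -/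
theorem displacementSymbol_eq_sub_primitive (hΦ : IsCalculus M R Φ) (hR : IsInverseElliptic R)
    (h : SectorAngle α θ) {u : H} {t : ℝ} (ht : 0 < t)
    (hi : IntegrableOn (fun s => Φ (rayMap M α θ 0 s) u) (Ioc 0 t)) :
    Φ (displacementSymbol M α θ t) u = u - primitive (fun s => Φ (rayMap M α θ 0 s) u) t := by
  rw [← sub_eq_zero]
  refine hR.injective _ ?_
  have e : R (primitive (fun s => Φ (rayMap M α θ 0 s) u) t) =
      Φ (primitive (sourceSymbol M α θ) t) u := by
    rw [primitive_calculus u (continuous_sourceSymbol h).integrableOn_Ioc, primitive, primitive,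
      ← ContinuousLinearMap.integral_comp_comm R hi]
    refine setIntegral_congr_fun measurableSet_Ioc fun s hs => ?_
    rw [← powMap_mul_rayMap_zero h hs.1, hΦ.pow_one_mul]
  rw [map_sub, map_sub, e, ← hΦ.pow_one_mul, powMap_mul_displacementSymbol h ht, map_sub, sub_apply,
    hΦ.map_pow_one]
  abel

/-- Both sides have the transform of `f` times that of `K` times `1 / p`. -/
theorem halfConv_primitive (L : H →L[ℝ] C(Icc (0:ℝ) M, ℝ) →L[ℝ] H) {f : ℝ → H}
    {K : ℝ → C(Icc (0:ℝ) M, ℝ)} (hf : IntegrableOn f (Ioi 0)) (hK : IntegrableOn K (Ioi 0)) :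
    halfConv L f (primitive K) =ᵐ[volume.restrict (Ioi 0)] primitive (halfConv L f K) := by
  refine ae_eq_of_laplace_eq (fun p hp => ?_) (fun p hp => ?_) fun p hp => ?_
  all_goals
    have hf' := integrableOn_exp_smul_of_integrableOn hp.le hf
    have hK' := integrableOn_exp_smul_of_integrableOn hp.le hK
    have hP := laplace_primitive hp hK'
    have hc := integrableOn_exp_smul_halfConv L hf' hK'
    have hP' := laplace_primitive hp hc
  · exact integrableOn_exp_smul_halfConv L hf' hP.1
  · exact hP'.1
  · rw [laplace_halfConv L hf' hP.1, hP.2, hP'.2, laplace_halfConv L hf' hK', map_smul]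

/-- The derivative is the sum of `-ray 0` on `u₀`, the velocity derivative on `k` and the
convolution of `f` with the source derivative. The last two have kernels integrable in operator
norm; only the first uses the approximability of `u₀`. -/
theorem exists_mildSolution_eq_primitive (hΦ : IsCalculus M R Φ) (hR : IsInverseElliptic R)
    (h : SectorAngle α θ) {κ N : ℝ} (hκ : 0 < κ) (hN : 0 < N) (T : ℝ) :
    ∃ C : ℝ, 0 ≤ C ∧ ∀ (u₀ k : H) (f : ℝ → H) (a : ℝ), 0 ≤ a → Approximable R κ N a u₀ →
      IntegrableOn f (Ioi 0) → ∃ g : ℝ → H, IntegrableOn g (Ioc 0 T) ∧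
        (∀ᵐ t ∂volume.restrict (Ioc 0 T), mildSolution Φ α θ u₀ k f t = u₀ + primitive g t) ∧
        ∫ t in Ioc 0 T, ‖g t‖ ≤ C * (a + ‖k‖ + ∫ t in Ioi (0:ℝ), ‖f t‖) := by
  obtain ⟨C₁, hC₁, hb₁⟩ := exists_integral_norm_rayMap_le hΦ hR h hκ hN T
  set C₂ := ∫ s in Ioi (0:ℝ), ‖velocitySymbolDeriv M α θ s‖
  set C₃ := ∫ s in Ioi (0:ℝ), ‖sourceSymbolDeriv M α θ s‖
  have hC₂ : 0 ≤ C₂ := integral_nonneg fun _ => norm_nonneg _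
  have hC₃ : 0 ≤ C₃ := integral_nonneg fun _ => norm_nonneg _
  refine ⟨C₁ + C₂ + C₃, by positivity, fun u₀ k f a ha hu hf => ?_⟩
  obtain ⟨hi₁, hn₁⟩ := hb₁ u₀ a ha hu
  have hv := integrableOn_velocitySymbolDeriv (M := M) h
  have hs := integrableOn_sourceSymbolDeriv (M := M) h
  have hi₂ : IntegrableOn (fun t => Φ (velocitySymbolDeriv M α θ t) k) (Ioi 0) :=
    (symbolAction Φ k).integrable_comp hv
  have hi₃ := (integrable_halfConv (symbolAction Φ) hf hs).integrableOn (s := Ioi 0)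
  have hsub : Ioc 0 T ⊆ Ioi 0 := Ioc_subset_Ioi_self
  have hi₂' := hi₂.mono_set hsub
  have hi₃' := hi₃.mono_set hsub
  have hn₂ : ∫ t in Ioc 0 T, ‖Φ (velocitySymbolDeriv M α θ t) k‖ ≤ C₂ * ‖k‖ := by
    refine (setIntegral_mono_set hi₂.norm (.of_forall fun _ => norm_nonneg _)
      hsub.eventuallyLE).trans ?_
    rw [← integral_mul_const]
    exact integral_mono hi₂.norm (hv.norm.mul_const _) fun t => hΦ.norm_apply_le _ _
  have hn₃ : ∫ t in Ioc 0 T, ‖halfConv (symbolAction Φ) f (sourceSymbolDeriv M α θ) t‖ ≤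
      (∫ t in Ioi (0:ℝ), ‖f t‖) * C₃ :=
    (setIntegral_mono_set hi₃.norm (.of_forall fun _ => norm_nonneg _) hsub.eventuallyLE).trans
      (integral_norm_halfConv_le (symbolAction Φ) hΦ.norm_symbolAction_le hf hs)
  set g₁ := fun t => Φ (rayMap M α θ 0 t) u₀
  set g₂ := fun t => Φ (velocitySymbolDeriv M α θ t) k
  set g₃ := halfConv (symbolAction Φ) f (sourceSymbolDeriv M α θ)
  have hn₁' : IntegrableOn (fun t => -g₁ t) (Ioc 0 T) := hi₁.neg
  have hi₁₂ : IntegrableOn (fun t => -g₁ t + g₂ t) (Ioc 0 T) := hn₁'.add hi₂'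
  have hi : IntegrableOn (fun t => -g₁ t + g₂ t + g₃ t) (Ioc 0 T) := hi₁₂.add hi₃'
  refine ⟨fun t => -g₁ t + g₂ t + g₃ t, hi, ?_, ?_⟩
  · have h3 : ∀ᵐ t ∂volume.restrict (Ioc 0 T),
        halfConv (symbolAction Φ) f (sourceSymbol M α θ) t = primitive g₃ t :=
      ae_restrict_of_ae_restrict_of_subset hsub (halfConv_primitive (symbolAction Φ) hf hs)
    filter_upwards [h3, ae_restrict_mem measurableSet_Ioc] with t ht ht0
    have hss : Ioc 0 t ⊆ Ioc 0 T := Ioc_subset_Ioc_right ht0.2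
    rw [mildSolution, displacementPart, if_neg (not_le.2 ht0.1),
      displacementSymbol_eq_sub_primitive hΦ hR h ht0.1 (hi₁.mono_set hss), velocitySymbol,
      primitive_calculus k (hv.mono_set (hss.trans hsub)), ht]
    have e : primitive (fun t => -g₁ t + g₂ t + g₃ t) t
        = -primitive g₁ t + primitive g₂ t + primitive g₃ t := by
      simp only [primitive]
      rw [integral_add (hi₁₂.mono_set hss) (hi₃'.mono_set hss),
        integral_add (hn₁'.mono_set hss) (hi₂'.mono_set hss), integral_neg]
    rw [e]
    abel
  · have hI : 0 ≤ ∫ t in Ioi (0:ℝ), ‖f t‖ := integral_nonneg fun _ => norm_nonneg _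
    have hk := norm_nonneg k
    calc _ ≤ ∫ t in Ioc 0 T, (‖g₁ t‖ + ‖g₂ t‖ + ‖g₃ t‖) := by
          refine integral_mono hi.norm ((hi₁.norm.add hi₂'.norm).add hi₃'.norm) fun t => ?_
          refine (norm_add_le _ _).trans (add_le_add_left ((norm_add_le _ _).trans ?_) _)
          rw [norm_neg]
      _ = (∫ t in Ioc 0 T, ‖g₁ t‖) + (∫ t in Ioc 0 T, ‖g₂ t‖) + ∫ t in Ioc 0 T, ‖g₃ t‖ := by
          have hi₁₂' : IntegrableOn (fun t => ‖g₁ t‖ + ‖g₂ t‖) (Ioc 0 T) := hi₁.norm.add hi₂'.norm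
          rw [integral_add hi₁₂' hi₃'.norm, integral_add hi₁.norm hi₂'.norm]
      _ ≤ C₁ * a + C₂ * ‖k‖ + (∫ t in Ioi (0:ℝ), ‖f t‖) * C₃ := by gcongr
      _ ≤ _ := by
          nlinarith [mul_nonneg hC₁ hI, mul_nonneg hC₂ hI, mul_nonneg hC₃ ha, mul_nonneg hC₁ hk,
            mul_nonneg hC₂ ha, mul_nonneg hC₃ hk]

end TimeDerivative

/-! ### The solution operator of a coercive variational problem -/

section Variational

variable {E H : Type*} [NormedAddCommGroup E] [InnerProductSpace ℝ E] [CompleteSpace E]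
  [NormedAddCommGroup H] [InnerProductSpace ℝ H] [CompleteSpace H]
variable {B : E →L[ℝ] E →L[ℝ] ℝ} (hB : IsCoercive B) (J : E →L[ℝ] H)

/-- The variational solution `w` of `B w φ = ℓ φ`. -/
def variationalSolution (ℓ : StrongDual ℝ E) : E :=
  hB.continuousLinearEquivOfBilin.symm ((InnerProductSpace.toDual ℝ E).symm ℓ)

theorem variationalSolution_spec (ℓ : StrongDual ℝ E) (φ : E) :
    B (variationalSolution hB ℓ) φ = ℓ φ := by
  rw [← hB.continuousLinearEquivOfBilin_apply, variationalSolution,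
    ContinuousLinearEquiv.apply_symm_apply, InnerProductSpace.toDual_symm_apply]

theorem norm_variationalSolution_le (ℓ : StrongDual ℝ E) :
    ‖variationalSolution hB ℓ‖ ≤ ‖(hB.continuousLinearEquivOfBilin.symm : E →L[ℝ] E)‖ * ‖ℓ‖ := by
  refine ((hB.continuousLinearEquivOfBilin.symm : E →L[ℝ] E).le_opNorm _).trans ?_
  rw [LinearIsometryEquiv.norm_map]

/-- The solution operator in the pivot space. -/
def solutionOp : H →L[ℝ] H :=
  J ∘L (hB.continuousLinearEquivOfBilin.symm : E →L[ℝ] E) ∘L J.adjoint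

theorem solutionOp_apply (g : H) :
    solutionOp hB J g = J (variationalSolution hB (innerSL ℝ g ∘L J)) := by
  simp only [solutionOp, ContinuousLinearMap.comp_apply]
  congr 1

omit [CompleteSpace H] in
theorem inner_apply_eq (hsym : ∀ x y, B x y = B y x) (w : E) (x : H) :
    inner ℝ (J w) x = B w (variationalSolution hB (innerSL ℝ x ∘L J)) := by
  rw [hsym, variationalSolution_spec, real_inner_comm]
  simp

omit [CompleteSpace E] in
theorem IsCoercive.nonneg (hB : IsCoercive B) (w : E) : 0 ≤ B w w := by
  obtain ⟨c, hc, h⟩ := hB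
  exact le_trans (by positivity) (h w)

/-- If `z` is the variational solution with datum `x`, then `⟪J w, x⟫ = B w z` and `⟪R x, x⟫ = B z
z`, and Cauchy–Schwarz for the form `B` concludes. This places the form domain in the range of
`R^(1/2)`. -/
theorem sqrtBound_solutionOp (hsym : ∀ x y, B x y = B y x) (w : E) :
    SqrtBound (solutionOp hB J) (J w) (Real.sqrt ‖B‖ * ‖w‖) := by
  intro x
  set z := variationalSolution hB (innerSL ℝ x ∘L J)
  have h1 : inner ℝ (solutionOp hB J x) x = B z z := by
    rw [solutionOp_apply, inner_apply_eq hB J hsym]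
  have h0 := fun w => IsCoercive.nonneg hB w
  have h2 : B w z ^ 2 ≤ B w w * B z z :=
    LinearMap.BilinForm.apply_sq_le_of_symm (B.toLinearMap₁₂) h0 ⟨fun x y => hsym x y⟩ w z
  have h3 : B w w ≤ ‖B‖ * ‖w‖ ^ 2 := by
    refine (le_abs_self _).trans ((B.le_opNorm₂ w w).trans_eq (by ring))
  rw [inner_apply_eq hB J hsym, h1]
  refine Real.abs_le_sqrt (y := ‖B‖ * ‖w‖ ^ 2 * B z z) (h2.trans ?_) |>.trans_eq ?_
  · gcongr; exact h0 z
  · rw [Real.sqrt_mul (by positivity), Real.sqrt_mul (norm_nonneg B), Real.sqrt_sq (norm_nonneg w)]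

/-- The key identity `⟪R x, y⟫ = B z_x z_y` transfers symmetry and positivity from `B`. If `R x =
0`, coercivity gives `z_x = 0`, so `x` is orthogonal to the dense range of `J`. -/
theorem isInverseElliptic_solutionOp (hsym : ∀ x y, B x y = B y x) (hJ : DenseRange J) :
    IsInverseElliptic (solutionOp hB J) := by
  have key : ∀ x y, inner ℝ (solutionOp hB J x) y = B (variationalSolution hB (innerSL ℝ x ∘L J))
      (variationalSolution hB (innerSL ℝ y ∘L J)) := fun x y => by
    rw [solutionOp_apply, inner_apply_eq hB J hsym]
  refine ⟨fun x y => ?_, fun x => ?_, fun x hx => ?_⟩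
  · rw [key, real_inner_comm, key, hsym]
  · rw [key]; exact IsCoercive.nonneg hB _
  · have h0 := key x x
    rw [hx, inner_zero_left] at h0
    obtain ⟨c, hc, h⟩ := id hB
    have h1 := h (variationalSolution hB (innerSL ℝ x ∘L J))
    rw [← h0] at h1
    have h2 : variationalSolution hB (innerSL ℝ x ∘L J) = 0 := by
      have := mul_self_nonneg ‖variationalSolution hB (innerSL ℝ x ∘L J)‖
      rw [← norm_eq_zero, ← mul_self_eq_zero]
      nlinarith
    refine hJ.eq_zero_of_inner_left ℝ fun w => ?_
    rw [real_inner_comm, inner_apply_eq hB J hsym, h2, map_zero]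

/-- The term `q W` is moved to the right and the form is inverted; `J` of the result is the operator
equation. Conversely that equation exhibits `W` as `J` of an element of the form domain, so
regularity of `W` comes for free. -/
theorem solvesVariational_iff (q : ℝ) (g W : H) (ν : ℝ) (ℓ : StrongDual ℝ E) :
    (∃ w, J w = W ∧ ∀ φ, B w φ + q * inner ℝ W (J φ) = inner ℝ g (J φ) + ν * ℓ φ) ↔
      W + q • solutionOp hB J W =
        solutionOp hB J g + ν • J (variationalSolution hB ℓ) := by
  have e : ∀ ψ φ, B (variationalSolution hB (innerSL ℝ ψ ∘L J)) φ = inner ℝ ψ (J φ) := fun ψ φ => by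
    rw [variationalSolution_spec]; simp
  constructor
  · rintro ⟨w, rfl, hw⟩
    have : w + q • variationalSolution hB (innerSL ℝ (J w) ∘L J) =
        variationalSolution hB (innerSL ℝ g ∘L J) + ν • variationalSolution hB ℓ := by
      rw [← sub_eq_zero, ← map_eq_zero_iff _ hB.continuousLinearEquivOfBilin.injective]
      refine ext_inner_right ℝ fun φ => ?_
      rw [hB.continuousLinearEquivOfBilin_apply]
      have := hw φ
      simp only [map_add, map_sub, map_smul, add_apply, sub_apply, smul_apply, e,
        variationalSolution_spec, smul_eq_mul, inner_zero_left]
      linarith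
    rw [solutionOp_apply, solutionOp_apply, ← map_smul, ← map_smul, ← map_add, ← map_add, this]
  · intro h
    refine ⟨variationalSolution hB (innerSL ℝ g ∘L J) + ν • variationalSolution hB ℓ
      - q • variationalSolution hB (innerSL ℝ W ∘L J), ?_, fun φ => ?_⟩
    · rw [map_sub, map_add, map_smul, map_smul, ← solutionOp_apply, ← solutionOp_apply, ← h]
      abel
    · simp only [map_add, map_sub, map_smul, add_apply, sub_apply, smul_apply, e,
        variationalSolution_spec, smul_eq_mul]
      ring

/-- A bounded, symmetric and coercive bilinear form. -/
structure IsEllipticForm (F : E → E → ℝ) : Prop where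
  add_left : ∀ w w' φ, F (w + w') φ = F w φ + F w' φ
  smul_left : ∀ (r : ℝ) w φ, F (r • w) φ = r • F w φ
  symm : ∀ w φ, F w φ = F φ w
  bounded : ∃ Q : ℝ, ∀ w φ, ‖F w φ‖ ≤ Q * ‖w‖ * ‖φ‖
  coercive : ∃ c : ℝ, 0 < c ∧ ∀ w, c * ‖w‖ * ‖w‖ ≤ F w w

theorem IsEllipticForm.exists_inverse {F : E → E → ℝ} (hF : IsEllipticForm F) (J : E →L[ℝ] H)
    (hJ : DenseRange J) :
    ∃ (R : H →L[ℝ] H) (k : StrongDual ℝ E → H) (C : ℝ), IsInverseElliptic R ∧ 0 ≤ C ∧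
      (∀ ℓ, SqrtBound R (k ℓ) (C * ‖ℓ‖)) ∧ (∀ w, SqrtBound R (J w) (C * ‖w‖)) ∧
      ∀ (q : ℝ) (g W : H) (ν : ℝ) (ℓ : StrongDual ℝ E),
        (∃ w, J w = W ∧ ∀ φ, F w φ + q * inner ℝ W (J φ) = inner ℝ g (J φ) + ν * ℓ φ) ↔
          W + q • R W = R g + ν • k ℓ := by
  obtain ⟨Q, hQ⟩ := hF.bounded
  let L : E →ₗ[ℝ] E →ₗ[ℝ] ℝ := LinearMap.mk₂ ℝ F hF.add_left hF.smul_left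
    (fun w φ φ' => by rw [hF.symm w, hF.symm w φ, hF.symm w φ', hF.add_left])
    (fun r w φ => by rw [hF.symm w, hF.symm w φ, hF.smul_left])
  let B : E →L[ℝ] E →L[ℝ] ℝ := L.mkContinuous₂ Q hQ
  have hsym : ∀ w φ, B w φ = B φ w := hF.symm
  have hB : IsCoercive B := hF.coercive
  set P := ‖(hB.continuousLinearEquivOfBilin.symm : E →L[ℝ] E)‖
  have hS : 0 ≤ Real.sqrt ‖B‖ := Real.sqrt_nonneg _
  have hP : 0 ≤ P := norm_nonneg _
  refine ⟨solutionOp hB J, fun ℓ => J (variationalSolution hB ℓ), Real.sqrt ‖B‖ * (1 + P),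
    isInverseElliptic_solutionOp hB J hsym hJ, by positivity, fun ℓ x => ?_, fun w x => ?_,
    solvesVariational_iff hB J⟩
  · refine (sqrtBound_solutionOp hB J hsym _ x).trans ?_
    refine mul_le_mul_of_nonneg_right ?_ (Real.sqrt_nonneg _)
    rw [mul_assoc]
    gcongr
    refine (norm_variationalSolution_le hB ℓ).trans ?_
    gcongr
    linarith
  · refine (sqrtBound_solutionOp hB J hsym w x).trans ?_
    gcongr
    nlinarith

end Variational

/-! ### The Sobolev inequality on `H¹₀(Ω)` and the elliptic form -/

section Sobolev

open Filter Topology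

variable {d : ℕ} {Ω : Set (Space d)}

theorem norm_fderiv_le_sum (φ : Space d → ℝ) (x : Space d) :
    ‖fderiv ℝ φ x‖ ≤ ∑ i, ‖partialDeriv i φ x‖ := by
  refine ContinuousLinearMap.opNorm_le_bound _ (Finset.sum_nonneg fun _ _ => norm_nonneg _)
    fun v => ?_
  have hv : v = ∑ i, v i • EuclideanSpace.single i (1:ℝ) := by
    ext j
    simp [Finset.sum_apply, Pi.single_apply]
  conv_lhs => rw [hv]
  rw [map_sum, Finset.sum_mul]
  refine norm_sum_le_of_le _ fun i _ => ?_
  rw [map_smul, norm_smul, mul_comm]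
  exact mul_le_mul_of_nonneg_left (PiLp.norm_apply_le v i) (norm_nonneg _)

theorem partialDeriv_continuous {φ : Space d → ℝ} (hφ : ContDiff ℝ ∞ φ) (i : Fin d) :
    Continuous (partialDeriv i φ) :=
  (hφ.continuous_fderiv (by simp)).clm_apply continuous_const

theorem eLpNorm_fderiv_le_sum {φ : Space d → ℝ} (hφ : ContDiff ℝ ∞ φ) {p : ℝ≥0∞} (hp : 1 ≤ p)
    (μ : Measure (Space d)) :
    eLpNorm (fderiv ℝ φ) p μ ≤ ∑ i, eLpNorm (partialDeriv i φ) p μ := by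
  calc _ ≤ eLpNorm (∑ i, fun x => ‖partialDeriv i φ x‖) p μ := by
        refine eLpNorm_mono_real fun x => (norm_fderiv_le_sum φ x).trans_eq ?_
        simp
    _ ≤ ∑ i, eLpNorm (fun x => ‖partialDeriv i φ x‖) p μ := by
        refine eLpNorm_sum_le (fun i _ => ?_) hp
        exact (partialDeriv_continuous hφ i).norm.aestronglyMeasurable
    _ = _ := by simp only [eLpNorm_norm]

/-- The exponent `p = 4d / (d + 4)` has Sobolev conjugate `4`, and it lies in `[1, 2]` for `d = 2,
3`, so on a bounded set the `L²` norm of the gradient controls its `L^p` norm. The target `L⁴` is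
what makes `V w φ` integrable for `V` in `L²`. -/
theorem exists_eLpNorm_four_le (hd : d = 2 ∨ d = 3) (hb : Bornology.IsBounded Ω) :
    ∃ C : ℝ, 0 ≤ C ∧ ∀ φ : Space d → ℝ, ContDiff ℝ ∞ φ → HasCompactSupport φ → tsupport φ ⊆ Ω →
      eLpNorm φ 4 (volume.restrict Ω) ≤
        ENNReal.ofReal C * ∑ i, eLpNorm (partialDeriv i φ) 2 (volume.restrict Ω) := by
  set p : NNReal := 4 * d / (d + 4)
  have hp1 : 1 ≤ p := by
    rcases hd with rfl | rfl
    · simp only [p]; rw [le_div_iff₀ (by positivity)]; norm_num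
    · simp only [p]; rw [le_div_iff₀ (by positivity)]; norm_num
  have hp2 : (p : ℝ≥0∞) ≤ 2 := by
    have : p ≤ 2 := by
      rcases hd with rfl | rfl
      · simp only [p]; rw [div_le_iff₀ (by positivity)]; norm_num
      · simp only [p]; rw [div_le_iff₀ (by positivity)]; norm_num
    exact_mod_cast this
  set C₁ := SNormLESNormFDerivOfEqConst ℝ (volume : Measure (Space d)) p
  set C₂ := (volume.restrict Ω) univ ^ (1 / (p : ℝ≥0∞).toReal - 1 / (2 : ℝ≥0∞).toReal)
  have hvol : volume Ω < ⊤ := hb.measure_lt_top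
  have hC₂ : C₂ ≠ ⊤ := by
    refine ENNReal.rpow_ne_top_of_nonneg ?_ ?_
    · have h1 : (p:ℝ≥0∞).toReal ≤ (2:ℝ≥0∞).toReal := ENNReal.toReal_mono (by simp) hp2
      have h2 : 0 < (p:ℝ≥0∞).toReal := by
        simpa using lt_of_lt_of_le one_pos hp1
      exact sub_nonneg.2 (one_div_le_one_div_of_le h2 h1)
    · rw [Measure.restrict_apply_univ]; exact hvol.ne
  refine ⟨C₁ * C₂.toReal, by positivity, fun φ h1 h2 h3 => ?_⟩
  have hs : (Function.support (fderiv ℝ φ)) ⊆ Ω :=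
    (support_fderiv_subset ℝ).trans h3
  have hres : eLpNorm (fderiv ℝ φ) p (volume.restrict Ω) = eLpNorm (fderiv ℝ φ) p volume := by
    rw [← eLpNorm_norm, ← eLpNorm_norm (fderiv ℝ φ)]
    exact eLpNorm_restrict_eq_of_support_subset fun x hx => hs fun h0 => hx (by simp [h0])
  have hsob : eLpNorm φ (4 : NNReal) volume ≤ C₁ * eLpNorm (fderiv ℝ φ) p volume := by
    refine eLpNorm_le_eLpNorm_fderiv_of_eq volume (h1.of_le (by exact_mod_cast le_top)) h2 hp1 ?_ ?_
    · simp only [finrank_euclideanSpace, Fintype.card_fin]; omega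
    · simp only [finrank_euclideanSpace, Fintype.card_fin, p]
      rcases hd with rfl | rfl <;> norm_num
  calc _ ≤ eLpNorm φ (4 : NNReal) volume := eLpNorm_mono_measure _ Measure.restrict_le_self
    _ ≤ C₁ * eLpNorm (fderiv ℝ φ) p volume := hsob
    _ = C₁ * eLpNorm (fderiv ℝ φ) p (volume.restrict Ω) := by
        rw [hres]
    _ ≤ C₁ * (eLpNorm (fderiv ℝ φ) 2 (volume.restrict Ω) * C₂) := by
        gcongr
        exact eLpNorm_le_eLpNorm_mul_rpow_measure_univ hp2
          (h1.continuous_fderiv (by simp)).aestronglyMeasurable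
    _ ≤ C₁ * ((∑ i, eLpNorm (partialDeriv i φ) 2 (volume.restrict Ω)) * C₂) := by
        gcongr
        exact eLpNorm_fderiv_le_sum h1 (by norm_num) _
    _ = _ := by
        rw [ENNReal.ofReal_mul (by positivity), ENNReal.ofReal_toReal hC₂,
          ENNReal.ofReal_coe_nnreal]
        ring

/-- The `L⁴` norm is lower semicontinuous along an almost everywhere convergent subsequence, so the
bound passes from test functions to their closure. -/
theorem exists_eLpNorm_four_le_snd (hd : d = 2 ∨ d = 3) (hb : Bornology.IsBounded Ω) :
    ∃ C : ℝ, 0 ≤ C ∧ ∀ w : H10 Ω,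
      eLpNorm w.1.fst 4 (volume.restrict Ω) ≤ ENNReal.ofReal (C * ‖w.1.snd‖) := by
  obtain ⟨C, hC, h⟩ := exists_eLpNorm_four_le hd hb
  have htest : ∀ w ∈ testGraph Ω, eLpNorm w.fst 4 (volume.restrict Ω) ≤
      ENNReal.ofReal (C * d * ‖w.snd‖) := by
    rintro w ⟨φ, h1, h2, h3, h4, h5⟩
    rw [eLpNorm_congr_ae h4]
    refine (h φ h1 h2 h3).trans ?_
    have : ∀ i ∈ Finset.univ, eLpNorm (partialDeriv i φ) 2 (volume.restrict Ω) ≤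
        ENNReal.ofReal ‖w.snd‖ := fun i _ => by
      rw [← eLpNorm_congr_ae (h5 i), ← Lp.enorm_def, ← ofReal_norm]
      exact ENNReal.ofReal_le_ofReal (PiLp.norm_apply_le w.snd i)
    calc _ ≤ ENNReal.ofReal C * ∑ i : Fin d, ENNReal.ofReal ‖w.snd‖ := by
          gcongr with i hi; exact this i hi
      _ = _ := by
          rw [ENNReal.ofReal_mul (by positivity), ENNReal.ofReal_mul hC]
          simp [mul_assoc]
  refine ⟨C * d, by positivity, fun w => ?_⟩
  obtain ⟨W, hW, hlim⟩ := mem_closure_iff_seq_limit.1 w.2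
  have hf : Tendsto (fun n => (W n).fst) atTop (𝓝 w.1.fst) :=
    ((WithLp.prod_continuous_ofLp 2 _ _).fst.tendsto _).comp hlim
  have hs : Tendsto (fun n => (W n).snd) atTop (𝓝 w.1.snd) :=
    ((WithLp.prod_continuous_ofLp 2 _ _).snd.tendsto _).comp hlim
  obtain ⟨ns, hns, hae⟩ := (tendstoInMeasure_of_tendsto_Lp hf).exists_seq_tendsto_ae
  refine (Lp.eLpNorm_lim_le_liminf_eLpNorm (fun n => Lp.aestronglyMeasurable _) _ hae).trans ?_
  have hlim' : Tendsto (fun n => ENNReal.ofReal (C * d * ‖(W (ns n)).snd‖)) atTop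
      (𝓝 (ENNReal.ofReal (C * d * ‖w.1.snd‖))) :=
    (ENNReal.continuous_ofReal.tendsto _).comp
      ((hs.comp hns.tendsto_atTop).norm.const_mul _)
  rw [← hlim'.liminf_eq]
  exact liminf_le_liminf (.of_forall fun n => htest _ (hW _))

end Sobolev

section EllipticForm

open Filter Topology

variable {d : ℕ} {Ω : Set (Space d)}

/-- The integral `∫ m f g` over `Ω`. -/
def weightedInner (m : Space d → ℝ) (f g : L2 Ω) : ℝ := ∫ x in Ω, m x * f x * g x

/-- The integrand of `weightedInner` is integrable. -/
def WeightedIntegrable (m : Space d → ℝ) (f g : L2 Ω) : Prop :=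
  Integrable (fun x => m x * f x * g x) (volume.restrict Ω)

theorem weightedInner_comm (m : Space d → ℝ) (f g : L2 Ω) :
    weightedInner m f g = weightedInner m g f := by
  simp only [weightedInner, mul_right_comm]

theorem weightedInner_add_left {m : Space d → ℝ} {f f' g : L2 Ω} (h : WeightedIntegrable m f g)
    (h' : WeightedIntegrable m f' g) :
    weightedInner m (f + f') g = weightedInner m f g + weightedInner m f' g := by
  rw [weightedInner, weightedInner, weightedInner, ← integral_add h h']
  refine integral_congr_ae ?_
  filter_upwards [Lp.coeFn_add f f'] with x hx
  rw [hx, Pi.add_apply]; ring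

theorem weightedInner_smul_left (m : Space d → ℝ) (c : ℝ) (f g : L2 Ω) :
    weightedInner m (c • f) g = c * weightedInner m f g := by
  rw [weightedInner, weightedInner, ← integral_const_mul]
  refine integral_congr_ae ?_
  filter_upwards [Lp.coeFn_smul c f] with x hx
  rw [hx, Pi.smul_apply, smul_eq_mul]; ring

theorem norm_weightedInner_le_of_bounded {m : Space d → ℝ} {K : ℝ} (hK : 0 ≤ K)
    (hm : AEStronglyMeasurable m (volume.restrict Ω))
    (hb : ∀ᵐ x ∂volume.restrict Ω, |m x| ≤ K) (f g : L2 Ω) :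
    WeightedIntegrable m f g ∧ |weightedInner m f g| ≤ K * (‖f‖ * ‖g‖) := by
  have hfg : Integrable (fun x => f x * g x) (volume.restrict Ω) :=
    (Lp.memLp f).integrable_mul (Lp.memLp g)
  have hi : WeightedIntegrable m f g := by
    have := hfg.bdd_mul (c := K) hm hb
    simpa only [WeightedIntegrable, mul_assoc] using this
  refine ⟨hi, ?_⟩
  have habs : Integrable (fun x => |f x| * |g x|) (volume.restrict Ω) := by
    simpa only [abs_mul] using hfg.abs
  have h2 : ∫ x in Ω, |f x| * |g x| ≤ ‖f‖ * ‖g‖ := by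
    have h3 : ∫ x in Ω, |f x| * |g x| = inner ℝ |f| |g| := by
      rw [L2.inner_def]
      refine integral_congr_ae ?_
      filter_upwards [Lp.coeFn_abs f, Lp.coeFn_abs g] with x h1 h2
      rw [h1, h2]; simp [mul_comm]
    rw [h3]
    refine (real_inner_le_norm |f| |g|).trans_eq ?_
    rw [norm_abs_eq_norm, norm_abs_eq_norm]
  calc |weightedInner m f g| ≤ ∫ x in Ω, K * (|f x| * |g x|) := by
        rw [weightedInner, ← Real.norm_eq_abs]
        refine norm_integral_le_of_norm_le (habs.const_mul K) ?_
        filter_upwards [hb] with x hx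
        rw [Real.norm_eq_abs, abs_mul, abs_mul, mul_assoc]
        gcongr
    _ ≤ K * (‖f‖ * ‖g‖) := by rw [integral_const_mul]; gcongr

theorem norm_weightedInner_le_of_memLp {m : Space d → ℝ} (hm : MemLp m 2 (volume.restrict Ω))
    {f g : L2 Ω} {A B : ℝ} (hA : 0 ≤ A) (hB : 0 ≤ B)
    (hf : eLpNorm f 4 (volume.restrict Ω) ≤ ENNReal.ofReal A)
    (hg : eLpNorm g 4 (volume.restrict Ω) ≤ ENNReal.ofReal B) :
    WeightedIntegrable m f g ∧
      |weightedInner m f g| ≤ (eLpNorm m 2 (volume.restrict Ω)).toReal * (A * B) := by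
  have : ENNReal.HolderTriple 4 4 2 := ⟨by
    rw [← ENNReal.toReal_eq_toReal_iff' (by simp) (by simp), ENNReal.toReal_add (by simp) (by simp)]
    norm_num⟩
  have hmf := hm.1
  have hfm := Lp.aestronglyMeasurable f
  have hgm := Lp.aestronglyMeasurable g
  have h1 : eLpNorm ((f : Space d → ℝ) • (g : Space d → ℝ)) 2 (volume.restrict Ω) ≤
      ENNReal.ofReal (A * B) := by
    refine (eLpNorm_smul_le_mul_eLpNorm (p := 4) (q := 4) hgm hfm).trans ?_
    rw [ENNReal.ofReal_mul hA]
    gcongr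
  have h2 : eLpNorm (m • ((f : Space d → ℝ) • (g : Space d → ℝ))) 1 (volume.restrict Ω) ≤
      eLpNorm m 2 (volume.restrict Ω) * ENNReal.ofReal (A * B) := by
    refine (eLpNorm_smul_le_mul_eLpNorm (p := 2) (q := 2) (hfm.smul hgm) hmf).trans ?_
    gcongr
  have e : m • ((f : Space d → ℝ) • (g : Space d → ℝ)) = fun x => m x * f x * g x := by
    ext x; simp [mul_assoc]
  rw [e] at h2
  have hlt : eLpNorm m 2 (volume.restrict Ω) * ENNReal.ofReal (A * B) ≠ ⊤ :=
    ENNReal.mul_ne_top hm.2.ne ENNReal.ofReal_ne_top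
  have hi : WeightedIntegrable m f g :=
    memLp_one_iff_integrable.1 ⟨(hmf.mul hfm).mul hgm, h2.trans_lt hlt.lt_top⟩
  refine ⟨hi, ?_⟩
  calc |weightedInner m f g| ≤ ∫ x in Ω, ‖m x * f x * g x‖ := by
        rw [weightedInner, ← Real.norm_eq_abs]
        exact norm_integral_le_integral_norm _
    _ = (eLpNorm (fun x => m x * f x * g x) 1 (volume.restrict Ω)).toReal := by
        rw [eLpNorm_one_eq_lintegral_enorm, integral_norm_eq_lintegral_enorm hi.1]
    _ ≤ (eLpNorm m 2 (volume.restrict Ω) * ENNReal.ofReal (A * B)).toReal :=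
        ENNReal.toReal_mono hlt h2
    _ = _ := by rw [ENNReal.toReal_mul, ENNReal.toReal_ofReal (by positivity)]

/-- Poincaré's inequality, read off from the `L⁴` bound since the measure of `Ω` is finite. -/
theorem exists_norm_fst_le (hd : d = 2 ∨ d = 3) (hb : Bornology.IsBounded Ω) :
    ∃ C : ℝ, 0 ≤ C ∧ ∀ w : H10 Ω, ‖w.1.fst‖ ≤ C * ‖w.1.snd‖ := by
  obtain ⟨C, hC, h⟩ := exists_eLpNorm_four_le_snd hd hb
  have hvol : volume Ω < ⊤ := hb.measure_lt_top
  set C₂ := (volume.restrict Ω) univ ^ (1 / (2 : ℝ≥0∞).toReal - 1 / (4 : ℝ≥0∞).toReal)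
  have hC₂ : C₂ ≠ ⊤ := by
    refine ENNReal.rpow_ne_top_of_nonneg (by norm_num) ?_
    rw [Measure.restrict_apply_univ]; exact hvol.ne
  refine ⟨C * C₂.toReal, by positivity, fun w => ?_⟩
  have h1 : eLpNorm w.1.fst 2 (volume.restrict Ω) ≤ ENNReal.ofReal (C * ‖w.1.snd‖) * C₂ := by
    refine (eLpNorm_le_eLpNorm_mul_rpow_measure_univ (q := 4) (by norm_num)
      (Lp.aestronglyMeasurable _)).trans ?_
    gcongr
    exact h w
  rw [Lp.norm_def]
  refine (ENNReal.toReal_mono (ENNReal.mul_ne_top ENNReal.ofReal_ne_top hC₂) h1).trans_eq ?_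
  rw [ENNReal.toReal_mul, ENNReal.toReal_ofReal (by positivity)]
  ring

theorem norm_snd_le (w : H10 Ω) : ‖w.1.snd‖ ≤ ‖w‖ := WithLp.norm_snd_le _ w.1

set_option maxHeartbeats 1000000 in
theorem isEllipticForm_ellipticForm (hd : d = 2 ∨ d = 3) (hΩo : IsOpen Ω) (hb : Bornology.IsBounded Ω)
    {a : Fin d → Fin d → Space d → ℝ}
    (ha_symm : ∀ i j, ∀ x ∈ closure Ω, a i j x = a j i x)
    (ha : ∀ i j, ContinuousOn (a i j) (closure Ω))
    {c : ℝ} (hc : 0 < c)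
    (ha_ell : ∀ x ∈ closure Ω, ∀ ξ : Space d, c * ‖ξ‖ ^ 2 ≤ ∑ i, ∑ j, a i j x * ξ i * ξ j)
    {κ : ℝ≥0∞} (hκ : 2 ≤ κ) {V : Space d → ℝ} (hV : MemLp V κ (volume.restrict Ω))
    (hV0 : ∀ᵐ x ∂(volume.restrict Ω), 0 ≤ V x) :
    IsEllipticForm (E := H10 Ω) (ellipticForm a V) := by
  have hvol : volume Ω < ⊤ := hb.measure_lt_top
  have : IsFiniteMeasure (volume.restrict Ω) := ⟨by rwa [Measure.restrict_apply_univ]⟩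
  have hV2 : MemLp V 2 (volume.restrict Ω) := hV.mono_exponent hκ
  obtain ⟨S, hS, hSob⟩ := exists_eLpNorm_four_le_snd hd hb
  obtain ⟨P, hP, hPoin⟩ := exists_norm_fst_le hd hb
  have hcomp : IsCompact (closure Ω) := hb.isCompact_closure
  have hbdd : ∀ i j, ∃ K, 0 ≤ K ∧ ∀ x ∈ closure Ω, |a i j x| ≤ K := fun i j => by
    obtain ⟨K, hK⟩ := hcomp.exists_bound_of_continuousOn (ha i j)
    exact ⟨max K 0, le_max_right _ _, fun x hx => (hK x hx).trans (le_max_left _ _)⟩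
  choose K hK0 hK using hbdd
  have hmem : ∀ᵐ x ∂volume.restrict Ω, x ∈ closure Ω :=
    (ae_restrict_mem hΩo.measurableSet).mono fun x hx => subset_closure hx
  have hA := fun i j => norm_weightedInner_le_of_bounded (Ω := Ω) (m := a i j) (hK0 i j)
    (((ha i j).mono subset_closure).aestronglyMeasurable hΩo.measurableSet)
    (hmem.mono fun x hx => hK i j x hx)
  have hW := fun w φ : H10 Ω => norm_weightedInner_le_of_memLp hV2 (A := S * ‖w.1.snd‖)
    (B := S * ‖φ.1.snd‖) (by positivity) (by positivity) (hSob w) (hSob φ)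
  have hform : ∀ w φ : H10 Ω, ellipticForm a V w φ =
      (∑ i, ∑ j, weightedInner (a i j) (w.1.snd j) (φ.1.snd i)) + weightedInner V w.1.fst φ.1.fst := by
    intro w φ
    rw [ellipticForm, integral_finsetSum _ fun i _ =>
      integrable_finsetSum _ fun j _ => (hA i j (w.1.snd j) (φ.1.snd i)).1]
    congr 1
    refine Finset.sum_congr rfl fun i _ => ?_
    rw [integral_finsetSum _ fun j _ => (hA i j (w.1.snd j) (φ.1.snd i)).1]
    rfl
  have hsym : ∀ w φ : H10 Ω, ellipticForm a V w φ = ellipticForm a V φ w := by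
    intro w φ
    rw [hform, hform, Finset.sum_comm, weightedInner_comm V]
    congr 1
    refine Finset.sum_congr rfl fun i _ => Finset.sum_congr rfl fun j _ => ?_
    rw [weightedInner_comm]
    refine integral_congr_ae (hmem.mono fun x hx => ?_)
    simp only [ha_symm j i x hx]
  have hadd : ∀ w w' φ : H10 Ω, ellipticForm a V (w + w') φ =
      ellipticForm a V w φ + ellipticForm a V w' φ := by
    intro w w' φ
    rw [hform, hform, hform]
    have e1 : ∀ i j, weightedInner (a i j) ((w + w').1.snd j) (φ.1.snd i) =
        weightedInner (a i j) (w.1.snd j) (φ.1.snd i) +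
        weightedInner (a i j) (w'.1.snd j) (φ.1.snd i) := fun i j =>
      weightedInner_add_left (hA i j _ _).1 (hA i j _ _).1
    have e2 : weightedInner V (w + w').1.fst φ.1.fst =
        weightedInner V w.1.fst φ.1.fst + weightedInner V w'.1.fst φ.1.fst :=
      weightedInner_add_left (hW w φ).1 (hW w' φ).1
    simp only [e1, e2, Finset.sum_add_distrib]
    ring
  have hsmul : ∀ (r : ℝ) (w φ : H10 Ω), ellipticForm a V (r • w) φ = r • ellipticForm a V w φ := by
    intro r w φ
    rw [hform, hform]
    have e1 : ∀ i j, weightedInner (a i j) ((r • w).1.snd j) (φ.1.snd i) =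
        r * weightedInner (a i j) (w.1.snd j) (φ.1.snd i) := fun i j =>
      weightedInner_smul_left _ _ _ _
    have e2 : weightedInner V (r • w).1.fst φ.1.fst = r * weightedInner V w.1.fst φ.1.fst :=
      weightedInner_smul_left _ _ _ _
    simp only [e1, e2, ← Finset.mul_sum, smul_eq_mul]
    ring
  set Q := (∑ i, ∑ j, K i j) + (eLpNorm V 2 (volume.restrict Ω)).toReal * (S * S)
  have hL : ∀ w φ : H10 Ω, ‖ellipticForm a V w φ‖ ≤ Q * ‖w‖ * ‖φ‖ := by
    intro w φ
    rw [Real.norm_eq_abs, hform]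
    have hw := norm_snd_le w
    have hφ := norm_snd_le φ
    have b1 : ∀ i j, |weightedInner (a i j) (w.1.snd j) (φ.1.snd i)| ≤ K i j * (‖w‖ * ‖φ‖) :=
      fun i j => (hA i j _ _).2.trans (by
        have := hK0 i j
        gcongr
        · exact (PiLp.norm_apply_le w.1.snd j).trans hw
        · exact (PiLp.norm_apply_le φ.1.snd i).trans hφ)
    have b2 : |weightedInner V w.1.fst φ.1.fst| ≤
        (eLpNorm V 2 (volume.restrict Ω)).toReal * (S * S) * (‖w‖ * ‖φ‖) := by
      refine (hW w φ).2.trans ?_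
      calc _ ≤ (eLpNorm V 2 (volume.restrict Ω)).toReal * (S * ‖w‖ * (S * ‖φ‖)) := by gcongr
        _ = _ := by ring
    calc _ ≤ (∑ i, ∑ j, K i j * (‖w‖ * ‖φ‖)) +
          (eLpNorm V 2 (volume.restrict Ω)).toReal * (S * S) * (‖w‖ * ‖φ‖) := by
          refine (abs_add_le _ _).trans (add_le_add ?_ b2)
          refine (Finset.abs_sum_le_sum_abs _ _).trans (Finset.sum_le_sum fun i _ => ?_)
          exact (Finset.abs_sum_le_sum_abs _ _).trans (Finset.sum_le_sum fun j _ => b1 i j)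
      _ = _ := by simp only [← Finset.sum_mul, Q]; ring
  -- Ellipticity and `V ≥ 0` control only the gradient; Poincaré turns this into the full norm
  -- through `‖w‖² ≤ (1 + P²) ‖∇w‖²`.
  refine ⟨hadd, hsmul, hsym, ⟨Q, hL⟩, c / (1 + P ^ 2), by positivity, fun w => ?_⟩
  have h1 : c * ‖w.1.snd‖ ^ 2 ≤ ellipticForm a V w w := by
    have hpos : 0 ≤ ∫ x in Ω, V x * w.1.fst x * w.1.fst x :=
      integral_nonneg_of_ae (hV0.mono fun x hx => by
        simp only [Pi.zero_apply, mul_assoc]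
        exact mul_nonneg hx (mul_self_nonneg _))
    have hsq : ∀ i, Integrable (fun x => (w.1.snd i x) ^ 2) (volume.restrict Ω) := fun i =>
      (Lp.memLp (w.1.snd i)).integrable_sq
    have hn : c * ‖w.1.snd‖ ^ 2 = ∫ x in Ω, c * ∑ i, (w.1.snd i x) ^ 2 := by
      rw [integral_const_mul, integral_finsetSum _ fun i _ => hsq i, PiLp.norm_sq_eq_of_L2]
      congr 1
      refine Finset.sum_congr rfl fun i _ => ?_
      rw [← real_inner_self_eq_norm_sq, L2.inner_def]
      simp [sq]
    rw [ellipticForm, hn]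
    refine le_add_of_le_of_nonneg (integral_mono_ae
      ((integrable_finsetSum _ fun i _ => hsq i).const_mul c)
      (integrable_finsetSum _ fun i _ => integrable_finsetSum _ fun j _ =>
        (hA i j (w.1.snd j) (w.1.snd i)).1) ?_) hpos
    filter_upwards [hmem] with x hx
    have := ha_ell x hx (WithLp.toLp 2 fun i => w.1.snd i x)
    rw [EuclideanSpace.real_norm_sq_eq] at this
    refine this.trans_eq (Finset.sum_congr rfl fun i _ => Finset.sum_congr rfl fun j _ => ?_)
    simp only; ring
  have h2 : ‖w‖ ^ 2 ≤ (1 + P ^ 2) * ‖w.1.snd‖ ^ 2 := by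
    have e : ‖w‖ ^ 2 = ‖w.1.fst‖ ^ 2 + ‖w.1.snd‖ ^ 2 := WithLp.prod_norm_sq_eq_of_L2 w.1
    have := pow_le_pow_left₀ (norm_nonneg _) (hPoin w) 2
    rw [e]; nlinarith
  calc c / (1 + P ^ 2) * ‖w‖ * ‖w‖ = c / (1 + P ^ 2) * ‖w‖ ^ 2 := by ring
    _ ≤ c / (1 + P ^ 2) * ((1 + P ^ 2) * ‖w.1.snd‖ ^ 2) := by gcongr
    _ = c * ‖w.1.snd‖ ^ 2 := by field_simp
    _ ≤ _ := h1

/-- The embedding of `H¹₀(Ω)` in `L²(Ω)`. -/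
def embedding (Ω : Set (Space d)) : H10 Ω →L[ℝ] L2 Ω :=
  WithLp.fstL 2 ℝ _ _ ∘L (H10 Ω).subtypeL

@[simp] theorem embedding_apply (w : H10 Ω) : embedding Ω w = w.1.fst := rfl

theorem inner_L2 (f g : L2 Ω) : inner ℝ f g = ∫ x in Ω, f x * g x := by
  rw [L2.inner_def]; simp [mul_comm]

/-- The element of `H¹₀(Ω)` defined by a test function. -/
theorem exists_testGraph {φ : Space d → ℝ} (h1 : ContDiff ℝ ∞ φ) (h2 : HasCompactSupport φ)
    (h3 : tsupport φ ⊆ Ω) : ∃ w : H10 Ω, (w.1.fst =ᵐ[volume.restrict Ω] φ) ∧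
      ∀ i, w.1.snd i =ᵐ[volume.restrict Ω] partialDeriv i φ := by
  have m1 : MemLp φ 2 (volume.restrict Ω) := (h1.continuous.memLp_of_hasCompactSupport h2).restrict Ω
  have m2 : ∀ i, MemLp (partialDeriv i φ) 2 (volume.restrict Ω) := fun i =>
    ((partialDeriv_continuous h1 i).memLp_of_hasCompactSupport
      ((h2.fderiv (𝕜 := ℝ)).comp_left
        (g := fun L : Space d →L[ℝ] ℝ => L (EuclideanSpace.single i 1)) rfl)).restrict Ω
  refine ⟨⟨WithLp.toLp 2 (m1.toLp φ, WithLp.toLp 2 fun i => (m2 i).toLp _),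
    (testGraph Ω).le_topologicalClosure ⟨φ, h1, h2, h3, m1.coeFn_toLp, fun i => (m2 i).coeFn_toLp⟩⟩,
    m1.coeFn_toLp, fun i => (m2 i).coeFn_toLp⟩

theorem denseRange_embedding (hΩ : IsOpen Ω) : DenseRange (embedding Ω) := by
  have hd : (embedding Ω).range.topologicalClosure = ⊤ := by
    rw [Submodule.topologicalClosure_eq_top_iff, Submodule.eq_bot_iff]
    intro f hf
    have h0 : ∀ᵐ x ∂volume.restrict Ω, x ∈ Ω → f x = 0 := by
      refine hΩ.ae_eq_zero_of_integral_contDiff_smul_eq_zero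
        (((Lp.memLp f).locallyIntegrable (by norm_num)).locallyIntegrableOn Ω) fun g h1 h2 h3 => ?_
      obtain ⟨w, hw, -⟩ := exists_testGraph h1 h2 h3
      have := (Submodule.mem_orthogonal _ f).1 hf (embedding Ω w) ⟨w, rfl⟩
      rw [inner_L2] at this
      rw [← this]
      refine integral_congr_ae ?_
      filter_upwards [hw] with x hx
      simp [hx]
    rw [Lp.eq_zero_iff_ae_eq_zero]
    filter_upwards [h0, ae_restrict_mem hΩ.measurableSet] with x h1 h2 using h1 h2
  have := congrArg (fun S : Submodule ℝ (L2 Ω) => (S : Set (L2 Ω))) hd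
  simp only [Submodule.topologicalClosure_coe, Submodule.top_coe] at this
  rw [DenseRange, dense_iff_closure_eq]
  exact this

/-- The reduction of the elliptic problem with parameter to an equation in `L²(Ω)`. -/
theorem exists_inverse_ellipticForm (hΩ : IsOpen Ω) {a : Fin d → Fin d → Space d → ℝ}
    {V : Space d → ℝ} (hF : IsEllipticForm (E := H10 Ω) (ellipticForm a V)) :
    ∃ (R : L2 Ω →L[ℝ] L2 Ω) (k : Hneg1 Ω → L2 Ω) (C : ℝ), IsInverseElliptic R ∧ 0 ≤ C ∧
      (∀ ℓ, SqrtBound R (k ℓ) (C * ‖ℓ‖)) ∧ (∀ w : H10 Ω, SqrtBound R w.1.fst (C * ‖w‖)) ∧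
      ∀ (q : ℝ) (g W : L2 Ω) (ν : ℝ) (ℓ : Hneg1 Ω),
        SolvesDirichlet a V q g ν ℓ W ↔ W + q • R W = R g + ν • k ℓ := by
  obtain ⟨R, k, C, h1, h2, h3, h4, h5⟩ :=
    hF.exists_inverse (embedding Ω) (denseRange_embedding hΩ)
  refine ⟨R, k, C, h1, h2, h3, h4, fun q g W ν ℓ => ?_⟩
  rw [← h5]
  simp only [SolvesDirichlet, inner_L2, embedding_apply]

end EllipticForm

/-! ### Geometry of the domain near its boundary -/

section Geometry

open Filter Topology Metric

variable {d : ℕ} {Ω : Set (Space d)}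

/-- In the ball of radius `r` around `x₀`, the set `Ω` is stable under translations by vectors
of the cone of axis `e` and opening `1 / L`. -/
def ConeCondition (Ω : Set (Space d)) (x₀ e : Space d) (r L : ℝ) : Prop :=
  ∀ x ∈ ball x₀ r, x ∈ Ω → ∀ v : Space d, x + v ∈ ball x₀ r →
    L * ‖v - inner ℝ v e • e‖ ≤ inner ℝ v e → x + v ∈ Ω

theorem norm_sub_inner_smul_le {e : Space d} (he : ‖e‖ = 1) (v : Space d) :
    ‖v - inner ℝ v e • e‖ ≤ ‖v‖ := by
  refine le_of_sq_le_sq ?_ (norm_nonneg v) |>.trans le_rfl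
  rw [norm_sub_sq_real, inner_smul_right, norm_smul, he, Real.norm_eq_abs, mul_one, sq_abs]
  nlinarith [sq_nonneg (inner ℝ v e)]

/-- The graph function is locally Lipschitz. A displacement `v` changes the graph height by at most
`L` times its tangential part, which the cone condition makes no larger than the gain in height `⟪v,
e⟫`. -/
theorem IsC2BoundedDomain.exists_coneCondition (hΩ : IsC2BoundedDomain Ω) {x₀ : Space d}
    (hx₀ : x₀ ∈ frontier Ω) :
    ∃ (e : Space d) (r L : ℝ), ‖e‖ = 1 ∧ 0 < r ∧ 0 ≤ L ∧ ConeCondition Ω x₀ e r L := by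
  obtain ⟨ρ, e, γ, hρ, he, hγ, hΩρ⟩ := hΩ.boundary x₀ hx₀
  obtain ⟨K, t, ht, hK⟩ := (hγ.contDiffAt (x := x₀ - inner ℝ x₀ e • e)).of_le
    (one_le_two) |>.exists_lipschitzOnWith
  obtain ⟨r, hr, hrt⟩ := Metric.mem_nhds_iff.1 ht
  refine ⟨e, min ρ r, K, he, lt_min hρ hr, K.2, fun x hx hxΩ v hv hcone => ?_⟩
  have hproj : ∀ z ∈ ball x₀ (min ρ r), z - inner ℝ z e • e ∈ t := fun z hz => hrt <| by
    have hz' := lt_of_lt_of_le hz (min_le_right ρ r)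
    rw [mem_ball, dist_eq_norm] at *
    have e2 : z - inner ℝ z e • e - (x₀ - inner ℝ x₀ e • e) =
        z - x₀ - inner ℝ (z - x₀) e • e := by
      rw [inner_sub_left, sub_smul]; abel
    rw [e2]
    exact (norm_sub_inner_smul_le he (z - x₀)).trans_lt hz'
  rw [hΩρ _ (lt_of_lt_of_le hv (min_le_left ρ r))]
  rw [hΩρ _ (lt_of_lt_of_le hx (min_le_left ρ r))] at hxΩ
  have h1 := hK.dist_le_mul _ (hproj _ hv) _ (hproj _ hx)
  have e1 : x + v - inner ℝ (x + v) e • e - (x - inner ℝ x e • e) = v - inner ℝ v e • e := by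
    rw [inner_add_left, add_smul]; abel
  rw [dist_eq_norm (x + v - _), e1, Real.dist_eq] at h1
  have h2 := (le_abs_self _).trans (h1.trans hcone)
  rw [inner_add_left] at *
  linarith

/-- Around the point at height `η / 2` along the axis, this radius is small enough for the whole
ball to stay in the cone with vertex `x`. The resulting lower bound on the measure of `Ω ∩ ball x η`
is what the averaging argument uses. -/
theorem ConeCondition.ball_subset {x₀ e : Space d} {r L : ℝ} (h : ConeCondition Ω x₀ e r L)
    (he : ‖e‖ = 1) (hL : 0 ≤ L) {x : Space d} (hx : x ∈ ball x₀ (r / 2)) (hxΩ : x ∈ Ω) {η : ℝ}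
    (hη : 0 < η) (hηr : η ≤ r / 2) :
    ball (x + (η / 2) • e) (η / (2 * (1 + L))) ⊆ Ω ∩ ball x η := by
  intro z hz
  set ξ := z - (x + (η / 2) • e) with hξ
  have hξn : ‖ξ‖ < η / (2 * (1 + L)) := by rwa [mem_ball, dist_eq_norm] at hz
  have hξ2 : (1 + L) * ‖ξ‖ < η / 2 := by
    rw [lt_div_iff₀ (by positivity)] at hξn; linarith
  have hξ3 : ‖ξ‖ < η / 2 := by nlinarith [norm_nonneg ξ]
  have hzv : z = x + ((η / 2) • e + ξ) := by rw [hξ]; abel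
  have hee : inner ℝ e e = (1:ℝ) := by rw [real_inner_self_eq_norm_sq, he]; norm_num
  have hv : ‖(η / 2) • e + ξ‖ < η := by
    refine (norm_add_le _ _).trans_lt ?_
    rw [norm_smul, he, Real.norm_of_nonneg (by positivity)]; linarith
  have hzball : z ∈ ball x η := by
    rw [mem_ball, dist_eq_norm, hzv, add_sub_cancel_left]; exact hv
  refine ⟨?_, hzball⟩
  rw [mem_ball] at hx hzball
  rw [hzv]
  refine h x (by rw [mem_ball]; linarith) hxΩ _ ?_ ?_
  · rw [← hzv, mem_ball]
    have := dist_triangle z x x₀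
    linarith
  · have e1 : (η / 2) • e + ξ - inner ℝ ((η / 2) • e + ξ) e • e = ξ - inner ℝ ξ e • e := by
      rw [inner_add_left, inner_smul_left, hee, add_smul]; simp
    rw [e1, inner_add_left, inner_smul_left, hee]
    have h1 := norm_sub_inner_smul_le he ξ
    have h2 : |inner ℝ ξ e| ≤ ‖ξ‖ := by
      have := abs_real_inner_le_norm ξ e
      rwa [he, mul_one] at this
    have h3 := neg_abs_le (inner ℝ ξ e)
    simp only [map_div₀, conj_trivial, mul_one]
    nlinarith [mul_le_mul_of_nonneg_left h1 hL]

/-- The part of `Ω` at distance less than `δ` from its complement. -/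
def strip (Ω : Set (Space d)) (δ : ℝ) : Set (Space d) := Ω ∩ thickening δ Ωᶜ

theorem measurableSet_strip (hΩ : IsOpen Ω) (δ : ℝ) : MeasurableSet (strip Ω δ) :=
  (hΩ.inter isOpen_thickening).measurableSet

/-- Moving a point of the strip by `-(1 + L) δ e` leaves `Ω`: otherwise the cone at the image would
cover the `δ`-ball of the point, which meets the complement. Hence the translates of the strip by
multiples of that step are disjoint, and `n` of them fit in the larger ball. -/
theorem ConeCondition.nat_mul_volume_strip_le {x₀ e : Space d} {r L : ℝ}
    (h : ConeCondition Ω x₀ e r L) (hΩ : IsOpen Ω) (he : ‖e‖ = 1) (hL : 0 ≤ L) {δ : ℝ} (hδ : 0 < δ)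
    (n : ℕ) (hn : n * ((1 + L) * δ) ≤ r / 2) (hr : (1 + L) * δ ≤ r / 4) :
    n * volume (strip Ω δ ∩ ball x₀ (r / 4)) ≤ volume (ball x₀ r) := by
  set A := strip Ω δ ∩ ball x₀ (r / 4) with hA
  set τ := (1 + L) * δ with hτ
  have hτ0 : 0 < τ := by positivity
  have hδτ : δ ≤ τ := by nlinarith
  have hAm : MeasurableSet A := (measurableSet_strip hΩ δ).inter measurableSet_ball
  have hee : inner ℝ e e = (1:ℝ) := by rw [real_inner_self_eq_norm_sq, he]; norm_num
  have hout : ∀ x ∈ A, x - τ • e ∉ Ω := by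
    rintro x ⟨⟨hxΩ, hx⟩, hxr⟩ hmem
    obtain ⟨y, hy, hxy⟩ := mem_thickening_iff.1 hx
    rw [mem_ball] at hxr
    have hb : x - τ • e ∈ ball x₀ r := by
      rw [mem_ball]
      have h1 : dist (x - τ • e) x = τ := by
        rw [dist_eq_norm]; simp [norm_smul, he, abs_of_pos hτ0]
      have := dist_triangle (x - τ • e) x x₀
      linarith
    have hyv : y = x - τ • e + (τ • e + (y - x)) := by abel
    refine hy ?_
    rw [hyv]
    refine h _ hb hmem _ ?_ ?_
    · rw [← hyv, mem_ball]
      have := dist_triangle y x x₀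
      rw [dist_comm] at hxy
      linarith
    · have e1 : τ • e + (y - x) - inner ℝ (τ • e + (y - x)) e • e =
          (y - x) - inner ℝ (y - x) e • e := by
        rw [inner_add_left, inner_smul_left, hee, add_smul]; simp
      have hn : ‖y - x‖ < δ := by rwa [dist_comm, dist_eq_norm] at hxy
      have h1 := norm_sub_inner_smul_le he (y - x)
      have h2 : |inner ℝ (y - x) e| ≤ ‖y - x‖ := by
        have := abs_real_inner_le_norm (y - x) e
        rwa [he, mul_one] at this
      have h3 := neg_abs_le (inner ℝ (y - x) e)
      rw [e1, inner_add_left, inner_smul_left, hee]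
      simp only [conj_trivial, mul_one]
      nlinarith [mul_le_mul_of_nonneg_left (h1.trans hn.le) hL]
  let T : ℕ → Set (Space d) := fun k => (fun z => z - (k * τ) • e) ⁻¹' A
  have hdisj : ∀ k k' : ℕ, k' < k → Disjoint (T k) (T k') := by
    intro k k' hk
    rw [Set.disjoint_left]
    intro z hz hz'
    refine hout _ hz' ?_
    have hkk : (0:ℝ) ≤ k - k' - 1 := by
      have : ((k' + 1 : ℕ) : ℝ) ≤ k := by exact_mod_cast hk
      push_cast at this; linarith
    have e1 : z - (k' * τ) • e - τ • e = z - (k * τ) • e + (((k:ℝ) - k' - 1) * τ) • e := by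
      module
    rw [e1]
    have hzr : dist (z - (k * τ) • e) x₀ < r / 4 := hz.2
    have hzr' : dist (z - (k' * τ) • e) x₀ < r / 4 := hz'.2
    refine h _ (by rw [mem_ball]; linarith [dist_nonneg.trans_lt hzr]) hz.1.1 _ ?_ ?_
    · rw [← e1, mem_ball]
      have h1 : dist (z - (k' * τ) • e - τ • e) (z - (k' * τ) • e) = τ := by
        rw [dist_eq_norm]; simp [norm_smul, he, abs_of_pos hτ0]
      have := dist_triangle (z - (k' * τ) • e - τ • e) (z - (k' * τ) • e) x₀
      linarith
    · rw [inner_smul_left, hee]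
      simp only [conj_trivial, mul_one, sub_self, norm_zero, mul_zero]
      positivity
  have hpair : (↑(Finset.range n) : Set ℕ).PairwiseDisjoint T := by
    intro k _ k' _ hkk
    rcases lt_or_gt_of_ne hkk with hlt | hlt
    · exact (hdisj k' k hlt).symm
    · exact hdisj k k' hlt
  have hTm : ∀ k, MeasurableSet (T k) := fun k => hAm.preimage (by fun_prop)
  have hTv : ∀ k, volume (T k) = volume A := fun k => by
    simp only [T, sub_eq_add_neg]
    exact measure_preimage_add_right _ _ _
  have hsub : (⋃ k ∈ Finset.range n, T k) ⊆ ball x₀ r := by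
    intro z hz
    simp only [mem_iUnion, Finset.mem_range] at hz
    obtain ⟨k, hk, hz⟩ := hz
    have hzr : dist (z - (k * τ) • e) x₀ < r / 4 := hz.2
    have h1 : dist z (z - (k * τ) • e) = k * τ := by
      rw [dist_eq_norm]
      simp [norm_smul, he, abs_of_pos hτ0]
    have h2 : (k:ℝ) * τ ≤ n * τ := by gcongr
    rw [mem_ball]
    have := dist_triangle z (z - (k * τ) • e) x₀
    linarith
  calc n * volume A = ∑ k ∈ Finset.range n, volume (T k) := by simp [hTv]
    _ = volume (⋃ k ∈ Finset.range n, T k) :=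
        (measure_biUnion_finset hpair fun k _ => hTm k).symm
    _ ≤ _ := measure_mono hsub

/-- Quantitative regularity of `Ω` in a neighbourhood of a part of its boundary. -/
def RegularNear (Ω U : Set (Space d)) (c C δ₀ : ℝ) : Prop :=
  (∀ δ, 0 < δ → δ ≤ δ₀ → volume (strip Ω δ ∩ U) ≤ ENNReal.ofReal (C * δ)) ∧
  ∀ x ∈ Ω ∩ U, ∀ η, 0 < η → η ≤ δ₀ → ENNReal.ofReal (c * η ^ d) ≤ volume (Ω ∩ ball x η)

theorem IsC2BoundedDomain.exists_regularNear_ball (hΩ : IsC2BoundedDomain Ω) {x₀ : Space d}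
    (hx₀ : x₀ ∈ frontier Ω) : ∃ r c C δ₀ : ℝ, 0 < r ∧ 0 < c ∧ 0 < C ∧ 0 < δ₀ ∧
      RegularNear Ω (ball x₀ r) c C δ₀ := by
  obtain ⟨e, r, L, he, hr, hL, hcone⟩ := hΩ.exists_coneCondition hx₀
  have hvb : volume (ball x₀ r) ≠ ⊤ := measure_ball_lt_top.ne
  set b := (volume (ball x₀ r)).toReal
  set b₁ := (volume (ball (0 : Space d) 1)).toReal
  have hb₁ : 0 < b₁ := ENNReal.toReal_pos (measure_ball_pos _ _ one_pos).ne' measure_ball_lt_top.ne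
  have hb : 0 < b := ENNReal.toReal_pos (measure_ball_pos _ _ hr).ne' hvb
  refine ⟨r / 4, (1 / (2 * (1 + L))) ^ d * b₁, b * (4 * (1 + L) / r), r / (4 * (1 + L)),
    by positivity, by positivity, by positivity, by positivity, fun δ hδ hδ0 => ?_,
    fun x hx η hη hη0 => ?_⟩
  · have hτ : (1 + L) * δ ≤ r / 4 := by
      rw [le_div_iff₀ (by positivity)] at hδ0; linarith
    have hτ0 : 0 < (1 + L) * δ := by positivity
    -- The number of translates that fit; rounding down still leaves `n (1 + L) δ ≥ r / 4`, so `1 /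
    -- n` is of order `δ`.
    set n := ⌊r / 2 / ((1 + L) * δ)⌋₊
    have hn1 : n * ((1 + L) * δ) ≤ r / 2 := by
      rw [← le_div_iff₀ hτ0]; exact Nat.floor_le (by positivity)
    have hn2 : r / 4 ≤ n * ((1 + L) * δ) := by
      have := Nat.lt_floor_add_one (r / 2 / ((1 + L) * δ))
      rw [div_lt_iff₀ hτ0] at this
      change r / 2 < ((n:ℝ) + 1) * _ at this
      linarith
    have hn0 : 0 < (n:ℝ) := by
      by_contra hneg
      have : (n:ℝ) * ((1 + L) * δ) ≤ 0 := mul_nonpos_of_nonpos_of_nonneg (not_lt.1 hneg) hτ0.le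
      linarith
    have h1 := hcone.nat_mul_volume_strip_le hΩ.isOpen he hL hδ n hn1 hτ
    have h2 : volume (strip Ω δ ∩ ball x₀ (r / 4)) ≤ ENNReal.ofReal (b / n) := by
      rw [ENNReal.ofReal_div_of_pos hn0, ENNReal.ofReal_toReal hvb, ENNReal.ofReal_natCast,
        ENNReal.le_div_iff_mul_le (.inl (by exact_mod_cast hn0.ne')) (.inl (by simp)), mul_comm]
      exact h1
    refine h2.trans (ENNReal.ofReal_le_ofReal ?_)
    rw [div_le_iff₀ hn0]
    have : 1 ≤ 4 * (1 + L) / r * δ * n := by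
      rw [div_mul_eq_mul_div, div_mul_eq_mul_div, le_div_iff₀ hr]; linarith
    nlinarith
  · have hη1 : η ≤ r / 2 := by
      refine hη0.trans ?_
      rw [div_le_div_iff₀ (by positivity) (by positivity)]
      nlinarith
    have hx' : x ∈ ball x₀ (r / 2) := ball_subset_ball (by linarith) hx.2
    refine le_trans (le_of_eq ?_) (measure_mono (hcone.ball_subset he hL hx' hx.1 hη hη1))
    have hpos : 0 < η / (2 * (1 + L)) := by positivity
    rw [Measure.addHaar_ball_of_pos _ _ hpos, finrank_euclideanSpace, Fintype.card_fin,
      ← ENNReal.ofReal_toReal (measure_ball_lt_top (x := (0 : Space d)) (r := 1)).ne,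
      ← ENNReal.ofReal_mul (by positivity)]
    congr 1
    rw [div_pow, div_pow]
    simp only [b₁]
    field_simp
    rw [one_pow, one_mul]

theorem RegularNear.union {U U' : Set (Space d)} {c C δ₀ c' C' δ₀' : ℝ}
    (h : RegularNear Ω U c C δ₀) (h' : RegularNear Ω U' c' C' δ₀') (hC : 0 < C) (hC' : 0 < C') :
    RegularNear Ω (U ∪ U') (min c c') (C + C') (min δ₀ δ₀') := by
  refine ⟨fun δ hδ hδ0 => ?_, ?_⟩
  · rw [inter_union_distrib_left, add_mul, ENNReal.ofReal_add (by positivity) (by positivity)]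
    exact (measure_union_le _ _).trans (add_le_add (h.1 δ hδ (hδ0.trans (min_le_left _ _)))
      (h'.1 δ hδ (hδ0.trans (min_le_right _ _))))
  · rintro x ⟨hxΩ, hx | hx⟩ η hη hη0
    · refine le_trans (ENNReal.ofReal_le_ofReal ?_) (h.2 x ⟨hxΩ, hx⟩ η hη
        (hη0.trans (min_le_left _ _)))
      gcongr; exact min_le_left _ _
    · refine le_trans (ENNReal.ofReal_le_ofReal ?_) (h'.2 x ⟨hxΩ, hx⟩ η hη
        (hη0.trans (min_le_right _ _)))
      gcongr; exact min_le_right _ _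

/-- Finitely many local estimates cover the compact frontier. What remains of the closure is a
compact subset of `Ω`, at positive distance from the complement, so thin strips do not meet it. -/
theorem IsC2BoundedDomain.exists_strip_regular (hΩ : IsC2BoundedDomain Ω) :
    ∃ c C δ₀ : ℝ, 0 < c ∧ 0 < C ∧ 0 < δ₀ ∧
      (∀ δ, 0 < δ → δ ≤ δ₀ → volume (strip Ω δ) ≤ ENNReal.ofReal (C * δ)) ∧
      ∀ x ∈ strip Ω δ₀, ∀ η, 0 < η → η ≤ δ₀ →
        ENNReal.ofReal (c * η ^ d) ≤ volume (Ω ∩ ball x η) := by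
  have hcl : IsCompact (closure Ω) := hΩ.isBounded.isCompact_closure
  have hfr : IsCompact (frontier Ω) := hcl.of_isClosed_subset isClosed_frontier
    frontier_subset_closure
  obtain ⟨U, hUo, hU, c, C, δ₀, hc, hC, hδ₀, hreg⟩ : ∃ U : Set (Space d), IsOpen U ∧
      frontier Ω ⊆ U ∧ ∃ c C δ₀ : ℝ, 0 < c ∧ 0 < C ∧ 0 < δ₀ ∧ RegularNear Ω U c C δ₀ := by
    refine hfr.induction_on (p := fun s => ∃ U : Set (Space d), IsOpen U ∧
      s ⊆ U ∧ ∃ c C δ₀ : ℝ, 0 < c ∧ 0 < C ∧ 0 < δ₀ ∧ RegularNear Ω U c C δ₀) ?_ ?_ ?_ ?_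
    · exact ⟨∅, isOpen_empty, subset_rfl, 1, 1, 1, one_pos, one_pos, one_pos, by simp, by simp⟩
    · rintro s t hst ⟨U, h1, h2, h3⟩
      exact ⟨U, h1, hst.trans h2, h3⟩
    · rintro s t ⟨U, h1, h2, c, C, δ, hc, hC, hδ, h⟩ ⟨U', h1', h2', c', C', δ', hc', hC', hδ', h'⟩
      exact ⟨U ∪ U', h1.union h1', union_subset_union h2 h2', _, _, _, lt_min hc hc',
        add_pos hC hC', lt_min hδ hδ', h.union h' hC hC'⟩
    · intro x hx
      obtain ⟨r, c, C, δ, hr, hc, hC, hδ, h⟩ := hΩ.exists_regularNear_ball hx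
      exact ⟨ball x r, mem_nhdsWithin_of_mem_nhds (ball_mem_nhds x hr), ball x r, isOpen_ball,
        subset_rfl, c, C, δ, hc, hC, hδ, h⟩
  have hK : IsCompact (closure Ω \ U) := hcl.diff hUo
  have hKΩ : closure Ω \ U ⊆ Ω := fun x hx => by
    by_contra hxΩ
    exact hx.2 (hU ⟨hx.1, by rwa [hΩ.isOpen.interior_eq]⟩)
  obtain ⟨ε, hε, hKε⟩ := hK.exists_thickening_subset_open hΩ.isOpen hKΩ
  have hstrip : strip Ω ε ⊆ U := by
    rintro x ⟨hxΩ, hx⟩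
    by_contra hxU
    obtain ⟨y, hy, hxy⟩ := mem_thickening_iff.1 hx
    exact hy (hKε (mem_thickening_iff.2 ⟨x, ⟨subset_closure hxΩ, hxU⟩, by rwa [dist_comm]⟩))
  have hmono : ∀ {δ}, δ ≤ ε → strip Ω δ ⊆ U := fun h =>
    (inter_subset_inter_right _ (thickening_mono h _)).trans hstrip
  refine ⟨c, C, min δ₀ ε, hc, hC, lt_min hδ₀ hε, fun δ hδ hδ0 => ?_, fun x hx η hη hη0 => ?_⟩
  · rw [← inter_eq_left.2 (hmono (hδ0.trans (min_le_right _ _)))]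
    exact hreg.1 δ hδ (hδ0.trans (min_le_left _ _))
  · exact hreg.2 x ⟨hx.1, hmono (min_le_right _ _) hx⟩ η hη (hη0.trans (min_le_left _ _))

end Geometry

/-! ### Mollification -/

section Mollification

open Filter Topology Metric

variable {d : ℕ} {Ω : Set (Space d)}

/-- `ψ` is a mollifier at scale `δ`, with size controlled by `A` and slope by `L`. -/
structure IsMollifier (A L δ : ℝ) (ψ : Space d → ℝ) : Prop where
  contDiff : ContDiff ℝ ∞ ψ
  zero_of_le : ∀ x, δ ≤ ‖x‖ → ψ x = 0
  integral_eq : ∫ x, ψ x = 1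
  abs_le : ∀ x, |ψ x| ≤ A / δ ^ d
  lipschitz : ∀ x y, |ψ x - ψ y| ≤ L / δ ^ (d + 1) * ‖x - y‖

theorem exists_isMollifier (d : ℕ) : ∃ A L : ℝ, 0 < A ∧ 0 ≤ L ∧ ∀ δ : ℝ, 0 < δ →
    ∃ ψ : Space d → ℝ, IsMollifier A L δ ψ := by
  let b : ContDiffBump (0 : Space d) := ⟨1 / 2, 1, by norm_num, by norm_num⟩
  have hc : ContDiff ℝ ∞ (b.normed volume) := b.contDiff_normed
  have hcs : HasCompactSupport (b.normed volume) := b.hasCompactSupport_normed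
  obtain ⟨A, hA⟩ := hc.continuous.bounded_above_of_compact_support hcs
  obtain ⟨L, hL⟩ := hc.lipschitzWith_of_hasCompactSupport hcs (by simp)
  refine ⟨max A 1, L, by positivity, L.2, fun δ hδ =>
    ⟨fun x => (δ ^ d)⁻¹ * b.normed volume (δ⁻¹ • x), ?_, ?_, ?_, ?_, ?_⟩⟩
  · exact contDiff_const.mul (hc.comp (contDiff_const_smul _))
  · intro x hx
    have : δ⁻¹ • x ∉ Function.support (b.normed volume) := by
      rw [b.support_normed_eq, mem_ball_zero_iff, norm_smul, norm_inv, Real.norm_of_nonneg hδ.le,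
        not_lt]
      change 1 ≤ _
      rw [← div_eq_inv_mul, le_div_iff₀ hδ, one_mul]
      exact hx
    rw [Function.notMem_support.1 this, mul_zero]
  · rw [integral_const_mul, Measure.integral_comp_inv_smul_of_nonneg _ _ hδ.le, b.integral_normed,
      finrank_euclideanSpace, Fintype.card_fin, smul_eq_mul, mul_one,
      inv_mul_cancel₀ (by positivity)]
  · intro x
    rw [abs_mul, abs_of_pos (by positivity), div_eq_inv_mul]
    gcongr
    exact (hA _).trans (le_max_left _ _)
  · intro x y
    have h1 := hL.dist_le_mul (δ⁻¹ • x) (δ⁻¹ • y)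
    rw [Real.dist_eq, dist_eq_norm, ← smul_sub, norm_smul, norm_inv, Real.norm_of_nonneg hδ.le]
      at h1
    rw [← mul_sub, abs_mul, abs_of_pos (by positivity)]
    calc _ ≤ (δ ^ d)⁻¹ * (L * (δ⁻¹ * ‖x - y‖)) := by gcongr
      _ = _ := by rw [pow_succ]; field_simp

theorem IsMollifier.hasCompactSupport {A L δ : ℝ} {ψ : Space d → ℝ} (h : IsMollifier A L δ ψ) :
    HasCompactSupport ψ :=
  HasCompactSupport.intro (isCompact_closedBall (0 : Space d) δ) fun x hx => h.zero_of_le x <| by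
    rw [mem_closedBall_zero_iff, not_le] at hx; exact hx.le

/-- The mollification of `g` by `ψ`. -/
def mollify (ψ g : Space d → ℝ) (x : Space d) : ℝ := ∫ y, g y * ψ (x - y)

theorem mollify_eq_convolution (ψ g : Space d → ℝ) :
    mollify ψ g = convolution g ψ (ContinuousLinearMap.mul ℝ ℝ) volume := rfl

theorem IsMollifier.integrable_mul {A L δ : ℝ} {ψ g : Space d → ℝ} (h : IsMollifier A L δ ψ)
    (hg : Integrable g) (x : Space d) : Integrable fun y => g y * ψ (x - y) :=
  hg.mul_bdd (c := A / δ ^ d)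
    (h.contDiff.continuous.comp (continuous_const.sub continuous_id)).aestronglyMeasurable
    (.of_forall fun _ => h.abs_le _)

theorem IsMollifier.contDiff_mollify {A L δ : ℝ} {ψ g : Space d → ℝ} (h : IsMollifier A L δ ψ)
    (hg : Integrable g) : ContDiff ℝ ∞ (mollify ψ g) := by
  rw [mollify_eq_convolution]
  exact h.hasCompactSupport.contDiff_convolution_right _ hg.locallyIntegrable h.contDiff

theorem IsMollifier.abs_mollify_le {A L δ : ℝ} {ψ g : Space d → ℝ} (h : IsMollifier A L δ ψ)
    (hg : Integrable g) (x : Space d) : |mollify ψ g x| ≤ A / δ ^ d * ∫ y, |g y| := by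
  rw [← integral_const_mul, ← Real.norm_eq_abs, mollify]
  refine norm_integral_le_of_norm_le (hg.abs.const_mul _) (.of_forall fun y => ?_)
  rw [Real.norm_eq_abs, abs_mul, mul_comm]
  gcongr
  exact h.abs_le _

theorem IsMollifier.abs_partialDeriv_mollify_le {A L δ : ℝ} {ψ g : Space d → ℝ}
    (h : IsMollifier A L δ ψ) (hg : Integrable g) (hL : 0 ≤ L) (hδ : 0 < δ) (i : Fin d)
    (x : Space d) : |partialDeriv i (mollify ψ g) x| ≤ L / δ ^ (d + 1) * ∫ y, |g y| := by
  have hI : 0 ≤ ∫ y, |g y| := integral_nonneg fun _ => abs_nonneg _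
  have hlip : LipschitzWith (Real.toNNReal (L / δ ^ (d + 1) * ∫ y, |g y|)) (mollify ψ g) := by
    refine LipschitzWith.of_dist_le_mul fun x z => ?_
    rw [Real.coe_toNNReal _ (by positivity), Real.dist_eq, dist_eq_norm, mollify, mollify,
      ← integral_sub (h.integrable_mul hg x) (h.integrable_mul hg z), mul_right_comm,
      ← integral_const_mul, ← Real.norm_eq_abs]
    refine norm_integral_le_of_norm_le (hg.abs.const_mul _) (.of_forall fun y => ?_)
    rw [← mul_sub, Real.norm_eq_abs, abs_mul, mul_comm]
    gcongr
    refine (h.lipschitz _ _).trans_eq ?_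
    rw [sub_sub_sub_cancel_right]
  have h1 := norm_fderiv_le_of_lipschitz ℝ hlip (x₀ := x)
  rw [Real.coe_toNNReal _ (by positivity)] at h1
  have h2 := (fderiv ℝ (mollify ψ g) x).le_opNorm (EuclideanSpace.single i 1)
  rw [PiLp.norm_single, norm_one, mul_one] at h2
  exact h2.trans h1

theorem IsMollifier.tsupport_mollify_subset {A L δ : ℝ} {ψ g : Space d → ℝ}
    (h : IsMollifier A L δ ψ) {K : Set (Space d)} (hK : ∀ y ∉ K, g y = 0) :
    tsupport (mollify ψ g) ⊆ cthickening δ K := by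
  refine closure_minimal (fun x hx => ?_) isClosed_cthickening
  by_contra hxK
  refine hx ?_
  rw [mollify, ← integral_zero (Space d) ℝ (μ := volume)]
  congr 1; ext y
  by_cases hy : y ∈ K
  · rw [h.zero_of_le, mul_zero]
    by_contra hlt
    exact hxK (mem_cthickening_of_dist_le x y δ K hy (by rw [dist_eq_norm]; exact (not_le.1 hlt).le))
  · rw [hK y hy, zero_mul]

theorem lintegral_sq_le_measure_mul {X : Type*} [MeasurableSpace X] {μ : Measure X} {F : X → ℝ}
    (hF : AEStronglyMeasurable F μ) :
    (∫⁻ x, ‖F x‖ₑ ∂μ) ^ 2 ≤ (∫⁻ x, ENNReal.ofReal (|F x| ^ 2) ∂μ) * μ univ := by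
  have h := eLpNorm_le_eLpNorm_mul_rpow_measure_univ (p := 1) (q := 2) (by norm_num) hF
  rw [eLpNorm_one_eq_lintegral_enorm] at h
  have e : eLpNorm F 2 μ ^ 2 = ∫⁻ x, ENNReal.ofReal (|F x| ^ 2) ∂μ := by
    have := eLpNorm_nnreal_pow_eq_lintegral (f := F) (μ := μ) (p := 2) (by norm_num)
    simp only [NNReal.coe_ofNat, ENNReal.rpow_ofNat, ENNReal.coe_ofNat] at this
    rw [this]
    refine lintegral_congr fun x => ?_
    rw [← Real.norm_eq_abs, ENNReal.ofReal_pow (norm_nonneg _), ofReal_norm]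
  calc _ ≤ (eLpNorm F 2 μ * μ univ ^ (1 / (1 : ℝ≥0∞).toReal - 1 / (2 : ℝ≥0∞).toReal)) ^ 2 := by
        gcongr
    _ = _ := by
        rw [mul_pow, e, ← ENNReal.rpow_mul_natCast]
        norm_num

/-- Since `ψ` has integral one, the difference is an integral of `r - g y` against `ψ` over a ball,
and Cauchy–Schwarz applies. -/
theorem IsMollifier.ofReal_sub_mollify_le {A L δ : ℝ} {ψ g : Space d → ℝ} (h : IsMollifier A L δ ψ)
    (hA : 0 ≤ A) (hδ : 0 < δ) (hg : Integrable g) (x : Space d) (r : ℝ) :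
    ENNReal.ofReal (|r - mollify ψ g x| ^ 2) ≤ ENNReal.ofReal ((A / δ ^ d) ^ 2) *
      ((∫⁻ y in ball x δ, ENNReal.ofReal (|r - g y| ^ 2)) * volume (ball x δ)) := by
  have hψi : Integrable fun y => ψ (x - y) :=
    (h.contDiff.continuous.integrable_of_hasCompactSupport h.hasCompactSupport).comp_sub_left x
  have e1 : r - mollify ψ g x = ∫ y, (r - g y) * ψ (x - y) := by
    have : ∫ y, r * ψ (x - y) = r := by
      rw [integral_const_mul, integral_sub_left_eq_self, h.integral_eq, mul_one]
    simp only [sub_mul]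
    rw [integral_sub (hψi.const_mul r) (h.integrable_mul hg x), this, mollify]
  have h1 : ‖r - mollify ψ g x‖ₑ ≤
      ENNReal.ofReal (A / δ ^ d) * ∫⁻ y in ball x δ, ‖r - g y‖ₑ := by
    rw [e1, ← lintegral_const_mul' _ _ ENNReal.ofReal_ne_top, ← lintegral_indicator measurableSet_ball]
    refine (enorm_integral_le_lintegral_enorm _).trans (lintegral_mono fun y => ?_)
    by_cases hy : y ∈ ball x δ
    · rw [indicator_of_mem hy, enorm_mul, mul_comm]
      gcongr
      rw [← ofReal_norm]
      exact ENNReal.ofReal_le_ofReal (h.abs_le _)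
    · rw [indicator_of_notMem hy, h.zero_of_le, mul_zero, enorm_zero]
      rwa [mem_ball, not_lt, dist_comm, dist_eq_norm] at hy
  calc _ = ‖r - mollify ψ g x‖ₑ ^ 2 := by
        rw [← Real.norm_eq_abs, ENNReal.ofReal_pow (norm_nonneg _), ofReal_norm]
    _ ≤ (ENNReal.ofReal (A / δ ^ d) * ∫⁻ y in ball x δ, ‖r - g y‖ₑ) ^ 2 := by gcongr
    _ ≤ _ := by
        rw [mul_pow, ← ENNReal.ofReal_pow (by positivity)]
        gcongr
        refine (lintegral_sq_le_measure_mul ?_).trans_eq (by rw [Measure.restrict_apply_univ])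
        exact (aestronglyMeasurable_const.sub hg.1).restrict

/-- The mean square oscillation of `u` at `x`, at scale `h`. -/
def localEnergy (u : L2 Ω) (h : ℝ) (x : Space d) : ℝ≥0∞ :=
  ∫⁻ y in Ω ∩ ball x h, ENNReal.ofReal (|u x - u y| ^ 2)

/-- For `|x - y| ≤ h` the Gagliardo weight is at least `h^(-(d + 2s))`. -/
theorem lintegral_localEnergy_le (hΩ : IsOpen Ω) (u : L2 Ω) {h s : ℝ} (hh : 0 < h) (hs : 0 < s) :
    ∫⁻ x in Ω, localEnergy u h x ≤ ENNReal.ofReal (h ^ ((d : ℝ) + 2 * s)) * gagliardoSq s u := by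
  have he : 0 < (d : ℝ) + 2 * s := by positivity
  rw [gagliardoSq, ← lintegral_const_mul' _ _ ENNReal.ofReal_ne_top]
  refine lintegral_mono fun x => ?_
  rw [← lintegral_const_mul' _ _ ENNReal.ofReal_ne_top]
  refine (setLIntegral_mono' (hΩ.measurableSet.inter measurableSet_ball) fun y hy => ?_).trans
    (lintegral_mono_set inter_subset_left)
  rw [← ENNReal.ofReal_mul (by positivity)]
  refine ENNReal.ofReal_le_ofReal ?_
  rcases eq_or_ne x y with rfl | hxy
  · simp
  · have h0 : 0 < ‖x - y‖ := norm_pos_iff.2 (sub_ne_zero.2 hxy)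
    have h1 : ‖x - y‖ ≤ h := by
      have := hy.2
      rw [mem_ball, dist_comm, dist_eq_norm] at this
      exact this.le
    have h2 : ‖x - y‖ ^ ((d : ℝ) + 2 * s) ≤ h ^ ((d : ℝ) + 2 * s) := by gcongr
    rw [mul_div_assoc', le_div_iff₀ (by positivity), mul_comm]
    gcongr

/-- The inequality `|u x|² ≤ 2 |u x - u y|² + 2 |u y|²` is averaged over `y` in `Ω ∩ ball x h`. The
mass in `S` is then bounded by the seminorm and by the volume of `S` times the total mass, without
any Hardy inequality. -/
theorem lintegral_sq_strip_le (hΩ : IsOpen Ω) (u : L2 Ω) {h s m : ℝ} (hh : 0 < h) (hs : 0 < s)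
    {S : Set (Space d)} (hSΩ : S ⊆ Ω) (hSm : MeasurableSet S)
    (hm : ∀ x ∈ S, ENNReal.ofReal m ≤ volume (Ω ∩ ball x h)) :
    ENNReal.ofReal m * ∫⁻ x in S, ENNReal.ofReal (|u x| ^ 2) ≤
      2 * (ENNReal.ofReal (h ^ ((d : ℝ) + 2 * s)) * gagliardoSq s u) +
      2 * ((∫⁻ x in Ω, ENNReal.ofReal (|u x| ^ 2)) * volume S) := by
  have hum : Measurable u := (Lp.stronglyMeasurable u).measurable
  have key : ∀ x ∈ S, ENNReal.ofReal m * ENNReal.ofReal (|u x| ^ 2) ≤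
      2 * localEnergy u h x + 2 * ∫⁻ y in Ω, ENNReal.ofReal (|u y| ^ 2) := by
    intro x hx
    calc _ ≤ ENNReal.ofReal (|u x| ^ 2) * volume (Ω ∩ ball x h) := by
          rw [mul_comm]; gcongr; exact hm x hx
      _ = ∫⁻ y in Ω ∩ ball x h, ENNReal.ofReal (|u x| ^ 2) := by rw [setLIntegral_const]
      _ ≤ ∫⁻ y in Ω ∩ ball x h, (2 * ENNReal.ofReal (|u x - u y| ^ 2) +
            2 * ENNReal.ofReal (|u y| ^ 2)) := by
          refine lintegral_mono fun y => ?_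
          have e2 : (2 : ℝ≥0∞) = ENNReal.ofReal 2 := by simp
          simp only [e2]
          rw [← ENNReal.ofReal_mul (by norm_num),
            ← ENNReal.ofReal_mul (by norm_num), ← ENNReal.ofReal_add (by positivity) (by positivity)]
          refine ENNReal.ofReal_le_ofReal ?_
          simp only [sq_abs]
          nlinarith [sq_nonneg (u x - u y - u y)]
      _ = 2 * localEnergy u h x + 2 * ∫⁻ y in Ω ∩ ball x h, ENNReal.ofReal (|u y| ^ 2) := by
          rw [lintegral_add_right _ (by fun_prop), lintegral_const_mul' _ _ (by simp),
            lintegral_const_mul' _ _ (by simp), localEnergy]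
      _ ≤ _ := by
          gcongr
          exact inter_subset_left
  rw [← lintegral_const_mul' _ _ ENNReal.ofReal_ne_top]
  refine (setLIntegral_mono' hSm key).trans ?_
  rw [lintegral_add_right _ measurable_const, lintegral_const_mul' _ _ (by simp),
    lintegral_const, Measure.restrict_apply_univ, mul_assoc]
  gcongr
  exact (lintegral_mono_set hSΩ).trans (lintegral_localEnergy_le hΩ u hh hs)

/-- Before mollifying, `u` is cut off within distance `2δ` of the complement. The cut-off is felt at
`x` only if the `δ`-ball of `x` reaches that zone, which puts `x` in the strip of width `3δ`;
elsewhere the error is the local oscillation. -/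
theorem IsMollifier.lintegral_sub_mollify_le {A L δ : ℝ} {ψ : Space d → ℝ} (h : IsMollifier A L δ ψ)
    (hA : 0 ≤ A) (hδ : 0 < δ) (hΩ : IsOpen Ω) (u : L2 Ω)
    (hg : Integrable ((Ω \ thickening (2 * δ) Ωᶜ).indicator u)) :
    ∫⁻ x in Ω, ENNReal.ofReal (|u x - mollify ψ ((Ω \ thickening (2 * δ) Ωᶜ).indicator u) x| ^ 2) ≤
      ENNReal.ofReal ((A / δ ^ d) ^ 2) * (((∫⁻ x in Ω, localEnergy u δ x) +
        (∫⁻ x in strip Ω (3 * δ), ENNReal.ofReal (|u x| ^ 2)) * volume (ball (0 : Space d) δ)) *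
        volume (ball (0 : Space d) δ)) := by
  have hum : Measurable u := (Lp.stronglyMeasurable u).measurable
  set K := Ω \ thickening (2 * δ) Ωᶜ
  set S := strip Ω (3 * δ)
  have hSm : MeasurableSet S := measurableSet_strip hΩ _
  set b := volume (ball (0 : Space d) δ)
  have hb : ∀ x : Space d, volume (ball x δ) = b := fun x =>
    Measure.addHaar_ball_center volume x δ
  have hb' : b ≠ ⊤ := measure_ball_lt_top.ne
  have key : ∀ x ∈ Ω, ∫⁻ y in ball x δ, ENNReal.ofReal (|u x - K.indicator u y| ^ 2) ≤
      localEnergy u δ x + S.indicator (fun x => ENNReal.ofReal (|u x| ^ 2)) x * b := by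
    intro x hx
    calc _ ≤ ∫⁻ y in ball x δ, (Ω.indicator (fun y => ENNReal.ofReal (|u x - u y| ^ 2)) y +
          S.indicator (fun x => ENNReal.ofReal (|u x| ^ 2)) x) := by
          refine setLIntegral_mono' measurableSet_ball fun y hy => ?_
          by_cases hyK : y ∈ K
          · rw [indicator_of_mem hyK, indicator_of_mem hyK.1]
            exact le_self_add
          · have hxS : x ∈ S := by
              refine ⟨hx, mem_thickening_iff.2 ?_⟩
              rw [mem_ball, dist_comm] at hy
              by_cases hyΩ : y ∈ Ω
              · obtain ⟨z, hz, hyz⟩ := mem_thickening_iff.1 (not_not.1 fun hn => hyK ⟨hyΩ, hn⟩)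
                exact ⟨z, hz, by linarith [dist_triangle x y z]⟩
              · exact ⟨y, hyΩ, by linarith⟩
            rw [indicator_of_notMem hyK, indicator_of_mem hxS, sub_zero]
            exact le_add_self
      _ = _ := by
          rw [lintegral_add_right _ measurable_const, lintegral_indicator hΩ.measurableSet,
            Measure.restrict_restrict hΩ.measurableSet, lintegral_const,
            Measure.restrict_apply_univ, hb, localEnergy]
  calc _ ≤ ∫⁻ x in Ω, ENNReal.ofReal ((A / δ ^ d) ^ 2) *
        ((localEnergy u δ x + S.indicator (fun x => ENNReal.ofReal (|u x| ^ 2)) x * b) * b) := by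
        refine setLIntegral_mono' hΩ.measurableSet fun x hx => ?_
        refine (h.ofReal_sub_mollify_le hA hδ hg x (u x)).trans ?_
        rw [hb]
        gcongr
        exact key x hx
    _ = _ := by
        have hm : Measurable (S.indicator fun x => ENNReal.ofReal (|u x| ^ 2)) :=
          Measurable.indicator (by fun_prop) hSm
        rw [lintegral_const_mul' _ _ ENNReal.ofReal_ne_top, lintegral_mul_const' _ _ hb',
          lintegral_add_right _ (hm.mul_const b), lintegral_mul_const' _ _ hb',
          lintegral_indicator hSm, Measure.restrict_restrict hSm,
          inter_eq_left.2 (show S ⊆ Ω from inter_subset_left)]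

end Mollification

/-! ### Approximation of `H^s` functions by `H¹₀` functions. -/

section Approximation

open Filter Topology Metric

variable {d : ℕ} {Ω : Set (Space d)}

theorem lintegral_sq_eq (u : L2 Ω) :
    ∫⁻ x in Ω, ENNReal.ofReal (|u x| ^ 2) = ENNReal.ofReal (‖u‖ ^ 2) := by
  rw [← real_inner_self_eq_norm_sq, inner_L2, ofReal_integral_eq_lintegral_ofReal]
  · simp [← sq]
  · exact (Lp.memLp u).integrable_mul (Lp.memLp u)
  · exact .of_forall fun x => mul_self_nonneg _

theorem integral_abs_le (hb : Bornology.IsBounded Ω) (u : L2 Ω) :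
    Integrable u (volume.restrict Ω) ∧
      ∫ x in Ω, |u x| ≤ Real.sqrt (volume Ω).toReal * ‖u‖ := by
  have hvol : volume Ω < ⊤ := hb.measure_lt_top
  have : IsFiniteMeasure (volume.restrict Ω) := ⟨by rwa [Measure.restrict_apply_univ]⟩
  have hi : Integrable u (volume.restrict Ω) := (Lp.memLp u).integrable (by norm_num)
  refine ⟨hi, ?_⟩
  have h1 := lintegral_sq_le_measure_mul hi.1
  rw [lintegral_sq_eq, Measure.restrict_apply_univ] at h1
  have h2 := ENNReal.toReal_mono (ENNReal.mul_ne_top ENNReal.ofReal_ne_top hvol.ne) h1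
  rw [ENNReal.toReal_pow, ENNReal.toReal_mul, ENNReal.toReal_ofReal (by positivity),
    ← integral_norm_eq_lintegral_enorm hi.1] at h2
  refine (Real.le_sqrt (integral_nonneg fun _ => abs_nonneg _)
    (by positivity)).2 h2 |>.trans_eq ?_
  rw [Real.sqrt_mul (by positivity), Real.sqrt_sq (norm_nonneg _), mul_comm]

theorem norm_le_of_abs_le (hb : Bornology.IsBounded Ω) {u : L2 Ω} {D : ℝ} (hD : 0 ≤ D)
    (h : ∀ᵐ x ∂volume.restrict Ω, |u x| ≤ D) : ‖u‖ ≤ Real.sqrt (volume Ω).toReal * D := by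
  have hvol : volume Ω < ⊤ := hb.measure_lt_top
  have h1 : ENNReal.ofReal (‖u‖ ^ 2) ≤ ENNReal.ofReal (D ^ 2 * (volume Ω).toReal) := by
    rw [← lintegral_sq_eq, ENNReal.ofReal_mul (by positivity), ENNReal.ofReal_toReal hvol.ne,
      ← setLIntegral_const]
    refine lintegral_mono_ae (h.mono fun x hx => ?_)
    exact ENNReal.ofReal_le_ofReal (by gcongr)
  rw [ENNReal.ofReal_le_ofReal_iff (by positivity)] at h1
  refine (Real.le_sqrt (norm_nonneg _) (by positivity)).2 h1 |>.trans_eq ?_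
  rw [Real.sqrt_mul (by positivity), Real.sqrt_sq hD, mul_comm]

theorem norm_sub_le_of_lintegral_le {u w : L2 Ω} {φ : Space d → ℝ}
    (hw : w =ᵐ[volume.restrict Ω] φ) {X : ℝ} (hX : 0 ≤ X)
    (h : ∫⁻ x in Ω, ENNReal.ofReal (|u x - φ x| ^ 2) ≤ ENNReal.ofReal X) :
    ‖u - w‖ ≤ Real.sqrt X := by
  refine (Real.le_sqrt (norm_nonneg _) hX).2 ?_
  rw [← ENNReal.ofReal_le_ofReal_iff hX, ← lintegral_sq_eq]
  refine le_of_eq_of_le (lintegral_congr_ae ?_) h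
  filter_upwards [Lp.coeFn_sub u w, hw] with x h1 h2
  rw [h1, Pi.sub_apply, h2]

theorem norm_sq_eq_H10 (w : H10 Ω) : ‖w‖ ^ 2 = ‖w.1.fst‖ ^ 2 + ∑ i, ‖w.1.snd i‖ ^ 2 := by
  have e : ‖w‖ ^ 2 = ‖w.1.fst‖ ^ 2 + ‖w.1.snd‖ ^ 2 := WithLp.prod_norm_sq_eq_of_L2 w.1
  rw [e, PiLp.norm_sq_eq_of_L2]

/-- Test functions at distance `δ` from the boundary approximate the mollification of `u`. -/
theorem IsMollifier.exists_H10 {A L δ : ℝ} {ψ : Space d → ℝ} (h : IsMollifier A L δ ψ)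
    (hA : 0 ≤ A) (hL : 0 ≤ L) (hδ : 0 < δ) (hδ1 : δ ≤ 1) (hΩ : IsOpen Ω)
    (hb : Bornology.IsBounded Ω) (u : L2 Ω) :
    ∃ w : H10 Ω, ‖w‖ ≤ (d + 1) * ((A + L) * (volume Ω).toReal) * ‖u‖ * δ ^ (-((d : ℝ) + 1)) ∧
      ∀ X : ℝ, 0 ≤ X → ENNReal.ofReal ((A / δ ^ d) ^ 2) * (((∫⁻ x in Ω, localEnergy u δ x) +
        (∫⁻ x in strip Ω (3 * δ), ENNReal.ofReal (|u x| ^ 2)) * volume (ball (0 : Space d) δ)) *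
        volume (ball (0 : Space d) δ)) ≤ ENNReal.ofReal X → ‖u - w.1.fst‖ ≤ Real.sqrt X := by
  set K := Ω \ thickening (2 * δ) Ωᶜ
  have hKm : MeasurableSet K := hΩ.measurableSet.diff isOpen_thickening.measurableSet
  obtain ⟨hui, hub⟩ := integral_abs_le hb u
  have hg : Integrable (K.indicator u) :=
    (integrable_indicator_iff hKm).2 (hui.mono_measure (Measure.restrict_mono_set _ sdiff_subset))
  set I := ∫ y, |K.indicator u y|
  have hI0 : 0 ≤ I := integral_nonneg fun _ => abs_nonneg _
  have hI : I ≤ Real.sqrt (volume Ω).toReal * ‖u‖ := by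
    refine le_trans ?_ hub
    have e : (fun y => |K.indicator u y|) = K.indicator fun y => |u y| := by
      ext y
      by_cases hy : y ∈ K
      · simp [hy]
      · simp [hy]
    simp only [I, e]
    rw [integral_indicator hKm]
    exact setIntegral_mono_set hui.abs (.of_forall fun _ => abs_nonneg _)
      sdiff_subset.eventuallyLE
  have hts : tsupport (mollify ψ (K.indicator u)) ⊆ cthickening δ K :=
    h.tsupport_mollify_subset fun y hy => indicator_of_notMem hy _
  -- Mollification spreads the support by `δ`, and the cut-off left a margin of `2δ`.
  have hsub : tsupport (mollify ψ (K.indicator u)) ⊆ Ω := by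
    refine hts.trans ((cthickening_subset_thickening' (by linarith : 0 < 2 * δ) (by linarith) K).trans ?_)
    intro x hx
    by_contra hxΩ
    obtain ⟨y, hy, hxy⟩ := mem_thickening_iff.1 hx
    exact hy.2 (mem_thickening_iff.2 ⟨x, hxΩ, by rwa [dist_comm]⟩)
  have hcs : HasCompactSupport (mollify ψ (K.indicator u)) :=
    (hb.subset hsub).isCompact_closure.of_isClosed_subset (isClosed_tsupport _) subset_closure
  obtain ⟨w, hw1, hw2⟩ := exists_testGraph (h.contDiff_mollify hg) hcs hsub
  refine ⟨w, ?_, fun X hX hle => norm_sub_le_of_lintegral_le hw1 hX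
    ((h.lintegral_sub_mollify_le hA hδ hΩ u hg).trans hle)⟩
  set D := (A + L) / δ ^ (d + 1) * I
  have hD : 0 ≤ D := by positivity
  have hd1 : A / δ ^ d ≤ (A + L) / δ ^ (d + 1) := by
    refine div_le_div₀ (by positivity) (by linarith) (by positivity) ?_
    exact pow_le_pow_of_le_one hδ.le hδ1 (Nat.le_succ d)
  have hd2 : L / δ ^ (d + 1) ≤ (A + L) / δ ^ (d + 1) := by gcongr; linarith
  have n1 : ‖w.1.fst‖ ≤ Real.sqrt (volume Ω).toReal * D := by
    refine norm_le_of_abs_le hb hD (hw1.mono fun x hx => ?_)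
    rw [hx]
    exact (h.abs_mollify_le hg x).trans (by simp only [D]; gcongr)
  have n2 : ∀ i, ‖w.1.snd i‖ ≤ Real.sqrt (volume Ω).toReal * D := fun i => by
    refine norm_le_of_abs_le hb hD ((hw2 i).mono fun x hx => ?_)
    rw [hx]
    exact (h.abs_partialDeriv_mollify_le hg hL hδ i x).trans (by simp only [D]; gcongr)
  set E := Real.sqrt (volume Ω).toReal * D
  have hE : 0 ≤ E := by positivity
  have h1 : ‖w‖ ^ 2 ≤ ((d + 1) * E) ^ 2 := by
    rw [norm_sq_eq_H10]
    calc _ ≤ E ^ 2 + ∑ _i : Fin d, E ^ 2 := by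
          gcongr with i
          exact n2 i
      _ = (d + 1) * E ^ 2 := by simp; ring
      _ ≤ _ := by
          have h0 : (0:ℝ) ≤ d := Nat.cast_nonneg d
          nlinarith [mul_nonneg h0 (sq_nonneg E), mul_nonneg (mul_nonneg h0 h0) (sq_nonneg E)]
  have h2 : ‖w‖ ≤ (d + 1) * E := abs_le_of_sq_le_sq' h1 (by positivity) |>.2
  refine h2.trans ?_
  have hE' : E ≤ (A + L) / δ ^ (d + 1) * ((volume Ω).toReal * ‖u‖) := by
    calc E ≤ Real.sqrt (volume Ω).toReal * ((A + L) / δ ^ (d + 1) *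
          (Real.sqrt (volume Ω).toReal * ‖u‖)) := by simp only [E, D]; gcongr
      _ = (A + L) / δ ^ (d + 1) * (Real.sqrt (volume Ω).toReal * Real.sqrt (volume Ω).toReal
          * ‖u‖) := by ring
      _ = _ := by rw [Real.mul_self_sqrt ENNReal.toReal_nonneg]
  have hpow : δ ^ (-((d : ℝ) + 1)) = (δ ^ (d + 1))⁻¹ := by
    rw [Real.rpow_neg hδ.le]; norm_cast
  calc _ ≤ (d + 1) * ((A + L) / δ ^ (d + 1) * ((volume Ω).toReal * ‖u‖)) := by gcongr
    _ = _ := by rw [hpow]; ring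

theorem rpow_le_rpow_of_le_one {δ a b : ℝ} (h0 : 0 < δ) (h1 : δ ≤ 1) (hab : a ≤ b) :
    δ ^ b ≤ δ ^ a := Real.rpow_le_rpow_of_exponent_ge h0 h1 hab

/-- The mass of a function of `H^s(Ω)` in a boundary strip. -/
theorem IsC2BoundedDomain.exists_lintegral_strip_le (hΩ : IsC2BoundedDomain Ω) (hd : 0 < d) {s : ℝ}
    (hs : 0 < s) (hs1 : s ≤ 1 / 2) :
    ∃ C δ₁ : ℝ, 0 < C ∧ 0 < δ₁ ∧ ∀ u : L2 Ω, MemHs s u → ∀ δ, 0 < δ → δ ≤ δ₁ → δ ≤ 1 →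
      ∫⁻ x in strip Ω (3 * δ), ENNReal.ofReal (|u x| ^ 2) ≤
        ENNReal.ofReal (C * δ ^ (s / d) * hsNorm s u ^ 2) := by
  obtain ⟨c, C, δ₀, hc, hC, hδ₀, hvol, hball⟩ := hΩ.exists_strip_regular
  have hd' : (0:ℝ) < d := by exact_mod_cast hd
  have hd1 : (1:ℝ) ≤ d := by exact_mod_cast hd
  refine ⟨2 / c * (1 + 3 * C), min (δ₀ / 3) (δ₀ ^ (2 * (d : ℝ))), by positivity, by positivity,
    fun u hu δ hδ hδ1 hδle => ?_⟩
  have h3 : 3 * δ ≤ δ₀ := by linarith [hδ1.trans (min_le_left _ _)]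
  -- The averaging radius must be much larger than the strip. Here `η^d = δ^(1/2)` still dominates
  -- the strip volume, of order `δ`, and the seminorm term keeps the factor `η^(2s) = δ^(s/d)`.
  set η := δ ^ (1 / (2 * (d : ℝ))) with hη
  have hη0 : 0 < η := by positivity
  have hηle : η ≤ δ₀ := by
    have := hδ1.trans (min_le_right _ _)
    calc η ≤ (δ₀ ^ (2 * (d : ℝ))) ^ (1 / (2 * (d : ℝ))) := by
          rw [hη]; gcongr
      _ = δ₀ := by rw [← Real.rpow_mul hδ₀.le, mul_one_div_cancel (by positivity), Real.rpow_one]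
  have hηd : η ^ d = δ ^ (1 / 2 : ℝ) := by
    rw [hη, ← Real.rpow_natCast, ← Real.rpow_mul hδ.le]
    congr 1; field_simp
  have hηs : η ^ ((d : ℝ) + 2 * s) = δ ^ (1 / 2 : ℝ) * δ ^ (s / d) := by
    rw [hη, ← Real.rpow_mul hδ.le, ← Real.rpow_add hδ]
    congr 1; field_simp
  have hsub : strip Ω (3 * δ) ⊆ strip Ω δ₀ := inter_subset_inter_right _ (thickening_mono h3 _)
  have h1 := lintegral_sq_strip_le hΩ.isOpen u hη0 hs (S := strip Ω (3 * δ)) inter_subset_left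
    (measurableSet_strip hΩ.isOpen _) (m := c * η ^ d) fun x hx => hball x (hsub hx) η hη0 hηle
  have hv := hvol (3 * δ) (by positivity) h3
  set G := (gagliardoSq s u).toReal
  have hG : gagliardoSq s u = ENNReal.ofReal G := (ENNReal.ofReal_toReal (ne_of_lt hu)).symm
  have hG0 : 0 ≤ G := ENNReal.toReal_nonneg
  have hQ : hsNorm s u ^ 2 = ‖u‖ ^ 2 + G := Real.sq_sqrt (by positivity)
  have h2 : ENNReal.ofReal (c * η ^ d) * ∫⁻ x in strip Ω (3 * δ), ENNReal.ofReal (|u x| ^ 2) ≤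
      ENNReal.ofReal (2 * (η ^ ((d : ℝ) + 2 * s) * G) + 2 * (‖u‖ ^ 2 * (C * (3 * δ)))) := by
    refine h1.trans ?_
    rw [lintegral_sq_eq, hG, ENNReal.ofReal_add (by positivity) (by positivity),
      ENNReal.ofReal_mul (p := 2) (by norm_num),
      ENNReal.ofReal_mul (p := η ^ ((d : ℝ) + 2 * s)) (by positivity),
      ENNReal.ofReal_mul (p := 2) (by norm_num),
      ENNReal.ofReal_mul (p := ‖u‖ ^ 2) (by positivity)]
    simp only [ENNReal.ofReal_ofNat]
    gcongr
  have hm0 : 0 < c * η ^ d := by positivity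
  have h4 : ∫⁻ x in strip Ω (3 * δ), ENNReal.ofReal (|u x| ^ 2) ≤ ENNReal.ofReal
      ((2 * (η ^ ((d : ℝ) + 2 * s) * G) + 2 * (‖u‖ ^ 2 * (C * (3 * δ)))) / (c * η ^ d)) := by
    rw [ENNReal.ofReal_div_of_pos hm0, ENNReal.le_div_iff_mul_le
      (.inl (ENNReal.ofReal_pos.2 hm0).ne') (.inl ENNReal.ofReal_ne_top), mul_comm]
    exact h2
  refine h4.trans (ENNReal.ofReal_le_ofReal ?_)
  rw [hηd, hηs, hQ, div_le_iff₀ (by positivity)]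
  have hsplit : δ = δ ^ (1 / 2 : ℝ) * δ ^ (1 / 2 : ℝ) := by
    rw [← Real.rpow_add hδ]; norm_num
  have hexp : δ ^ (1 / 2 : ℝ) ≤ δ ^ (s / d) := by
    refine rpow_le_rpow_of_le_one hδ hδle ?_
    rw [div_le_iff₀ hd']; nlinarith
  set X := δ ^ (1 / 2 : ℝ)
  set Y := δ ^ (s / d)
  have hX : 0 < X := by positivity
  have hY : 0 < Y := by positivity
  have e : 2 / c * (1 + 3 * C) * Y * (‖u‖ ^ 2 + G) * (c * X) =
      2 * (1 + 3 * C) * Y * (‖u‖ ^ 2 + G) * X := by field_simp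
  rw [e]
  calc _ = 2 * (X * Y * G) + 2 * (‖u‖ ^ 2 * (C * (3 * (X * X)))) := by rw [← hsplit]
    _ ≤ 2 * (X * Y * G) + 2 * (‖u‖ ^ 2 * (C * (3 * (X * Y)))) := by gcongr
    _ ≤ 2 * (X * Y * G) + 2 * (‖u‖ ^ 2 * (C * (3 * (X * Y)))) + 6 * C * (X * Y * G) +
        2 * (X * Y * ‖u‖ ^ 2) := by
        have : 0 ≤ 6 * C * (X * Y * G) := by positivity
        have : 0 ≤ 2 * (X * Y * ‖u‖ ^ 2) := by positivity
        linarith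
    _ = _ := by ring

theorem norm_le_hsNorm (s : ℝ) (u : L2 Ω) : ‖u‖ ≤ hsNorm s u :=
  Real.le_sqrt_of_sq_le (by linarith [ENNReal.toReal_nonneg (a := gagliardoSq s u)])

/-- Functions of `H^s(Ω)` are approximated in `L²(Ω)` by functions of `H¹₀(Ω)` at a polynomial
rate. -/
theorem IsC2BoundedDomain.exists_approx (hΩ : IsC2BoundedDomain Ω) (hd : 0 < d) {s : ℝ}
    (hs : 0 < s) (hs1 : s ≤ 1 / 2) :
    ∃ C κ N : ℝ, 0 < C ∧ 0 < κ ∧ 0 < N ∧ ∀ u : L2 Ω, MemHs s u → ∀ δ, 0 < δ → δ ≤ 1 →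
      ∃ w : H10 Ω, ‖u - w.1.fst‖ ≤ C * hsNorm s u * δ ^ κ ∧ ‖w‖ ≤ C * hsNorm s u * δ ^ (-N) := by
  obtain ⟨C, δ₁, hC, hδ₁, hstrip⟩ := hΩ.exists_lintegral_strip_le hd hs hs1
  obtain ⟨A, L, hA, hL, hmol⟩ := exists_isMollifier d
  have hd' : (0:ℝ) < d := by exact_mod_cast hd
  have hd1 : (1:ℝ) ≤ d := by exact_mod_cast hd
  set b := (volume (ball (0 : Space d) 1)).toReal
  have hb0 : 0 ≤ b := ENNReal.toReal_nonneg
  -- The squared error is of order `δ^(s/d)`; the square root halves the exponent. The cost exponent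
  -- `d + 1` is that of the gradient of the mollifier.
  set κ := s / d / 2
  set C₁ := Real.sqrt (A ^ 2 * b * (1 + b * C))
  set C₂ := (d + 1) * ((A + L) * (volume Ω).toReal)
  have hC₂ : 0 ≤ C₂ := by positivity
  have hC₁ : 0 ≤ C₁ := Real.sqrt_nonneg _
  refine ⟨C₁ + C₂ + 1 + δ₁ ^ (-κ), κ, d + 1, by positivity, by positivity, by positivity,
    fun u hu δ hδ hδle => ?_⟩
  have hh0 : 0 ≤ hsNorm s u := Real.sqrt_nonneg _
  have hun := norm_le_hsNorm s u
  rcases le_or_gt δ δ₁ with hδ1 | hδ1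
  · obtain ⟨ψ, hψ⟩ := hmol δ hδ
    obtain ⟨w, hw1, hw2⟩ := hψ.exists_H10 hA.le hL hδ hδle hΩ.isOpen hΩ.isBounded u
    refine ⟨w, ?_, ?_⟩
    · set G := (gagliardoSq s u).toReal
      have hG : gagliardoSq s u = ENNReal.ofReal G := (ENNReal.ofReal_toReal (ne_of_lt hu)).symm
      have hG0 : 0 ≤ G := ENNReal.toReal_nonneg
      have hQ : hsNorm s u ^ 2 = ‖u‖ ^ 2 + G := Real.sq_sqrt (by positivity)
      have hvol : volume (ball (0 : Space d) δ) = ENNReal.ofReal (δ ^ d * b) := by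
        rw [Measure.addHaar_ball_of_pos _ _ hδ, finrank_euclideanSpace, Fintype.card_fin,
          ENNReal.ofReal_mul (by positivity), ENNReal.ofReal_toReal measure_ball_lt_top.ne]
      have hE : ∫⁻ x in Ω, localEnergy u δ x ≤ ENNReal.ofReal (δ ^ ((d : ℝ) + 2 * s) * G) := by
        rw [ENNReal.ofReal_mul (by positivity), ← hG]
        exact lintegral_localEnergy_le hΩ.isOpen u hδ hs
      have hX : ENNReal.ofReal ((A / δ ^ d) ^ 2) * (((∫⁻ x in Ω, localEnergy u δ x) +
          (∫⁻ x in strip Ω (3 * δ), ENNReal.ofReal (|u x| ^ 2)) * volume (ball (0 : Space d) δ)) *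
          volume (ball (0 : Space d) δ)) ≤ ENNReal.ofReal ((A / δ ^ d) ^ 2 *
            ((δ ^ ((d : ℝ) + 2 * s) * G + C * δ ^ (s / d) * hsNorm s u ^ 2 * (δ ^ d * b)) *
              (δ ^ d * b))) := by
        rw [ENNReal.ofReal_mul (by positivity), ENNReal.ofReal_mul (by positivity),
          ENNReal.ofReal_add (by positivity) (by positivity),
          ENNReal.ofReal_mul (p := C * δ ^ (s / d) * hsNorm s u ^ 2) (by positivity), hvol]
        gcongr
        exact hstrip u hu δ hδ hδ1 hδle
      refine (hw2 _ (by positivity) hX).trans ?_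
      have hexp : δ ^ (2 * s) ≤ δ ^ (s / d) := by
        refine rpow_le_rpow_of_le_one hδ hδle ?_
        rw [div_le_iff₀ hd']; nlinarith
      have e1 : δ ^ ((d : ℝ) + 2 * s) = δ ^ d * δ ^ (2 * s) := by
        rw [Real.rpow_add hδ, Real.rpow_natCast]
      have hle : (A / δ ^ d) ^ 2 *
            ((δ ^ ((d : ℝ) + 2 * s) * G + C * δ ^ (s / d) * hsNorm s u ^ 2 * (δ ^ d * b)) *
              (δ ^ d * b)) ≤ A ^ 2 * b * (1 + b * C) * (δ ^ κ * hsNorm s u) ^ 2 := by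
        have e2 : (δ ^ κ) ^ 2 = δ ^ (s / d) := by
          rw [← Real.rpow_natCast, ← Real.rpow_mul hδ.le]
          congr 1; simp only [κ]; push_cast; ring
        rw [mul_pow, e2, e1]
        have e3 : (A / δ ^ d) ^ 2 *
            ((δ ^ d * δ ^ (2 * s) * G + C * δ ^ (s / d) * hsNorm s u ^ 2 * (δ ^ d * b)) *
              (δ ^ d * b)) =
            A ^ 2 * b * (δ ^ (2 * s) * G + b * C * (δ ^ (s / d) * hsNorm s u ^ 2)) := by
          field_simp
        rw [e3]
        have hGQ : G ≤ hsNorm s u ^ 2 := by rw [hQ]; nlinarith [sq_nonneg ‖u‖]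
        calc _ ≤ A ^ 2 * b * (δ ^ (s / d) * hsNorm s u ^ 2 +
              b * C * (δ ^ (s / d) * hsNorm s u ^ 2)) := by gcongr
          _ = _ := by ring
      refine (Real.sqrt_le_sqrt hle).trans ?_
      rw [Real.sqrt_mul (by positivity), Real.sqrt_sq (by positivity)]
      change C₁ * _ ≤ _
      have hk : 0 ≤ δ ^ κ * hsNorm s u := by positivity
      have h5 : 0 ≤ C₂ + 1 + δ₁ ^ (-κ) := by positivity
      nlinarith [mul_nonneg h5 hk]
    · refine hw1.trans ?_
      have hk : 0 ≤ δ ^ (-((d : ℝ) + 1)) := by positivity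
      have h5 : C₂ ≤ C₁ + C₂ + 1 + δ₁ ^ (-κ) := by
        have : 0 < δ₁ ^ (-κ) := by positivity
        linarith
      have : C₂ * ‖u‖ ≤ (C₁ + C₂ + 1 + δ₁ ^ (-κ)) * hsNorm s u := by gcongr
      exact mul_le_mul_of_nonneg_right this hk
  -- For `δ` not small the zero function suffices, at the price of the term `δ₁^(-κ)` in the
  -- constant.
  · refine ⟨0, ?_, ?_⟩
    · have h5 : 1 ≤ δ₁ ^ (-κ) * δ ^ κ := by
        rw [Real.rpow_neg hδ₁.le, ← div_eq_inv_mul, le_div_iff₀ (by positivity), one_mul]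
        gcongr
      have h6 : (0:ℝ) < δ ^ κ := by positivity
      have e : u - (0 : H10 Ω).1.fst = u := sub_zero u
      rw [e]
      calc ‖u‖ ≤ hsNorm s u * 1 := by linarith
        _ ≤ hsNorm s u * (δ₁ ^ (-κ) * δ ^ κ) := by gcongr
        _ ≤ _ := by
            have : 0 ≤ (C₁ + C₂ + 1) * (hsNorm s u * δ ^ κ) := by positivity
            linarith
    · rw [norm_zero]
      positivity

end Approximation

/-! ### Weak solutions -/

section Time

open Filter Topology

theorem openTime_subset_Ioi (T : ℝ≥0∞) : openTime T ⊆ Ioi 0 := fun _ ht => ht.1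

theorem measurableSet_openTime (T : ℝ≥0∞) : MeasurableSet (openTime T) :=
  measurableSet_Ioi.inter (measurableSet_lt ENNReal.measurable_ofReal measurable_const)

theorem openTime_eq_Ioo {T : ℝ≥0∞} (hT : T ≠ ⊤) : openTime T = Ioo 0 T.toReal := by
  ext t
  refine and_congr_right fun ht => ?_
  rw [← ENNReal.ofReal_lt_iff_lt_toReal ht.le hT]

variable {E : Type*} [NormedAddCommGroup E] [NormedSpace ℝ E]

/-- Integration by parts for a merely integrable `g`, by Fubini on the triangle `s ≤ t`; the
boundary terms vanish because `η` is supported inside the interval. -/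
theorem integral_deriv_smul_primitive [CompleteSpace E] {T : ℝ} {g : ℝ → E}
    (hg : IntegrableOn g (Ioc 0 T)) (x : E)
    {η : ℝ → ℝ} (hη : ContDiff ℝ ∞ η) (hs : tsupport η ⊆ Ioo 0 T) :
    ∫ t in Ioo 0 T, deriv η t • (x + primitive g t) = -∫ t in Ioo 0 T, η t • g t := by
  rcases le_or_gt T 0 with hT | hT
  · simp [Ioo_eq_empty (not_lt.2 hT)]
  have hηT : η T = 0 := image_eq_zero_of_notMem_tsupport fun h => lt_irrefl _ (hs h).2
  have hη0 : η 0 = 0 := image_eq_zero_of_notMem_tsupport fun h => lt_irrefl _ (hs h).1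
  have hdc : Continuous (deriv η) := hη.continuous_deriv (by simp)
  have hftc : ∀ s ≤ T, ∫ t in Ioc s T, deriv η t = -η s := fun s hsT => by
    rw [← intervalIntegral.integral_of_le hsT, intervalIntegral.integral_deriv_eq_sub
      (fun t _ => (hη.differentiable (by simp)) t) (hdc.intervalIntegrable _ _), hηT, zero_sub]
  have hdi : IntegrableOn (deriv η) (Ioc 0 T) := hdc.integrableOn_Ioc
  have hloc : ∀ S, IntegrableOn ((Ioc 0 T).indicator g) (Ioc 0 S) := fun S =>
    ((integrable_indicator_iff measurableSet_Ioc).2 hg).integrableOn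
  have hprim : ∀ t ∈ Ioc 0 T, primitive g t = primitive ((Ioc 0 T).indicator g) t := fun t ht => by
    rw [primitive, primitive, setIntegral_indicator measurableSet_Ioc,
      inter_eq_left.2 (Ioc_subset_Ioc_right ht.2)]
  have hpi : IntegrableOn (fun t => deriv η t • primitive g t) (Ioc 0 T) := by
    have : Continuous fun t => deriv η t • primitive ((Ioc 0 T).indicator g) t :=
      hdc.smul (continuous_primitive_of_local hloc)
    exact (this.integrableOn_Ioc).congr_fun (fun t ht => by simp only [hprim t ht])
      measurableSet_Ioc
  set μ := volume.restrict (Ioc 0 T)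
  have hprod : Integrable (fun z : ℝ × ℝ => deriv η z.1 • g z.2) (μ.prod μ) := hdi.smul_prod hg
  let D : Set (ℝ × ℝ) := {z | z.2 ≤ z.1}
  have hD : MeasurableSet D := measurableSet_le measurable_snd measurable_fst
  have hswap := integral_integral_swap (f := fun t s => D.indicator
    (fun z : ℝ × ℝ => deriv η z.1 • g z.2) (t, s)) (hprod.indicator hD)
  have e1 : ∫ t, ∫ s, D.indicator (fun z : ℝ × ℝ => deriv η z.1 • g z.2) (t, s) ∂μ ∂μ =
      ∫ t, deriv η t • primitive g t ∂μ := by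
    refine setIntegral_congr_fun measurableSet_Ioc fun t ht => ?_
    have : (fun s => D.indicator (fun z : ℝ × ℝ => deriv η z.1 • g z.2) (t, s)) =
        (Iic t).indicator fun s => deriv η t • g s := by
      ext s
      by_cases h : s ≤ t
      · rw [indicator_of_mem (show (t, s) ∈ D from h), indicator_of_mem (mem_Iic.2 h)]
      · rw [indicator_of_notMem (show (t, s) ∉ D from h), indicator_of_notMem (s := Iic t) h]
    simp only [this]
    rw [integral_indicator measurableSet_Iic, Measure.restrict_restrict measurableSet_Iic,
      integral_smul, primitive]
    congr 3
    ext s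
    exact ⟨fun h => ⟨h.2.1, h.1⟩, fun h => ⟨h.2, h.1, h.2.trans ht.2⟩⟩
  have e2 : ∫ s, ∫ t, D.indicator (fun z : ℝ × ℝ => deriv η z.1 • g z.2) (t, s) ∂μ ∂μ =
      ∫ s, -(η s • g s) ∂μ := by
    refine setIntegral_congr_fun measurableSet_Ioc fun s hs' => ?_
    have : (fun t => D.indicator (fun z : ℝ × ℝ => deriv η z.1 • g z.2) (t, s)) =
        (Ici s).indicator fun t => deriv η t • g s := by
      ext t
      by_cases h : s ≤ t
      · rw [indicator_of_mem (show (t, s) ∈ D from h), indicator_of_mem (mem_Ici.2 h)]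
      · rw [indicator_of_notMem (show (t, s) ∉ D from h), indicator_of_notMem (s := Ici s) h]
    simp only [this]
    rw [integral_indicator measurableSet_Ici, Measure.restrict_restrict measurableSet_Ici,
      integral_smul_const, ← neg_smul, ← hftc s hs'.2, ← integral_Icc_eq_integral_Ioc]
    congr 3
    ext t
    exact ⟨fun h => ⟨h.1, h.2.2⟩, fun h => ⟨h.1, hs'.1.trans_le h.1, h.2⟩⟩
  rw [← integral_Ioc_eq_integral_Ioo, ← integral_Ioc_eq_integral_Ioo]
  simp only [smul_add]
  rw [integral_add (hdi.smul_const x) hpi, integral_smul_const, hftc 0 hT.le, hη0, neg_zero,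
    zero_smul, zero_add]
  change ∫ t, deriv η t • primitive g t ∂μ = _
  rw [← e1, hswap, e2, integral_neg]

end Time

/-! ### Weak solutions and the transformed equation in `L²(Ω)`. -/

section WeakSolution

open Filter Topology

variable {d : ℕ} {Ω : Set (Space d)} {a : Fin d → Fin d → Space d → ℝ} {V : Space d → ℝ}
  {R : L2 Ω →L[ℝ] L2 Ω} {k : Hneg1 Ω → L2 Ω} {α : ℝ} {T : ℝ≥0∞} {u₀ : L2 Ω} {u₁ : Hneg1 Ω}
  {f u : ℝ → L2 Ω}

/-- The operator `R` and the map `k` reduce the elliptic problem with parameter to an equation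
in `L²(Ω)`. -/
def ReducesDirichlet (a : Fin d → Fin d → Space d → ℝ) (V : Space d → ℝ) (R : L2 Ω →L[ℝ] L2 Ω)
    (k : Hneg1 Ω → L2 Ω) : Prop :=
  ∀ (q : ℝ) (g W : L2 Ω) (ν : ℝ) (ℓ : Hneg1 Ω),
    SolvesDirichlet a V q g ν ℓ W ↔ W + q • R W = R g + ν • k ℓ

theorem laplaceOn_openTime (f : ℝ → L2 Ω) (p : ℝ) :
    laplaceOn (openTime T) f p =
      ∫ t in Ioi (0:ℝ), Real.exp (-p * t) • (openTime T).indicator f t := by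
  simp only [← indicator_smul_apply (openTime T) (fun t => Real.exp (-p * t)) f]
  rw [setIntegral_indicator (measurableSet_openTime T),
    inter_eq_right.2 (openTime_subset_Ioi T), laplaceOn]

/-- An infimum equal to `0` provides, for each `p > 0`, an admissible `ε ≤ p`, hence integrability
against `e^(-pt)` for every `p > 0`. -/
theorem IsWeakSolution.exists_solvesTransformed (hRk : ReducesDirichlet a V R k)
    (h : IsWeakSolution a V α T u₀ u₁ f u) :
    ∃ v : ℝ → L2 Ω, v =ᵐ[volume.restrict (openTime T)] u ∧
      (∀ p : ℝ, 0 < p → IntegrableOn (fun t => Real.exp (-p * t) • v t) (Ioi 0)) ∧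
      SolvesTransformed R α u₀ (k u₁) ((openTime T).indicator f) v := by
  obtain ⟨v, -, hvu, hglb, hv⟩ := h
  refine ⟨v, hvu, fun p hp => ?_, fun p hp => ?_⟩
  · obtain ⟨ε, hε, -, hlt⟩ := hglb.exists_between hp
    exact integrableOn_exp_smul_of_lt hlt.le hε.2
  · have := (hRk _ _ _ _ _).1 (hv p hp)
    rwa [laplaceOn_openTime] at this

/-- A solution given for all positive times is its own extension `v`; the set of admissible `ε` is
then all of `(0, ∞)`, with infimum `0`. -/
theorem isWeakSolution_of_solvesTransformed (hRk : ReducesDirichlet a V R k)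
    (hloc : ∀ R : ℝ, 0 < R → MemLp u (⊤ : ℝ≥0∞) (volume.restrict (Ioo 0 R)))
    (hi : ∀ p : ℝ, 0 < p → IntegrableOn (fun t => Real.exp (-p * t) • u t) (Ioi 0))
    (h : SolvesTransformed R α u₀ (k u₁) ((openTime T).indicator f) u) :
    IsWeakSolution a V α T u₀ u₁ f u := by
  refine ⟨u, hloc, .rfl, ?_, fun p hp => ?_⟩
  · have : {ε : ℝ | 0 < ε ∧ IntegrableOn (fun t => Real.exp (-ε * t) • u t) (Ioi 0)} = Ioi 0 := by
      ext ε
      exact ⟨fun h => h.1, fun h => ⟨h, hi ε h⟩⟩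
    rw [this]
    exact isGLB_Ioi
  · rw [hRk, laplaceOn_openTime]
    exact h p hp

theorem hasW11Deriv_of_ae_eq {τ D : ℝ} (hτ : 0 ≤ τ) {u m g : ℝ → L2 Ω}
    (hmc : ContinuousOn m (Ici 0)) (hD : ∀ t, 0 ≤ t → ‖m t‖ ≤ D)
    (hum : u =ᵐ[volume.restrict (Ioo 0 τ)] m) (hgi : IntegrableOn g (Ioc 0 τ))
    (hg : ∀ᵐ t ∂volume.restrict (Ioc 0 τ), m t = u₀ + primitive g t) :
    HasW11Deriv (Ioo 0 τ) u g ∧ ∫ t in Ioo 0 τ, ‖u t‖ ≤ τ * D := by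
  have hmi : IntegrableOn m (Ioo 0 τ) :=
    ((hmc.mono fun t ht => ht.1 : ContinuousOn m (Icc 0 τ)).integrableOn_Icc).mono_set
      Ioo_subset_Icc_self
  have hsub : Ioo 0 τ ⊆ Ioc 0 τ := Ioo_subset_Ioc_self
  have hug : ∀ᵐ t ∂volume.restrict (Ioo 0 τ), u t = u₀ + primitive g t := by
    filter_upwards [hum, ae_restrict_of_ae_restrict_of_subset hsub hg] with t h1 h2
    rw [h1, h2]
  refine ⟨⟨hmi.congr hum.symm, hgi.mono_set hsub, fun η h1 _ h3 => ?_⟩, ?_⟩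
  · rw [← integral_deriv_smul_primitive hgi u₀ h1 h3]
    refine integral_congr_ae ?_
    filter_upwards [hug] with t ht
    rw [ht]
  · have e : ∫ t in Ioo 0 τ, ‖u t‖ = ∫ t in Ioo 0 τ, ‖m t‖ :=
      integral_congr_ae (hum.mono fun t ht => by simp only [ht])
    rw [e]
    refine (setIntegral_mono_on hmi.norm (integrableOn_const (by simp)) measurableSet_Ioo
      fun t ht => hD t ht.1.le).trans_eq ?_
    rw [setIntegral_const, Real.volume_real_Ioo_of_le hτ, sub_zero, smul_eq_mul]

end WeakSolution

end FracWave

end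


/-! ### Proof of the theorem. -/

open FracWave in
set_option maxHeartbeats 1000000 in
theorem theorem1p2
    (d : ℕ) (hd : d = 2 ∨ d = 3)
    (Ω : Set (FracWave.Space d)) (hΩ : FracWave.IsC2BoundedDomain Ω)
    (a : Fin d → Fin d → FracWave.Space d → ℝ)
    (ha_symm : ∀ i j, ∀ x ∈ closure Ω, a i j x = a j i x)
    (ha_C1 : ∀ i j, ContDiffOn ℝ 1 (a i j) (closure Ω))
    (c : ℝ) (hc : 0 < c)
    (ha_ell : ∀ x ∈ closure Ω, ∀ ξ : FracWave.Space d,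
      c * ‖ξ‖ ^ 2 ≤ ∑ i, ∑ j, a i j x * ξ i * ξ j)
    (κ : ℝ≥0∞) (hκ : (d : ℝ≥0∞) < κ)
    (V : FracWave.Space d → ℝ) (hV : MemLp V κ (volume.restrict Ω))
    (hV_nonneg : ∀ᵐ x ∂(volume.restrict Ω), 0 ≤ V x)
    (α : ℝ) (hα₁ : 1 < α) (hα₂ : α < 2)
    (T : ℝ≥0∞) (hT : 0 < T) :
    (∃ C : ℝ, 0 < C ∧
      ∀ (u₀ : FracWave.L2 Ω) (u₁ : FracWave.Hneg1 Ω) (f : ℝ → FracWave.L2 Ω),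
        IntegrableOn f (FracWave.openTime T) →
        ∃ u : ℝ → FracWave.L2 Ω,
          ContinuousOn u (FracWave.closedTime T) ∧
          FracWave.IsWeakSolution a V α T u₀ u₁ f u ∧
          (∀ w : ℝ → FracWave.L2 Ω, FracWave.IsWeakSolution a V α T u₀ u₁ f w →
            w =ᵐ[volume.restrict (FracWave.openTime T)] u) ∧
          ∀ t ∈ FracWave.closedTime T,
            ‖u t‖ ≤ C * (‖u₀‖ + ‖u₁‖ + ∫ s in FracWave.openTime T, ‖f s‖)) ∧
    (T ≠ (⊤ : ℝ≥0∞) → ∀ r : ℝ, 0 < r → r < 1 / 4 → ∃ C : ℝ, 0 < C ∧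
      ∀ (u₀ : FracWave.L2 Ω) (u₁ : FracWave.Hneg1 Ω) (f : ℝ → FracWave.L2 Ω),
        IntegrableOn f (FracWave.openTime T) → FracWave.MemHs (2 * r) u₀ →
        ∀ u : ℝ → FracWave.L2 Ω, FracWave.IsWeakSolution a V α T u₀ u₁ f u →
          ∃ u' : ℝ → FracWave.L2 Ω,
            FracWave.HasW11Deriv (FracWave.openTime T) u u' ∧
            (∫ t in FracWave.openTime T, ‖u t‖) + (∫ t in FracWave.openTime T, ‖u' t‖)
              ≤ C * (FracWave.hsNorm (2 * r) u₀ + ‖u₁‖ +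
                  ∫ s in FracWave.openTime T, ‖f s‖)) := by
  have hd0 : 0 < d := by omega
  have hκ2 : 2 ≤ κ := by
    refine le_trans ?_ hκ.le
    have : 2 ≤ d := by omega
    exact_mod_cast this
  have hF := isEllipticForm_ellipticForm hd hΩ.isOpen hΩ.isBounded ha_symm
    (fun i j => (ha_C1 i j).continuousOn) hc ha_ell hκ2 hV hV_nonneg
  obtain ⟨R, k, S, hR, hS, hk, hw, hRk⟩ := exists_inverse_ellipticForm hΩ.isOpen hF
  obtain ⟨θ, hθ⟩ := exists_sectorAngle hα₁ hα₂
  obtain ⟨Φ, hΦ⟩ := exists_isCalculus hR.symm hR.nonneg (le_refl ‖R‖)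
  -- The initial velocity enters through `k u₁ = R^(1/2) h`, with `‖h‖` controlled by the dual norm.
  have hvel : ∀ ℓ : Hneg1 Ω, ∃ h : L2 Ω, Φ (powMap ‖R‖ (1 / 2) one_half_pos.le) h = k ℓ ∧
      ‖h‖ ≤ S * ‖ℓ‖ := fun ℓ => hΦ.exists_sqrt hR (by positivity) (hk ℓ)
  obtain ⟨C, hC, hbound⟩ := exists_norm_mildSolution_le (H := L2 Ω) hθ ‖R‖
  have hfi : ∀ f : ℝ → L2 Ω, IntegrableOn f (openTime T) →
      IntegrableOn ((openTime T).indicator f) (Ioi 0) := fun f hf =>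
    ((integrable_indicator_iff (measurableSet_openTime T)).2 hf).integrableOn
  have hfn : ∀ f : ℝ → L2 Ω, ∫ t in Ioi (0:ℝ), ‖(openTime T).indicator f t‖ =
      ∫ t in openTime T, ‖f t‖ := fun f => by
    simp only [norm_indicator_eq_indicator_norm]
    rw [setIntegral_indicator (measurableSet_openTime T), inter_eq_right.2 (openTime_subset_Ioi T)]
  have hsolves : ∀ (u₀ h : L2 Ω) (u₁ : Hneg1 Ω) (f : ℝ → L2 Ω), IntegrableOn f (openTime T) →
      Φ (powMap ‖R‖ (1 / 2) one_half_pos.le) h = k u₁ →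
      SolvesTransformed R α u₀ (k u₁) ((openTime T).indicator f)
        (mildSolution Φ α θ u₀ h ((openTime T).indicator f)) := fun u₀ h u₁ f hf hh p hp => by
    rw [← hh]
    exact (laplace_mildSolution hΦ hθ u₀ h (hfi f hf) hp).2
  have huniq : ∀ (u₀ h : L2 Ω) (u₁ : Hneg1 Ω) (f w : ℝ → L2 Ω), IntegrableOn f (openTime T) →
      Φ (powMap ‖R‖ (1 / 2) one_half_pos.le) h = k u₁ →
      IsWeakSolution a V α T u₀ u₁ f w → w =ᵐ[volume.restrict (openTime T)]
        mildSolution Φ α θ u₀ h ((openTime T).indicator f) := fun u₀ h u₁ f w hf hh hws => by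
    obtain ⟨v, hvw, hvi, hv⟩ := hws.exists_solvesTransformed hRk
    have := SolvesTransformed.ae_eq hR hv (hsolves u₀ h u₁ f hf hh) hvi
      fun p hp => (laplace_mildSolution hΦ hθ u₀ h (hfi f hf) hp).1
    exact hvw.symm.trans (ae_restrict_of_ae_restrict_of_subset (openTime_subset_Ioi T) this)
  have hest : ∀ (u₀ h : L2 Ω) (u₁ : Hneg1 Ω) (f : ℝ → L2 Ω), IntegrableOn f (openTime T) →
      ‖h‖ ≤ S * ‖u₁‖ → ∀ t, 0 ≤ t →
      ‖mildSolution Φ α θ u₀ h ((openTime T).indicator f) t‖ ≤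
        C * (1 + S) * (‖u₀‖ + ‖u₁‖ + ∫ s in openTime T, ‖f s‖) :=
    fun u₀ h u₁ f hf hh t ht => by
    refine (hbound R Φ hΦ u₀ h _ (hfi f hf) t ht).trans ?_
    rw [hfn, mul_assoc]
    have hI : 0 ≤ ∫ s in openTime T, ‖f s‖ := integral_nonneg fun _ => norm_nonneg _
    gcongr
    have : 0 ≤ S * (‖u₀‖ + ∫ s in openTime T, ‖f s‖) := by positivity
    nlinarith [norm_nonneg u₁]
  refine ⟨⟨C * (1 + S), by positivity, fun u₀ u₁ f hf => ?_⟩, fun hTtop r hr hr4 => ?_⟩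
  · obtain ⟨h, hh, hhn⟩ := hvel u₁
    have hcont := continuousOn_mildSolution hΦ hR hθ u₀ h (hfi f hf)
    -- The source is extended by zero after `T`, so the mild solution exists for all times and
    -- serves every `T` at once, including infinity.
    refine ⟨mildSolution Φ α θ u₀ h ((openTime T).indicator f), hcont.mono fun t ht => ht.1, ?_,
      fun w hw => huniq u₀ h u₁ f w hf hh hw, fun t ht => hest u₀ h u₁ f hf hhn t ht.1⟩
    refine isWeakSolution_of_solvesTransformed hRk (fun r _ => ?_)
      (fun p hp => (laplace_mildSolution hΦ hθ u₀ h (hfi f hf) hp).1) (hsolves u₀ h u₁ f hf hh)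
    have hsub : Ioo 0 r ⊆ Ici 0 := fun t ht => ht.1.le
    refine memLp_top_of_bound ((hcont.mono hsub).aestronglyMeasurable measurableSet_Ioo) _
      ((ae_restrict_iff' measurableSet_Ioo).2 (.of_forall fun t ht =>
        hest u₀ h u₁ f hf hhn t ht.1.le))
  · obtain ⟨C₁, κ₁, N, hC₁, hκ₁, hN, happ⟩ := hΩ.exists_approx hd0 (s := 2 * r) (by linarith)
      (by linarith)
    obtain ⟨C₂, hC₂, hder⟩ := exists_mildSolution_eq_primitive hΦ hR hθ hκ₁ hN T.toReal
    have hTr : 0 < T.toReal := ENNReal.toReal_pos hT.ne' hTtop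
    set A := (1 + S) * C₁
    refine ⟨T.toReal * (C * (1 + S)) + C₂ * (1 + A + S), by positivity,
      fun u₀ u₁ f hf hu₀ u hu => ?_⟩
    obtain ⟨h, hh, hhn⟩ := hvel u₁
    have hQ : 0 ≤ hsNorm (2 * r) u₀ := Real.sqrt_nonneg _
    have hI : 0 ≤ ∫ s in openTime T, ‖f s‖ := integral_nonneg fun _ => norm_nonneg _
    -- The approximants lie in `H¹₀(Ω)`, hence in the range of `R^(1/2)` with bound `S ‖w‖`; the
    -- factor `1 + S` in `A` covers both the error and this cost.
    have happrox : Approximable R κ₁ N (A * hsNorm (2 * r) u₀) u₀ := by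
      intro δ hδ hδ1
      obtain ⟨w, hw1, hw2⟩ := happ u₀ hu₀ δ hδ hδ1
      refine ⟨w.1.fst, hw1.trans ?_, fun x => (hw w x).trans ?_⟩
      · gcongr
        nlinarith
      · refine mul_le_mul_of_nonneg_right ?_ (Real.sqrt_nonneg _)
        calc S * ‖w‖ ≤ (1 + S) * (C₁ * hsNorm (2 * r) u₀ * δ ^ (-N)) := by
              gcongr; linarith
          _ = _ := by simp only [A]; ring
    obtain ⟨g, hgi, hg, hgn⟩ := hder u₀ h _ (A * hsNorm (2 * r) u₀) (by positivity) happrox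
      (hfi f hf)
    rw [hfn] at hgn
    set m := mildSolution Φ α θ u₀ h ((openTime T).indicator f)
    have hmild : u =ᵐ[volume.restrict (Ioo 0 T.toReal)] m := by
      rw [← openTime_eq_Ioo hTtop]
      exact huniq u₀ h u₁ f u hf hh hu
    have hme : ∀ t, 0 ≤ t → ‖m t‖ ≤ C * (1 + S) * (‖u₀‖ + ‖u₁‖ + ∫ s in openTime T, ‖f s‖) :=
      hest u₀ h u₁ f hf hhn
    obtain ⟨hw11, b1⟩ := hasW11Deriv_of_ae_eq hTr.le
      (continuousOn_mildSolution hΦ hR hθ u₀ h (hfi f hf)) hme hmild hgi hg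
    rw [openTime_eq_Ioo hTtop] at hI hgn b1 ⊢
    refine ⟨g, hw11, ?_⟩
    rw [← integral_Ioc_eq_integral_Ioo (f := fun t => ‖g t‖)]
    generalize ∫ s in Ioo 0 T.toReal, ‖f s‖ = F at hI hgn b1 ⊢
    have hun := norm_le_hsNorm (2 * r) u₀
    calc _ ≤ T.toReal * (C * (1 + S) * (hsNorm (2 * r) u₀ + ‖u₁‖ +
          F)) + C₂ * (A * hsNorm (2 * r) u₀ + S * ‖u₁‖ +
            F) := by
          refine add_le_add ((b1.trans ?_)) (hgn.trans ?_)
          · gcongr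
          · gcongr
      _ ≤ T.toReal * (C * (1 + S) * (hsNorm (2 * r) u₀ + ‖u₁‖ +
          F)) + C₂ * ((1 + A + S) * (hsNorm (2 * r) u₀ + ‖u₁‖ +
            F)) := by
          gcongr
          have hA : 0 ≤ A := by positivity
          have hSP : 0 ≤ S := by positivity
          have hu1 := norm_nonneg u₁
          nlinarith [mul_nonneg hA hu1, mul_nonneg hA hI, mul_nonneg hSP hI, mul_nonneg hSP hQ]
      _ = _ := by ring
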